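/- Let $S=\Gamma\backslash\mathbb H^2$ be a complete connected orientable hyperbolic surface, where $\Gamma$ is a discrete group of orientation-preserving isometries acting freely on the hyperbolic plane $\mathbb H^2$. Assume that $S$ has finite area and at most one cusp. A multicurve on $S$ is a continuous map $m\colon M\to S$ from a finite disjoint union $M$ of oriented circles. Its length is the sum of the lengths of the closed curves obtained by restricting $m$ to the circles (so multiply covered curves count with multiplicity). It represents the class in $H_1(S,\mathbb Z)$ of the singular $1$-cycle that it defines. The multicurve $m$ is called embedded if its image is a union of finitely many pairwise disjoint simple closed curves on $S$; the components of $m$ may cover these curves several times. Let $h\in H_1(S,\mathbb Z)$ be a non-trivial homology class. Then: 1. Among all multicurves representing $h$ there is one of minimal (finite) length, and it can be chosen embedded, with every component a closed geodesic (possibly multiply covered, parametrized with constant positive speed). 2. Every multicurve of minimal length representing $h$, none of whose components is a constant map, is embedded, and each of its components is a closed geodesic (possibly multiply covered) up to an orientation-preserving weakly monotone reparametrization of the circle. -/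

import Mathlib

open Set UpperHalfPlane MeasureTheory CategoryTheory AlgebraicTopology Simplicial
open scoped MatrixGroups ENNReal

noncomputable section

/-! ### Hyperbolic surfaces as quotients of the upper half-plane -/

/-- The quotient `S = Γ \ ℍ`, as a set. -/
def HypSurface (Γ : Subgroup SL(2, ℝ)) : Type := MulAction.orbitRel.Quotient Γ ℍ

namespace HypSurface

variable (Γ : Subgroup SL(2, ℝ))

/-- The projection `ℍ → Γ \ ℍ`. -/
def proj (z : ℍ) : HypSurface Γ := Quotient.mk (MulAction.orbitRel Γ ℍ) z

variable {Γ}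

lemma proj_surjective : Function.Surjective (proj Γ) := Quotient.mk_surjective

lemma proj_eq_proj_iff {z w : ℍ} : proj Γ z = proj Γ w ↔ ∃ γ : Γ, γ • w = z := by
  exact (Quotient.eq (r := MulAction.orbitRel Γ ℍ)).trans MulAction.orbitRel_apply

lemma proj_smul (γ : Γ) (z : ℍ) : proj Γ (γ • z) = proj Γ z :=
  proj_eq_proj_iff.2 ⟨γ, rfl⟩

/-- The quotient distance: the infimum of the hyperbolic distances between lifts. -/
instance : Dist (HypSurface Γ) :=
  ⟨fun p q ↦ sInf {r | ∃ z w : ℍ, proj Γ z = p ∧ proj Γ w = q ∧ dist z w = r}⟩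

lemma dist_def (p q : HypSurface Γ) :
    dist p q = sInf {r | ∃ z w : ℍ, proj Γ z = p ∧ proj Γ w = q ∧ dist z w = r} := rfl

lemma dist_smul_smul (γ : Γ) (z w : ℍ) : dist (γ • z) (γ • w) = dist z w :=
  dist_smul (γ : SL(2, ℝ)) z w

lemma bddBelow_dist (p q : HypSurface Γ) :
    BddBelow {r | ∃ z w : ℍ, proj Γ z = p ∧ proj Γ w = q ∧ dist z w = r} :=
  ⟨0, by rintro _ ⟨z, w, -, -, rfl⟩; exact dist_nonneg⟩

lemma dist_proj_le (z w : ℍ) : dist (proj Γ z) (proj Γ w) ≤ dist z w :=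
  csInf_le (bddBelow_dist _ _) ⟨z, w, rfl, rfl, rfl⟩

lemma dist_proj_nonneg (p q : HypSurface Γ) : 0 ≤ dist p q :=
  Real.sInf_nonneg (by rintro _ ⟨z, w, -, -, rfl⟩; exact dist_nonneg)

lemma exists_lift_dist_lt {z : ℍ} {q : HypSurface Γ} {r : ℝ} (h : dist (proj Γ z) q < r) :
    ∃ w : ℍ, proj Γ w = q ∧ dist z w < r := by
  obtain ⟨w₀, rfl⟩ := proj_surjective q
  rw [dist_def] at h
  obtain ⟨_, ⟨z', w', hz, hw, rfl⟩, hr⟩ := exists_lt_of_csInf_lt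
    (by exact ⟨_, z, w₀, rfl, rfl, rfl⟩) h
  obtain ⟨γ, rfl⟩ := proj_eq_proj_iff.1 hz.symm
  exact ⟨γ • w', (proj_smul _ _).trans hw, by rwa [dist_smul_smul]⟩

instance : PseudoMetricSpace (HypSurface Γ) where
  dist_self p := by
    obtain ⟨z, rfl⟩ := proj_surjective p
    exact le_antisymm ((dist_proj_le z z).trans_eq (dist_self z)) (dist_proj_nonneg _ _)
  dist_comm p q := by
    rw [dist_def, dist_def]
    congr 1
    ext r
    exact ⟨fun ⟨z, w, h₁, h₂, h₃⟩ ↦ ⟨w, z, h₂, h₁, by rw [dist_comm, h₃]⟩,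
      fun ⟨z, w, h₁, h₂, h₃⟩ ↦ ⟨w, z, h₂, h₁, by rw [dist_comm, h₃]⟩⟩
  dist_triangle p q r := by
    obtain ⟨z, rfl⟩ := proj_surjective p
    refine le_of_forall_pos_lt_add fun ε hε ↦ ?_
    obtain ⟨w, rfl, hw⟩ := exists_lift_dist_lt
      (show dist (proj Γ z) q < dist (proj Γ z) q + ε / 2 by linarith)
    obtain ⟨u, rfl, hu⟩ := exists_lift_dist_lt
      (show dist (proj Γ w) r < dist (proj Γ w) r + ε / 2 by linarith)
    have h₁ := dist_proj_le (Γ := Γ) z u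
    have h₂ := dist_triangle z w u
    linarith

/-- The topology given by the quotient distance is the quotient topology of `Γ \ ℍ`. -/
lemma isOpenQuotientMap_proj : IsOpenQuotientMap (proj Γ) where
  surjective := proj_surjective
  continuous := (LipschitzWith.of_dist_le_mul (K := 1)
    (fun z w ↦ by simpa using dist_proj_le z w)).continuous
  isOpenMap := by
    intro U hU
    rw [Metric.isOpen_iff] at hU ⊢
    rintro _ ⟨z, hz, rfl⟩
    obtain ⟨ε, hε, hball⟩ := hU z hz
    refine ⟨ε, hε, fun q hq ↦ ?_⟩
    rw [Metric.mem_ball, dist_comm] at hq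
    obtain ⟨w, rfl, hw⟩ := exists_lift_dist_lt hq
    exact ⟨w, hball (by rwa [Metric.mem_ball, dist_comm]), rfl⟩

variable (Γ)

/-- The hyperbolic area of `Γ \ ℍ`: the least hyperbolic area (for `dx dy / y ^ 2`) of a
measurable subset of `ℍ` that meets every orbit. -/
def area : ℝ≥0∞ :=
  ⨅ D : {D : Set ℍ // MeasurableSet D ∧ proj Γ '' D = univ}, volume D.1

/-- `Γ` is discrete and its image in `PSL(2, ℝ)` acts freely on `ℍ`, so that `Γ \ ℍ` is a
complete connected orientable hyperbolic surface; every such surface arises in this way. -/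
structure IsSurfaceGroup : Prop where
  discrete : DiscreteTopology Γ
  free : ∀ γ : Γ, ∀ z : ℍ, γ • z = z → ∀ w : ℍ, γ • w = w

/-- The surface `Γ \ ℍ` has at most one cusp: all fixed points of parabolic elements of `Γ` on
the boundary circle `ℝ ∪ {∞}` are equivalent under `Γ`. -/
def AtMostOneCusp : Prop :=
  ∀ c d : OnePoint ℝ,
    IsCusp c (Γ.map (Matrix.SpecialLinearGroup.mapGL ℝ)) →
    IsCusp d (Γ.map (Matrix.SpecialLinearGroup.mapGL ℝ)) →
    ∃ γ ∈ Γ, Matrix.SpecialLinearGroup.mapGL ℝ γ • c = d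

end HypSurface

/-! ### The class of a loop in singular homology -/

/-- The first singular homology group `H₁(X, ℤ)`. -/
abbrev SingularH1 (X : Type) [TopologicalSpace X] : ModuleCat.{0} ℤ :=
  ((singularHomologyFunctor (ModuleCat.{0} ℤ) 1).obj (ModuleCat.of ℤ ℤ)).obj (TopCat.of X)

section LoopClass

variable {X : Type} [TopologicalSpace X]

/-- The path `[0, 1] → ℝ / ℤ → X` of a loop, as a morphism of topological spaces. -/
def loopPath (c : C(UnitAddCircle, X)) : (TopCat.I : TopCat.{0}) ⟶ TopCat.of X :=
  TopCat.ofHom (X := ULift unitInterval) (Y := X)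
    (c.comp ⟨fun t ↦ ((t.down : ℝ) : UnitAddCircle),
      (AddCircle.continuous_mk' 1).comp (continuous_subtype_val.comp continuous_uliftDown)⟩)

/-- The singular `1`-simplex of a loop. -/
def loopSimplex (c : C(UnitAddCircle, X)) : (TopCat.toSSet.obj (TopCat.of X)) _⦋1⦌ :=
  TopCat.toSSetObj₁Equiv.symm (loopPath c)

/-- The singular chain `1 • loopSimplex c`, as a homomorphism from `ℤ` to the singular chains. -/
def loopChain (c : C(UnitAddCircle, X)) : ModuleCat.of ℤ ℤ ⟶
    (((singularChainComplexFunctor (ModuleCat.{0} ℤ)).obj (ModuleCat.of ℤ ℤ)).obj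
      (TopCat.of X)).X 1 :=
  (TopCat.toSSet.obj (TopCat.of X)).ιChainComplex (loopSimplex c)

lemma loopChain_d (c : C(UnitAddCircle, X)) :
    loopChain c ≫ (((singularChainComplexFunctor (ModuleCat.{0} ℤ)).obj
      (ModuleCat.of ℤ ℤ)).obj (TopCat.of X)).d 1 0 = 0 := by
  refine ((TopCat.toSSet.obj (TopCat.of X)).ιChainComplex_d (ModuleCat.of ℤ ℤ) (loopSimplex c)).trans ?_
  have h₀ : loopPath c 1 = loopPath c 0 :=
    show c ((1 : ℝ) : UnitAddCircle) = c ((0 : ℝ) : UnitAddCircle) from congrArg c (by simp)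
  have h : (TopCat.toSSet.obj (TopCat.of X)).δ 0 (loopSimplex c) =
      (TopCat.toSSet.obj (TopCat.of X)).δ 1 (loopSimplex c) :=
    (TopCat.δ_zero_toSSetObj₁Equiv.symm (loopPath c)).trans
      ((congrArg _ h₀).trans (TopCat.δ_one_toSSetObj₁Equiv.symm (loopPath c)).symm)
  rw [Fin.sum_univ_two, h]
  simp
  rfl

/-- The class in `H₁(X, ℤ)` of the singular cycle `1 • loopSimplex c`. -/
def loopClass (c : C(UnitAddCircle, X)) : SingularH1 X :=
  (HomologicalComplex.liftCycles _ (loopChain c) 0 (by simp) (loopChain_d c) ≫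
    HomologicalComplex.homologyπ _ 1).hom (1 : ℤ)

end LoopClass

/-! ### Multicurves -/

/-- A multicurve: a continuous map to `X` from a closed oriented `1`-manifold, that is, from a
disjoint union of finitely many oriented circles `ℝ / ℤ`. -/
structure Multicurve (X : Type*) [TopologicalSpace X] where
  /-- the number of circles -/
  n : ℕ
  /-- the restriction of the map to each circle -/
  component : Fin n → C(UnitAddCircle, X)

/-- The length of a closed curve: the supremum of the lengths of inscribed polygons. -/
def curveLength {X : Type*} [PseudoEMetricSpace X] (c : C(UnitAddCircle, X)) : ℝ≥0∞ :=
  eVariationOn (fun t : ℝ ↦ c (t : UnitAddCircle)) (Icc 0 1)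

/-- A closed geodesic, parametrized by `ℝ / ℤ` with constant speed `v > 0`: it is locally
distance-minimizing. It may run several times around a shorter closed geodesic. -/
def IsClosedGeodesic {X : Type*} [PseudoMetricSpace X] (c : C(UnitAddCircle, X)) : Prop :=
  ∃ v : ℝ, 0 < v ∧ ∀ t : ℝ, ∃ ε > 0, ∀ s ∈ Ioo (t - ε) (t + ε), ∀ s' ∈ Ioo (t - ε) (t + ε),
    dist (c (s : UnitAddCircle)) (c (s' : UnitAddCircle)) = v * |s - s'|

/-- The closed curve `c` is a closed geodesic up to an orientation-preserving, weakly monotone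
reparametrization of degree one of the circle. -/
def IsClosedGeodesicUpToParam {X : Type*} [PseudoMetricSpace X] (c : C(UnitAddCircle, X)) :
    Prop :=
  ∃ g : C(UnitAddCircle, X), IsClosedGeodesic g ∧
    ∃ φ : ℝ → ℝ, Continuous φ ∧ Monotone φ ∧ (∀ t, φ (t + 1) = φ t + 1) ∧
      ∀ t : ℝ, c (t : UnitAddCircle) = g (φ t : UnitAddCircle)

namespace Multicurve

/-- The sum of the lengths of the components. -/
def length {X : Type*} [PseudoEMetricSpace X] (m : Multicurve X) : ℝ≥0∞ :=
  ∑ i, curveLength (m.component i)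

/-- The image of `m` is a union of finitely many pairwise disjoint simple closed curves; the
components of `m` may cover these curves several times. -/
def IsEmbedded {X : Type*} [TopologicalSpace X] (m : Multicurve X) : Prop :=
  ∃ (k : ℕ) (σ : Fin k → C(UnitAddCircle, X)),
    (∀ j, Function.Injective (σ j)) ∧
    (∀ j j', j ≠ j' → Disjoint (range (σ j)) (range (σ j'))) ∧
    ⋃ i, range (m.component i) = ⋃ j, range (σ j)

/-- The class in `H₁(X, ℤ)` of the singular cycle defined by `m`. -/
def homologyClass {X : Type} [TopologicalSpace X] (m : Multicurve X) : SingularH1 X :=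
  ∑ i, loopClass (m.component i)

/-- `m` represents `h`, and no multicurve that represents `h` is shorter than `m`. -/
def IsMinimalFor {X : Type} [PseudoMetricSpace X] (m : Multicurve X) (h : SingularH1 X) : Prop :=
  m.homologyClass = h ∧ ∀ m' : Multicurve X, m'.homologyClass = h → m.length ≤ m'.length

end Multicurve

end

/-! A closed curve lifts to a path in ℍ with F (t + 1) = γ • F t for some γ in Γ. Its class in
homology is `cls Γ γ`, and its length is at least the displacement of F 0 under γ. Since `cls` is
multiplicative and reaches every class (`cls_mul`, `exists_cls_eq`), minimizing length over
multicurves becomes minimizing a sum of displacements over finite lists of elements of Γ.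

Regularity (`Multicurve.IsMinimalFor.isEmbedded`) is cut and paste. In a minimal multicurve every
component realizes the minimal displacement of its γ, so γ translates a geodesic and the component
runs monotonically along it (`exists_monotone_axis`). If two components meet, joining them at the
meeting point gives one loop with the same total length and homology class. Minimality forbids a
corner, so the two geodesics coincide (`geo_eq_of_two`). At a self-intersection the curve is split
into two loops, and again there can be no corner (`geo_eq_of_one`). Hence the images are simple and
pairwise equal or disjoint.

Existence (`exists_isMinimalFor`) needs two facts. The first is that elements of Γ which are not
translations along a geodesic are null-homologous. Elements with a fixed point are harmless. A
parabolic element has displacements tending to 0 without a minimum, and it may be dropped because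
there is only one cusp. With the cusp at ∞, the boundary of the Ford domain over one period of the
stabilizer is homologous to the loop around the cusp. The elements of Γ that pair its sides reverse
their direction, so the sides cancel (`CuspGroup.loop_eq_zero`). The second fact is that only
finitely many translation lengths lie below any bound. Then the sums of translation lengths are
well-ordered, although the number of components is not bounded in advance, and a least sum exists.

The finiteness holds because every geodesic meets a fixed compact set up to Γ
(`ProperFree.exists_vert_dist_le`), so a short translation is conjugate to an element moving i by a
bounded amount. This rests on a thick-thin decomposition (`ProperFree.thick_thin`): finite area
bounds the thick part by packing discs, and the thin tubes around closed geodesics are controlled by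
the contraction of commutators near the identity. -/

noncomputable section

/-! ### Geodesics of the upper half-plane -/

namespace HypGeom

lemma det_eq (g : SL(2, ℝ)) : g 0 0 * g 1 1 - g 0 1 * g 1 0 = 1 := by
  have := g.det_coe
  rwa [Matrix.det_fin_two] at this

lemma coe_smul (g : SL(2, ℝ)) (z : ℍ) :
    ((g • z : ℍ) : ℂ) = (g 0 0 * z + g 0 1) / (g 1 0 * z + g 1 1) := by
  simp [coe_specialLinearGroup_apply]

/-- The squared norm of the denominator `cz + d`. -/
def denSq (g : SL(2, ℝ)) (z : ℍ) : ℝ := (g 1 0 * z.re + g 1 1) ^ 2 + (g 1 0 * z.im) ^ 2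

lemma denSq_pos (g : SL(2, ℝ)) (z : ℍ) : 0 < denSq g z := by
  have hd := det_eq g
  have hy := z.im_pos
  unfold denSq
  by_cases hc : g 1 0 = 0
  · have : g 1 1 ≠ 0 := by
      intro h; rw [hc, h] at hd; norm_num at hd
    simpa [hc] using sq_pos_iff.2 this
  · have : 0 < (g 1 0 * z.im) ^ 2 := sq_pos_iff.2 (mul_ne_zero hc hy.ne')
    exact add_pos_of_nonneg_of_pos (sq_nonneg _) this

lemma re_smul (g : SL(2, ℝ)) (z : ℍ) :
    (g • z).re = ((g 0 0 * z.re + g 0 1) * (g 1 0 * z.re + g 1 1) +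
      g 0 0 * g 1 0 * z.im ^ 2) / denSq g z := by
  have h : (g • z).re = ((g • z : ℍ) : ℂ).re := rfl
  rw [h, coe_smul, Complex.div_re, denSq]
  simp only [Complex.normSq_apply]
  simp
  ring

lemma im_smul (g : SL(2, ℝ)) (z : ℍ) : (g • z).im = z.im / denSq g z := by
  have h : (g • z).im = ((g • z : ℍ) : ℂ).im := rfl
  have hd := det_eq g
  rw [h, coe_smul, Complex.div_im, denSq]
  simp only [Complex.normSq_apply]
  simp
  rw [← sub_div]
  congr 1
  · linear_combination z.im * hd
  · ring

lemma cosh_dist_eq (z w : ℍ) : Real.cosh (dist z w) =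
    1 + ((z.re - w.re) ^ 2 + (z.im - w.im) ^ 2) / (2 * z.im * w.im) := by
  rw [UpperHalfPlane.cosh_dist, Complex.dist_eq, ← Complex.normSq_eq_norm_sq, Complex.normSq_apply]
  simp [sq]

/-- The right side is the squared Frobenius norm. This converts small displacement of i into
closeness to ±1 as a matrix. -/
lemma cosh_dist_I_smul (g : SL(2, ℝ)) : 2 * Real.cosh (dist I (g • I)) =
    g 0 0 ^ 2 + g 0 1 ^ 2 + g 1 0 ^ 2 + g 1 1 ^ 2 := by
  have hd := det_eq g
  have hp := denSq_pos g I
  rw [cosh_dist_eq, re_smul, im_smul]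
  have hN : denSq g I = g 1 0 ^ 2 + g 1 1 ^ 2 := by simp [denSq]; ring
  -- Lagrange's identity for the two rows, with determinant 1.
  have h2 : (g 0 0 * g 1 0 + g 0 1 * g 1 1) ^ 2 =
      (g 0 0 ^ 2 + g 0 1 ^ 2) * (g 1 0 ^ 2 + g 1 1 ^ 2) - 1 := by
    linear_combination (-(g 0 0 * g 1 1 - g 0 1 * g 1 0 + 1)) * hd
  rw [← hN] at h2
  have h3 : g 1 0 ^ 2 = denSq g I - g 1 1 ^ 2 := by rw [hN]; ring
  simp only [I_re, I_im]
  rw [h3]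
  generalize denSq g I = N at *
  field_simp
  ring_nf
  linear_combination h2


/-- The point `i e ^ s`. -/
def vert (s : ℝ) : ℍ := ⟨⟨0, Real.exp s⟩, Real.exp_pos s⟩

@[simp] lemma vert_re (s : ℝ) : (vert s).re = 0 := rfl
@[simp] lemma vert_im (s : ℝ) : (vert s).im = Real.exp s := rfl

lemma vert_zero : vert 0 = I := by
  apply UpperHalfPlane.ext; apply Complex.ext <;> simp [vert]

lemma dist_vert (s t : ℝ) : dist (vert s) (vert t) = |s - t| := by
  rw [dist_of_re_eq (by simp)]
  simp [Real.dist_eq]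

lemma continuous_vert : Continuous vert :=
  (isometry_iff_dist_eq.2 fun s t ↦ (dist_vert s t).trans (Real.dist_eq s t).symm).continuous

lemma eq_vert {z : ℍ} (h : z.re = 0) : z = vert (Real.log z.im) := by
  apply UpperHalfPlane.ext; apply Complex.ext
  · simpa using h
  · simp [vert, Real.exp_log z.im_pos]

/-- The dilation `z ↦ e ^ L z`. -/
def dil (L : ℝ) : SL(2, ℝ) :=
  ⟨!![Real.exp (L / 2), 0; 0, Real.exp (-(L / 2))], by
    rw [Matrix.det_fin_two_of, ← Real.exp_add]; simp⟩

@[simp] lemma dil_00 (L : ℝ) : dil L 0 0 = Real.exp (L / 2) := rfl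
@[simp] lemma dil_01 (L : ℝ) : dil L 0 1 = 0 := rfl
@[simp] lemma dil_10 (L : ℝ) : dil L 1 0 = 0 := rfl
@[simp] lemma dil_11 (L : ℝ) : dil L 1 1 = Real.exp (-(L / 2)) := rfl

lemma denSq_dil (L : ℝ) (z : ℍ) : denSq (dil L) z = Real.exp (-L) := by
  simp only [denSq, dil_10, dil_11, zero_mul, zero_add, sq, mul_zero, add_zero, ← Real.exp_add]
  congr 1; ring

lemma dil_im (L : ℝ) (z : ℍ) : (dil L • z).im = Real.exp L * z.im := by
  rw [im_smul, denSq_dil, Real.exp_neg]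
  field_simp

lemma dil_re (L : ℝ) (z : ℍ) : (dil L • z).re = Real.exp L * z.re := by
  rw [re_smul, denSq_dil]
  simp only [dil_00, dil_01, dil_10, dil_11, Real.exp_neg]
  have : Real.exp L = Real.exp (L / 2) * Real.exp (L / 2) := by rw [← Real.exp_add]; ring_nf
  rw [this]
  field_simp
  ring

lemma hext {z w : ℍ} (h₁ : z.re = w.re) (h₂ : z.im = w.im) : z = w :=
  UpperHalfPlane.ext (Complex.ext h₁ h₂)

lemma dil_vert (L s : ℝ) : dil L • vert s = vert (s + L) :=
  hext (by simp [dil_re]) (by simp [dil_im, Real.exp_add, mul_comm])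

lemma dil_add (L M : ℝ) (z : ℍ) : dil (L + M) • z = dil L • dil M • z :=
  hext (by simp [dil_re, Real.exp_add, mul_assoc]) (by simp [dil_im, Real.exp_add, mul_assoc])

lemma dil_zero_smul (z : ℍ) : dil 0 • z = z := hext (by simp [dil_re]) (by simp [dil_im])

lemma dil_smul_dil_neg (L : ℝ) (z : ℍ) : dil L • dil (-L) • z = z := by
  rw [← dil_add]; simp [dil_zero_smul]

lemma log_im_le_dist (s : ℝ) (z : ℍ) : |Real.log z.im - s| ≤ dist (vert s) z := by
  have := dist_log_im_le (vert s) z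
  rwa [vert_im, Real.log_exp, dist_comm, Real.dist_eq] at this

/-- The vertical projection of z realizes the lower bound given by the heights. If z does so too,
the horizontal term in the formula for cosh must vanish. -/
lemma re_eq_zero_of_dist_vert {s : ℝ} {z : ℍ} (h : dist (vert s) z ≤ |Real.log z.im - s|) :
    z.re = 0 := by
  have h' : dist (vert s) z = dist (vert s) (vert (Real.log z.im)) := by
    rw [dist_vert, abs_sub_comm]
    exact le_antisymm h (log_im_le_dist s z)
  have := congrArg Real.cosh h'
  rw [cosh_dist_eq, cosh_dist_eq] at this
  simp only [vert_re, vert_im, Real.exp_log z.im_pos] at this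
  have hp : 0 < 2 * Real.exp s * z.im := by have := z.im_pos; positivity
  field_simp at this
  nlinarith

/-- A point on a shortest connection between two points of a vertical line. -/
lemma eq_vert_of_dist_add_le {L : ℝ} {p : ℍ}
    (h : dist (vert 0) p + dist p (vert L) ≤ L) : ∃ c, 0 ≤ c ∧ c ≤ L ∧ p = vert c := by
  have h1 := log_im_le_dist 0 p
  have h2 := log_im_le_dist L p
  rw [dist_comm] at h2
  set c := Real.log p.im
  have h3 := le_abs_self (c - 0)
  have h4 := neg_le_abs (c - L)
  have h5 := abs_nonneg (c - L)
  have h6 := abs_nonneg (c - 0)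
  refine ⟨c, ?_, ?_, eq_vert (re_eq_zero_of_dist_vert (s := 0) ?_)⟩
  · linarith
  · linarith
  · linarith

/-- The rotation about `i`. -/
def rot (θ : ℝ) : SL(2, ℝ) :=
  ⟨!![Real.cos θ, Real.sin θ; -Real.sin θ, Real.cos θ], by
    rw [Matrix.det_fin_two_of]; nlinarith [Real.sin_sq_add_cos_sq θ]⟩

@[simp] lemma rot_00 (L : ℝ) : rot L 0 0 = Real.cos L := rfl
@[simp] lemma rot_01 (L : ℝ) : rot L 0 1 = Real.sin L := rfl
@[simp] lemma rot_10 (L : ℝ) : rot L 1 0 = -Real.sin L := rfl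
@[simp] lemma rot_11 (L : ℝ) : rot L 1 1 = Real.cos L := rfl

lemma rot_smul_I (θ : ℝ) : rot θ • I = I := by
  have h := Real.sin_sq_add_cos_sq θ
  have hd : denSq (rot θ) I = 1 := by simp [denSq]
  apply hext
  · rw [re_smul, hd]; simp; ring
  · rw [im_smul, hd]; simp

/-- The numerator of the real part of `rot θ • w` takes opposite values at 0 and π/2, so it vanishes
in between. -/
lemma exists_rot_re (w : ℍ) : ∃ θ, (rot θ • w).re = 0 := by
  set f : ℝ → ℝ := fun θ ↦ (Real.cos θ * w.re + Real.sin θ) * (-Real.sin θ * w.re + Real.cos θ) +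
      Real.cos θ * (-Real.sin θ) * w.im ^ 2 with hf
  have hc : Continuous f := by fun_prop
  have h : ∃ θ, f θ = 0 := by
    have h0 : f 0 = w.re := by simp [f]
    have h1 : f (Real.pi / 2) = - w.re := by simp [f]
    have hpi : (0 : ℝ) ≤ Real.pi / 2 := by positivity
    rcases le_total 0 w.re with h | h
    · obtain ⟨θ, -, h⟩ := intermediate_value_Icc' hpi hc.continuousOn
        (show (0 : ℝ) ∈ Icc (f (Real.pi / 2)) (f 0) by rw [h0, h1]; constructor <;> linarith)
      exact ⟨θ, h⟩
    · obtain ⟨θ, -, h⟩ := intermediate_value_Icc hpi hc.continuousOn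
        (show (0 : ℝ) ∈ Icc (f 0) (f (Real.pi / 2)) by rw [h0, h1]; constructor <;> linarith)
      exact ⟨θ, h⟩
  obtain ⟨θ, hθ⟩ := h
  refine ⟨θ, ?_⟩
  rw [re_smul]
  simp only [rot_00, rot_01, rot_10, rot_11]
  simp only [hf] at hθ
  rw [hθ, zero_div]

lemma rot_pi_div_two_vert (s : ℝ) : rot (Real.pi / 2) • vert s = vert (-s) := by
  have hd : denSq (rot (Real.pi / 2)) (vert s) = Real.exp s ^ 2 := by simp [denSq]
  apply hext
  · rw [re_smul, hd]; simp
  · rw [im_smul, hd]; simp [Real.exp_neg]; field_simp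

lemma dist_smul' (g : SL(2, ℝ)) (z w : ℍ) : dist (g • z) (g • w) = dist z w := dist_smul g z w

/-- Any two points are joined by a geodesic segment. -/
lemma exists_geodesic (z w : ℍ) : ∃ g : SL(2, ℝ), z = g • vert 0 ∧ w = g • vert (dist z w) := by
  obtain ⟨θ, hθ⟩ := exists_rot_re (z.toSL2R⁻¹ • w)
  have key : ∃ k : SL(2, ℝ), ∃ s, 0 ≤ s ∧ k • z = vert 0 ∧ k • w = vert s := by
    have hz : (rot θ * z.toSL2R⁻¹) • z = vert 0 := by
      rw [vert_zero, mul_smul]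
      rw [show z.toSL2R⁻¹ • z = I by rw [inv_smul_eq_iff, toSL2R_smul_I], rot_smul_I]
    have hw : (rot θ * z.toSL2R⁻¹) • w = vert (Real.log (rot θ • z.toSL2R⁻¹ • w).im) := by
      rw [mul_smul]; exact eq_vert hθ
    rcases le_total 0 (Real.log (rot θ • z.toSL2R⁻¹ • w).im) with h | h
    · exact ⟨_, _, h, hz, hw⟩
    -- If w lands below i, the half-turn z ↦ -1/z about i moves it above.
    · refine ⟨rot (Real.pi / 2) * (rot θ * z.toSL2R⁻¹), _, neg_nonneg.2 h, ?_, ?_⟩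
      · rw [mul_smul, hz, rot_pi_div_two_vert, neg_zero]
      · rw [mul_smul, hw, rot_pi_div_two_vert]
  obtain ⟨k, s, hs, hz, hw⟩ := key
  have hd : dist z w = s := by
    rw [← dist_smul' k, hz, hw, dist_vert]; simp [abs_of_nonneg hs]
  refine ⟨k⁻¹, ?_, ?_⟩
  · rw [← hz, inv_smul_smul]
  · rw [hd, ← hw, inv_smul_smul]

/-- An element fixing two points of the imaginary axis acts trivially. -/
lemma smul_eq_self_of_fix_vert {k : SL(2, ℝ)} {t : ℝ} (ht : t ≠ 0) (h0 : k • vert 0 = vert 0)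
    (h1 : k • vert t = vert t) (z : ℍ) : k • z = z := by
  have hd := det_eq k
  have e0 := congrArg UpperHalfPlane.im h0
  have e1 := congrArg UpperHalfPlane.im h1
  have e2 := congrArg UpperHalfPlane.re h0
  have p0 := denSq_pos k (vert 0)
  have p1 := denSq_pos k (vert t)
  rw [im_smul, div_eq_iff p0.ne'] at e0
  rw [im_smul, div_eq_iff p1.ne'] at e1
  rw [re_smul, div_eq_iff p0.ne'] at e2
  simp only [denSq, vert_re, vert_im, Real.exp_zero] at e0 e1 e2
  have hE : Real.exp t ≠ 1 := by simpa using ht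
  have hE0 := Real.exp_pos t
  have e0' : k 1 0 ^ 2 + k 1 1 ^ 2 = 1 := by linarith
  have e1' : k 1 1 ^ 2 + k 1 0 ^ 2 * Real.exp t ^ 2 = 1 := by
    have : Real.exp t * (k 1 1 ^ 2 + k 1 0 ^ 2 * Real.exp t ^ 2) = Real.exp t * 1 := by linarith
    exact mul_left_cancel₀ hE0.ne' this
  have hc : k 1 0 = 0 := by
    have h3 : k 1 0 ^ 2 * ((Real.exp t - 1) * (Real.exp t + 1)) = 0 := by linarith
    have h4 : (Real.exp t - 1) * (Real.exp t + 1) ≠ 0 :=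
      mul_ne_zero (sub_ne_zero.2 hE) (by positivity)
    simpa [h4] using h3
  rw [hc] at e0' e2 hd
  have hdd : k 1 1 ^ 2 = 1 := by linarith
  have hb : k 0 1 = 0 := by
    have h5 : k 0 1 * k 1 1 = 0 := by linarith
    rcases mul_eq_zero.1 h5 with h | h
    · exact h
    · rw [h] at hdd; norm_num at hdd
  have hz : denSq k z = 1 := by simp [denSq, hc, hdd]
  apply hext
  · rw [re_smul, hz, hc, hb]; linear_combination z.re * hd
  · rw [im_smul, hz, div_one]

/-- Two parametrized geodesics with two common points, at the same times, coincide. -/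
lemma geodesic_unique {g k : SL(2, ℝ)} {a b t : ℝ} (ht : t ≠ 0) (h0 : g • vert a = k • vert b)
    (h1 : g • vert (a + t) = k • vert (b + t)) (u : ℝ) :
    g • vert (a + u) = k • vert (b + u) := by
  have e (x : ℝ) : (dil (-b) * k⁻¹ * g * dil a) • vert x = dil (-b) • k⁻¹ • g • vert (a + x) := by
    rw [mul_smul, mul_smul, mul_smul, dil_vert, add_comm x a]
  have := smul_eq_self_of_fix_vert (k := dil (-b) * k⁻¹ * g * dil a) ht
    (by rw [e, add_zero, h0, inv_smul_smul, dil_vert]; simp)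
    (by rw [e, h1, inv_smul_smul, dil_vert]; congr 1; ring) (vert u)
  rw [e] at this
  have h2 := congrArg (fun x : ℍ ↦ k • dil b • x) this
  simp only [dil_smul_dil_neg, smul_inv_smul] at h2
  rw [h2, dil_vert, add_comm]

/-- If `x` and `y` lie on a geodesic and `z` extends the segment from `x` to `y`,
then `z` lies on the geodesic. -/
lemma eq_geodesic_of_dist_add_le {g : SL(2, ℝ)} {a b : ℝ} (hab : a < b) {z : ℍ}
    (h : (b - a) + dist (g • vert b) z ≤ dist (g • vert a) z) :
    z = g • vert (b + dist (g • vert b) z) := by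
  obtain ⟨k, hk0, hk1⟩ := exists_geodesic (g • vert a) z
  have hd : dist (g • vert a) (g • vert b) = b - a := by
    rw [dist_smul', dist_vert, abs_sub_comm, abs_of_pos (by linarith)]
  have hba : 0 < b - a := by linarith
  have h0 : vert 0 = k⁻¹ • g • vert a := by rw [hk0, inv_smul_smul]
  -- Equality in the triangle inequality places `g • vert b` on the segment k from `g • vert a` to
  -- z. The geodesics of g and k then share two points and agree.
  obtain ⟨c, hc0, hc1, hc⟩ := eq_vert_of_dist_add_le (L := dist (g • vert a) z)
    (p := k⁻¹ • g • vert b) (by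
      rw [show vert (dist (g • vert a) z) = k⁻¹ • z by rw [eq_inv_smul_iff, ← hk1], h0,
        dist_smul' k⁻¹, dist_smul' k⁻¹, hd]
      exact h)
  have hcb : c = b - a := by
    have : dist (vert 0) (vert c) = b - a := by rw [← hc, h0, dist_smul', hd]
    rw [dist_vert] at this
    simpa [abs_of_nonneg hc0] using this
  have hc' : g • vert b = k • vert c := by rw [← hc, smul_inv_smul]
  have hdist : dist (g • vert a) z = b - a + dist (g • vert b) z :=
    le_antisymm ((dist_triangle _ (g • vert b) _).trans_eq (by rw [hd])) h
  have := geodesic_unique (g := g) (k := k) (a := a) (b := 0) hba.ne' hk0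
    (by rw [zero_add, ← hcb, ← hc', hcb]; congr 2; ring) (b - a + dist (g • vert b) z)
  rw [show b + dist (g • vert b) z = a + (b - a + dist (g • vert b) z) by ring, this, zero_add,
    ← hdist]
  exact hk1

/-! ### Translations -/

/-- `γ` translates the geodesic `g • vert` by `L`. -/
def IsTrans (γ g : SL(2, ℝ)) (L : ℝ) : Prop := ∀ z : ℍ, γ • g • z = g • dil L • z

lemma IsTrans.smul_vert {γ g : SL(2, ℝ)} {L : ℝ} (h : IsTrans γ g L) (s : ℝ) :
    γ • g • vert s = g • vert (s + L) := by rw [h, dil_vert]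

lemma IsTrans.conj {γ g : SL(2, ℝ)} {L : ℝ} (h : IsTrans γ g L) (δ : SL(2, ℝ)) :
    IsTrans (δ * γ * δ⁻¹) (δ * g) L := fun z ↦ by
  rw [mul_smul, mul_smul, mul_smul, inv_smul_smul, h, mul_smul]

lemma IsTrans.inv {γ g : SL(2, ℝ)} {L : ℝ} (h : IsTrans γ g L) : IsTrans γ⁻¹ g (-L) := fun z ↦ by
  rw [inv_smul_eq_iff, h, dil_smul_dil_neg]

lemma IsTrans.inv_smul_vert {γ g : SL(2, ℝ)} {L : ℝ} (h : IsTrans γ g L) (s : ℝ) :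
    γ⁻¹ • g • vert s = g • vert (s - L) := by rw [h.inv.smul_vert, sub_eq_add_neg]

/-- The logarithm of the height is 1-Lipschitz, and the dilation shifts it by L. -/
lemma le_dist_dil (L : ℝ) (z : ℍ) : |L| ≤ dist z (dil L • z) := by
  have := dist_log_im_le z (dil L • z)
  rwa [dil_im, Real.log_mul (Real.exp_pos L).ne' z.im_ne_zero, Real.log_exp, dist_comm,
    Real.dist_eq, add_sub_cancel_right] at this

lemma IsTrans.abs_le_dist {γ g : SL(2, ℝ)} {L : ℝ} (h : IsTrans γ g L) (z : ℍ) :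
    |L| ≤ dist z (γ • z) := by
  have := le_dist_dil L (g⁻¹ • z)
  rwa [← dist_smul' g, ← h, smul_inv_smul] at this

lemma IsTrans.le_dist {γ g : SL(2, ℝ)} {L : ℝ} (h : IsTrans γ g L) (z : ℍ) :
    L ≤ dist z (γ • z) := (le_abs_self L).trans (h.abs_le_dist z)

lemma IsTrans.dist_vert {γ g : SL(2, ℝ)} {L : ℝ} (h : IsTrans γ g L) (hL : 0 ≤ L) (s : ℝ) :
    dist (g • vert s) (γ • g • vert s) = L := by
  rw [h.smul_vert, dist_smul', HypGeom.dist_vert]; simp [abs_of_nonneg hL]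

/-- An isometry shifting two points of a geodesic is a translation. -/
lemma isTrans_of_two_points {γ g : SL(2, ℝ)} {a t L : ℝ} (ht : t ≠ 0)
    (h0 : γ • g • vert a = g • vert (a + L))
    (h1 : γ • g • vert (a + t) = g • vert (a + t + L)) : IsTrans γ g L := by
  have key (z : ℍ) : (dil (-a - L) * g⁻¹ * γ * g * dil a) • z = z := by
    apply smul_eq_self_of_fix_vert ht
    · simp only [mul_smul, dil_vert, zero_add, h0, inv_smul_smul]; congr 1; ring
    · simp only [mul_smul, dil_vert, add_comm t a, h1, inv_smul_smul]; congr 1; ring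
  intro z
  have := key (dil (-a) • z)
  simp only [mul_smul, dil_smul_dil_neg] at this
  have h2 := congrArg (fun x : ℍ ↦ g • dil (a + L) • x) this
  rw [show -a - L = -(a + L) by ring, dil_smul_dil_neg, smul_inv_smul, ← dil_add] at h2
  rw [h2]; congr 3; ring

/-- An isometry with a point of minimal positive displacement is a translation along
a geodesic through the point. -/
lemma exists_isTrans_of_min {γ : SL(2, ℝ)} {z : ℍ} (hpos : 0 < dist z (γ • z))
    (hmin : ∀ w : ℍ, dist z (γ • z) ≤ dist w (γ • w)) :
    ∃ g : SL(2, ℝ), IsTrans γ g (dist z (γ • z)) ∧ z = g • vert 0 := by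
  obtain ⟨g, hz, hγz⟩ := exists_geodesic z (γ • z)
  set L := dist z (γ • z) with hLdef
  refine ⟨g, ?_, hz⟩
  -- Test minimality at the midpoint of [z, γz]. Its image lies at distance L/2 from γz, so the
  -- broken path through γz has length L and, by minimality, no corner.
  have hm := hmin (g • vert (L / 2))
  have h2 : dist (g • vert L) (γ • g • vert (L / 2)) = L / 2 := by
    rw [← hγz, dist_smul', hz, dist_smul' g, HypGeom.dist_vert, abs_sub_comm, sub_zero,
      abs_of_pos (by linarith)]
  have h3 := eq_geodesic_of_dist_add_le (g := g) (a := L / 2) (b := L)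
    (z := γ • g • vert (L / 2)) (by linarith) (by rw [h2]; linarith)
  rw [h2] at h3
  refine isTrans_of_two_points (a := 0) (t := L / 2) (by linarith) ?_ ?_
  · rw [← hz, zero_add, hγz]
  · rw [zero_add, h3]; congr 2; ring

end HypGeom

/-! ### Properly discontinuous groups of isometries -/

namespace HypGeom

/-- `Γ` acts properly discontinuously on `ℍ`, and its image in `PSL(2, ℝ)` acts freely. -/
structure ProperFree (Γ : Subgroup SL(2, ℝ)) : Prop where
  finite : ∀ R : ℝ, {γ | γ ∈ Γ ∧ dist I (γ • I) ≤ R}.Finite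
  free : ∀ γ ∈ Γ, ∀ z : ℍ, γ • z = z → ∀ w : ℍ, γ • w = w

lemma _root_.HypSurface.IsSurfaceGroup.properFree {Γ : Subgroup SL(2, ℝ)}
    (hΓ : HypSurface.IsSurfaceGroup Γ) : ProperFree Γ where
  finite R := by
    have := hΓ.discrete
    have h := ProperlyDiscontinuousSMul.finite_disjoint_inter_image (Γ := Γ) (T := ℍ)
      (isCompact_singleton (x := I)) (isCompact_closedBall I R)
    refine (h.image (fun γ : Γ ↦ (γ : SL(2, ℝ)))).subset ?_
    rintro γ ⟨hγ, hd⟩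
    refine ⟨⟨γ, hγ⟩, ?_, rfl⟩
    have hmem : γ • I ∈ Metric.closedBall I R := by rwa [Metric.mem_closedBall, dist_comm]
    have hne : (((fun z : ℍ ↦ (⟨γ, hγ⟩ : Γ) • z) '' {I}) ∩ Metric.closedBall I R).Nonempty :=
      ⟨γ • I, ⟨I, rfl, rfl⟩, hmem⟩
    exact hne
  free γ hγ z h w := hΓ.free ⟨γ, hγ⟩ z h w

variable {Γ : Subgroup SL(2, ℝ)}

lemma ProperFree.finite_dist_le (hΓ : ProperFree Γ) (z : ℍ) (R : ℝ) :
    {γ | γ ∈ Γ ∧ dist z (γ • z) ≤ R}.Finite := by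
  refine (hΓ.finite (R + 2 * dist I z)).subset ?_
  rintro γ ⟨hγ, hd⟩
  refine ⟨hγ, ?_⟩
  have h1 := dist_triangle4 I z (γ • z) (γ • I)
  rw [dist_smul' γ, dist_comm z I] at h1
  linarith

/-- The group `g⁻¹ Γ g`. -/
def conjGroup (Γ : Subgroup SL(2, ℝ)) (g : SL(2, ℝ)) : Subgroup SL(2, ℝ) :=
  Γ.comap (MulAut.conj g).toMonoidHom

lemma mem_conjGroup {g γ : SL(2, ℝ)} : γ ∈ conjGroup Γ g ↔ g * γ * g⁻¹ ∈ Γ := by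
  simp [conjGroup, Subgroup.mem_comap]

lemma mem_conjGroup' {g γ : SL(2, ℝ)} : g⁻¹ * γ * g ∈ conjGroup Γ g ↔ γ ∈ Γ := by
  rw [mem_conjGroup]; congr! 1; group

lemma ProperFree.conj (hΓ : ProperFree Γ) (g : SL(2, ℝ)) : ProperFree (conjGroup Γ g) where
  finite R := by
    have h := hΓ.finite_dist_le (g • I) R
    refine (h.preimage (f := fun γ ↦ g * γ * g⁻¹) ?_).subset ?_
    · intro γ _ δ _ h
      simpa using h
    · rintro γ ⟨hγ, hd⟩
      refine ⟨mem_conjGroup.1 hγ, ?_⟩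
      rwa [mul_smul, mul_smul, inv_smul_smul, dist_smul' g]
  free γ hγ z h w := by
    have := hΓ.free _ (mem_conjGroup.1 hγ) (g • z)
      (by rw [mul_smul, mul_smul, inv_smul_smul, h]) (g • w)
    rwa [mul_smul, mul_smul, inv_smul_smul, smul_left_cancel_iff] at this

/-- Only finitely many elements move z by at most 1. Take r below all their non-zero displacements;
zero displacement means a fixed point, hence a trivial action. -/
lemma ProperFree.exists_injRadius (hΓ : ProperFree Γ) (z : ℍ) :
    ∃ r > 0, ∀ γ ∈ Γ, dist z (γ • z) < r → ∀ w : ℍ, γ • w = w := by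
  have hf := hΓ.finite_dist_le z 1
  set s : Set ℝ := {d | ∃ γ ∈ Γ, dist z (γ • z) ≤ 1 ∧ dist z (γ • z) = d ∧ d ≠ 0}
  have hsf : s.Finite := by
    refine (hf.image fun γ ↦ dist z (γ • z)).subset ?_
    rintro d ⟨γ, hγ, h1, h2, -⟩
    exact ⟨γ, ⟨hγ, h1⟩, h2⟩
  have hev : ∀ᶠ r in nhdsWithin (0 : ℝ) (Ioi 0), ∀ d ∈ s, r ≤ d := by
    rw [Filter.eventually_all_finite hsf]
    rintro d ⟨γ, hγ, h1, h2, h3⟩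
    have : 0 < d := lt_of_le_of_ne (h2 ▸ dist_nonneg) h3.symm
    exact Filter.mem_of_superset (Ioc_mem_nhdsGT this) fun x hx ↦ hx.2
  obtain ⟨r, ⟨hr, hr1⟩, hr0⟩ := ((hev.and (Filter.mem_of_superset
    (Ioc_mem_nhdsGT (zero_lt_one' ℝ)) fun x hx ↦ hx.2)).and self_mem_nhdsWithin).exists
  refine ⟨r, hr0, fun γ hγ h ↦ hΓ.free γ hγ z ?_⟩
  by_contra hne
  have hd : dist z (γ • z) ≠ 0 := by rw [dist_ne_zero]; exact Ne.symm hne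
  exact absurd (hr _ ⟨γ, hγ, (h.le.trans hr1), rfl, hd⟩) (not_le.2 h)

end HypGeom

/-! ### The covering map -/

namespace HypSurface

open HypGeom

variable {Γ : Subgroup SL(2, ℝ)}

lemma proj_eq_iff {z w : ℍ} : proj Γ z = proj Γ w ↔ ∃ γ ∈ Γ, γ • w = z := by
  rw [proj_eq_proj_iff]
  exact ⟨fun ⟨γ, h⟩ ↦ ⟨γ, γ.2, h⟩, fun ⟨γ, hγ, h⟩ ↦ ⟨⟨γ, hγ⟩, h⟩⟩

lemma proj_smul_mem {γ : SL(2, ℝ)} (hγ : γ ∈ Γ) (z : ℍ) : proj Γ (γ • z) = proj Γ z :=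
  proj_eq_iff.2 ⟨γ, hγ, rfl⟩

lemma continuous_proj : Continuous (proj Γ) := isOpenQuotientMap_proj.continuous

/-- For r as in `exists_injRadius`, use the ball of radius r/4. An element moving z by at least r
keeps any two lifts at least r/2 apart, which exceeds `dist x y`. -/
lemma exists_isometry_ball (hΓ : ProperFree Γ) (z : ℍ) :
    ∃ r > 0, ∀ x ∈ Metric.ball z r, ∀ y ∈ Metric.ball z r,
      dist (proj Γ x) (proj Γ y) = dist x y := by
  obtain ⟨r, hr, h⟩ := hΓ.exists_injRadius z
  refine ⟨r / 4, by positivity, fun x hx y hy ↦ ?_⟩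
  rw [Metric.mem_ball] at hx hy
  refine le_antisymm (dist_proj_le x y) ?_
  rw [dist_def]
  refine le_csInf ⟨_, x, y, rfl, rfl, rfl⟩ ?_
  rintro _ ⟨x', y', hx', hy', rfl⟩
  obtain ⟨γ, hγ, rfl⟩ := proj_eq_iff.1 hx'
  obtain ⟨δ, hδ, rfl⟩ := proj_eq_iff.1 hy'
  have e : dist (γ • x) (δ • y) = dist x ((γ⁻¹ * δ) • y) := by
    rw [← dist_smul' γ⁻¹, inv_smul_smul, mul_smul]
  rw [e]
  by_cases ht : dist z ((γ⁻¹ * δ) • z) < r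
  · rw [h _ (Γ.mul_mem (Γ.inv_mem hγ) hδ) ht]
  · have h1 := dist_triangle4 z x ((γ⁻¹ * δ) • y) ((γ⁻¹ * δ) • z)
    rw [dist_smul' (γ⁻¹ * δ), dist_comm z x] at h1
    have h2 := dist_triangle x z y
    rw [dist_comm z y] at h2
    linarith

lemma isCoveringMap_proj (hΓ : ProperFree Γ) : IsCoveringMap (proj Γ) := by
  -- The deck group is the image of Γ in the permutations of ℍ, because -1 may lie in Γ and acts
  -- trivially.
  let G := (MulAction.toPermHom Γ ℍ).range
  have hq : IsQuotientCoveringMap (proj Γ) G :=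
    { isOpenQuotientMap_proj.isQuotientMap with
      continuous_const_smul := by
        rintro ⟨_, γ, rfl⟩
        exact continuous_const_smul (γ : SL(2, ℝ))
      apply_eq_iff_mem_orbit := by
        intro z w
        rw [proj_eq_proj_iff, MulAction.mem_orbit_iff]
        constructor
        · rintro ⟨γ, h⟩
          exact ⟨⟨_, γ, rfl⟩, h⟩
        · rintro ⟨⟨_, γ, rfl⟩, h⟩
          exact ⟨γ, h⟩
      disjoint := by
        intro z
        obtain ⟨r, hr, h⟩ := hΓ.exists_injRadius z
        refine ⟨Metric.ball z (r / 2), Metric.ball_mem_nhds _ (by positivity), ?_⟩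
        rintro ⟨_, γ, rfl⟩ ⟨_, ⟨x, hx, rfl⟩, hy⟩
        have hy' : dist ((γ : SL(2, ℝ)) • x) z < r / 2 := hy
        rw [Metric.mem_ball] at hx
        have h1 := dist_triangle z ((γ : SL(2, ℝ)) • x) ((γ : SL(2, ℝ)) • z)
        rw [dist_smul' (γ : SL(2, ℝ)), dist_comm z ((γ : SL(2, ℝ)) • x)] at h1
        have := h γ γ.2 (by linarith)
        apply Subtype.ext
        ext1 w
        exact this w }
  exact hq.isCoveringMap

lemma exists_lift (hΓ : ProperFree Γ) {A : Type*} [TopologicalSpace A] [SimplyConnectedSpace A]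
    [LocallyPathConnectedSpace A] {f : A → HypSurface Γ} (hf : Continuous f) (a : A) (z : ℍ)
    (hz : proj Γ z = f a) : ∃ F : A → ℍ, Continuous F ∧ F a = z ∧ ∀ t, proj Γ (F t) = f t := by
  obtain ⟨F, ⟨h1, h2⟩, -⟩ :=
    (isCoveringMap_proj hΓ).existsUnique_continuousMap_lifts ⟨f, hf⟩ a z hz
  exact ⟨F, F.continuous, h1, fun t ↦ congrFun h2 t⟩

lemma lift_unique (hΓ : ProperFree Γ) {A : Type*} [TopologicalSpace A] [SimplyConnectedSpace A]
    [LocallyPathConnectedSpace A] {F F' : A → ℍ} (hF : Continuous F) (hF' : Continuous F') (a : A)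
    (ha : F a = F' a) (h : ∀ t, proj Γ (F t) = proj Γ (F' t)) (t : A) : F t = F' t := by
  obtain ⟨G, -, h3⟩ := (isCoveringMap_proj hΓ).existsUnique_continuousMap_lifts
    ⟨fun t ↦ proj Γ (F t), continuous_proj.comp hF⟩ a (F a) rfl
  have e1 := h3 ⟨F, hF⟩ ⟨rfl, rfl⟩
  have e2 := h3 ⟨F', hF'⟩ ⟨ha.symm, funext fun t ↦ (h t).symm⟩
  exact congrArg (fun f : C(A, ℍ) ↦ f t) (e1.trans e2.symm)

/-- Closed curves lift to curves that are equivariant under the translation by `1`. -/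
lemma exists_lift_loop (hΓ : ProperFree Γ) (c : C(UnitAddCircle, HypSurface Γ)) :
    ∃ F : ℝ → ℍ, Continuous F ∧ (∀ t : ℝ, proj Γ (F t) = c t) ∧
      ∃ γ ∈ Γ, ∀ t, F (t + 1) = γ • F t := by
  obtain ⟨z, hz⟩ := proj_surjective (c ((0 : ℝ) : UnitAddCircle))
  obtain ⟨F, hF, -, h⟩ := exists_lift hΓ (f := fun t : ℝ ↦ c (t : UnitAddCircle))
    (c.continuous.comp (AddCircle.continuous_mk' 1)) 0 z hz
  have hper (t : ℝ) : proj Γ (F (t + 1)) = proj Γ (F t) := by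
    rw [h, h, AddCircle.coe_add_period]
  obtain ⟨γ, hγ, hγ'⟩ := proj_eq_iff.1 (hper 0)
  refine ⟨F, hF, h, γ, hγ, fun t ↦ ?_⟩
  exact lift_unique hΓ (F := fun t ↦ F (t + 1)) (F' := fun t ↦ γ • F t)
    (hF.comp (continuous_add_const 1)) (hF.const_smul γ) 0 hγ'.symm
    (fun t ↦ by rw [hper, proj_smul_mem hγ]) t

/-! ### Lengths -/

lemma eVariationOn_congr_edist {α E E' : Type*} [LinearOrder α] [PseudoEMetricSpace E]
    [PseudoEMetricSpace E'] {f : α → E} {g : α → E'} {s : Set α}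
    (h : ∀ x ∈ s, ∀ y ∈ s, edist (f x) (f y) = edist (g x) (g y)) :
    eVariationOn f s = eVariationOn g s := by
  unfold eVariationOn
  refine iSup_congr fun p ↦ Finset.sum_congr rfl fun i _ ↦ h _ (p.2.2.2 _) _ (p.2.2.2 _)

/-- Subdivide [a, b] so that F maps each piece into a ball on which the projection is isometric, and
use additivity of the variation. -/
lemma eVariationOn_proj (hΓ : ProperFree Γ) {F : ℝ → ℍ} (hF : Continuous F) {a b : ℝ}
    (hab : a ≤ b) :
    eVariationOn (fun t ↦ proj Γ (F t)) (Icc a b) = eVariationOn F (Icc a b) := by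
  choose r hr hiso using exists_isometry_ball hΓ
  obtain ⟨t, ht0, htm, ⟨m, hm⟩, ht⟩ := exists_monotone_Icc_subset_open_cover_Icc hab
    (c := fun z : ℍ ↦ ((↑) : Icc a b → ℝ) ⁻¹' (F ⁻¹' Metric.ball z (r z)))
    (fun z ↦ (Metric.isOpen_ball.preimage hF).preimage continuous_subtype_val)
    (fun x _ ↦ mem_iUnion.2 ⟨F x, Metric.mem_ball_self (hr _)⟩)
  have hmono : Monotone fun n ↦ (t n : ℝ) := fun i j hij ↦ htm hij
  have key := eVariationOn.sum' F hmono (n := m)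
  have key' := eVariationOn.sum' (fun t ↦ proj Γ (F t)) hmono (n := m)
  simp only [ht0, hm m le_rfl] at key key'
  rw [← key, ← key']
  refine Finset.sum_congr rfl fun i _ ↦ eVariationOn_congr_edist fun x hx y hy ↦ ?_
  obtain ⟨z, hz⟩ := ht i
  have mem {x} (hx : x ∈ Icc (t i : ℝ) (t (i + 1))) : F x ∈ Metric.ball z (r z) :=
    hz (show (⟨x, (t i).2.1.trans hx.1, hx.2.trans (t (i + 1)).2.2⟩ : Icc a b) ∈
      Icc (t i) (t (i + 1)) from hx)
  rw [edist_dist, edist_dist, hiso z _ (mem hx) _ (mem hy)]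

lemma curveLength_eq (hΓ : ProperFree Γ) {c : C(UnitAddCircle, HypSurface Γ)} {F : ℝ → ℍ}
    (hF : Continuous F) (h : ∀ t ∈ Icc (0 : ℝ) 1, c (t : UnitAddCircle) = proj Γ (F t)) :
    curveLength c = eVariationOn F (Icc 0 1) := by
  rw [← eVariationOn_proj hΓ hF zero_le_one]
  exact eVariationOn.congr h

lemma eVariationOn_geodesic (g : SL(2, ℝ)) {v a b : ℝ} (hv : 0 ≤ v) (hab : a ≤ b) :
    eVariationOn (fun t : ℝ ↦ g • vert (v * t)) (Icc a b) = ENNReal.ofReal (v * (b - a)) := by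
  rw [eVariationOn_congr_edist (g := fun t : ℝ ↦ v * t)]
  · have hm : MonotoneOn (fun t : ℝ ↦ v * t) (Icc a b) :=
      fun x _ y _ h ↦ mul_le_mul_of_nonneg_left h hv
    have := hm.eVariationOn_eq (left_mem_Icc.2 hab) (right_mem_Icc.2 hab)
    rwa [inter_self, ← mul_sub] at this
  · intro x _ y _
    rw [edist_dist, edist_dist, dist_smul', HypGeom.dist_vert, Real.dist_eq]

/-- Closed curves given by a path between two equivalent points. -/
lemma exists_loop {F : ℝ → ℍ} (hF : Continuous F) {γ : SL(2, ℝ)} (hγ : γ ∈ Γ)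
    (h : F 1 = γ • F 0) : ∃ c : C(UnitAddCircle, HypSurface Γ),
      ∀ t ∈ Icc (0 : ℝ) 1, c (t : UnitAddCircle) = proj Γ (F t) := by
  have h01 : proj Γ (F 0) = proj Γ (F (0 + 1)) := by rw [zero_add, h, proj_smul_mem hγ]
  refine ⟨⟨AddCircle.liftIco 1 0 (fun t ↦ proj Γ (F t)),
    AddCircle.liftIco_continuous h01 (continuous_proj.comp hF).continuousOn⟩, fun t ht ↦ ?_⟩
  change AddCircle.liftIco 1 0 (fun t ↦ proj Γ (F t)) t = _
  rcases eq_or_lt_of_le ht.2 with rfl | h1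
  · have : ((1 : ℝ) : UnitAddCircle) = ((0 : ℝ) : UnitAddCircle) := by simp
    rw [this, AddCircle.liftIco_coe_apply (by simp), h01, zero_add]
  · rw [AddCircle.liftIco_coe_apply]
    exact ⟨ht.1, by simpa using h1⟩

/-- Closed curves given by periodic paths. -/
lemma exists_loop_periodic {F : ℝ → ℍ} (hF : Continuous F)
    (h : ∀ t, proj Γ (F (t + 1)) = proj Γ (F t)) : ∃ c : C(UnitAddCircle, HypSurface Γ),
      ∀ t : ℝ, c (t : UnitAddCircle) = proj Γ (F t) := by
  have hp : Function.Periodic (fun t ↦ proj Γ (F t)) 1 := h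
  refine ⟨⟨hp.lift, ?_⟩, fun t ↦ hp.lift_coe t⟩
  exact continuous_coinduced_dom.2 (continuous_proj.comp hF)

/-- The geodesic loop at `z` in the class of `γ`. -/
lemma exists_geodesic_loop (hΓ : ProperFree Γ) {γ : SL(2, ℝ)} (hγ : γ ∈ Γ) (z : ℍ) :
    ∃ (c : C(UnitAddCircle, HypSurface Γ)) (F : ℝ → ℍ), Continuous F ∧ F 1 = γ • F 0 ∧
      (∀ t ∈ Icc (0 : ℝ) 1, c (t : UnitAddCircle) = proj Γ (F t)) ∧
      curveLength c = ENNReal.ofReal (dist z (γ • z)) := by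
  obtain ⟨g, h0, h1⟩ := exists_geodesic z (γ • z)
  set F : ℝ → ℍ := fun t ↦ g • vert (dist z (γ • z) * t) with hFdef
  have hF : Continuous F := by
    exact (continuous_vert.comp (continuous_const_mul _)).const_smul g
  have h' : F 1 = γ • F 0 := by
    simp only [hFdef, mul_one, mul_zero]
    rw [← h1, ← h0]
  obtain ⟨c, hc⟩ := exists_loop hF hγ h'
  refine ⟨c, F, hF, h', hc, ?_⟩
  rw [curveLength_eq hΓ hF hc, eVariationOn_geodesic g dist_nonneg zero_le_one]
  simp

lemma edist_le_curveLength (hΓ : ProperFree Γ) {c : C(UnitAddCircle, HypSurface Γ)} {F : ℝ → ℍ}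
    (hF : Continuous F) (h : ∀ t ∈ Icc (0 : ℝ) 1, c (t : UnitAddCircle) = proj Γ (F t)) :
    edist (F 0) (F 1) ≤ curveLength c := by
  rw [curveLength_eq hΓ hF h]
  exact eVariationOn.edist_le F (by simp) (by simp)

end HypSurface

/-! ### Paths and singular `1`-chains -/

section PathClass

variable (X : Type) [TopologicalSpace X]

/-- The singular chain complex with integral coefficients. -/
abbrev SingChains : ChainComplex (ModuleCat.{0} ℤ) ℕ :=
  (TopCat.toSSet.obj (TopCat.of X)).chainComplex (ModuleCat.of ℤ ℤ)

/-- Singular `1`-chains modulo boundaries. -/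
abbrev ChainsModB : ModuleCat.{0} ℤ := (SingChains X).opcycles 1

/-- The inclusion of the first homology group into the `1`-chains modulo boundaries. -/
def h1Incl : SingularH1 X ⟶ ChainsModB X := (SingChains X).homologyι 1

variable {X}

/-- A path as a singular `1`-simplex. -/
def pathSimplex (f : C(unitInterval, X)) : (TopCat.toSSet.obj (TopCat.of X)) _⦋1⦌ :=
  TopCat.toSSetObj₁Equiv.symm (TopCat.ofHom (X := ULift unitInterval) (Y := X)
    (f.comp ⟨fun t ↦ t.down, continuous_uliftDown⟩))

/-- The chain of a path, as a homomorphism. -/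
def pathChain (f : C(unitInterval, X)) : ModuleCat.of ℤ ℤ ⟶ (SingChains X).X 1 :=
  (TopCat.toSSet.obj (TopCat.of X)).ιChainComplex (pathSimplex f)

/-- The class of a path modulo boundaries. -/
def pathClass (f : C(unitInterval, X)) : ChainsModB X :=
  (pathChain f ≫ (SingChains X).pOpcycles 1).hom (1 : ℤ)

/-- Equalities of homology classes may therefore be tested among chains modulo boundaries, where
paths that are not closed have classes too. -/
lemma h1Incl_injective : Function.Injective (h1Incl X).hom :=
  (ModuleCat.mono_iff_injective ((SingChains X).homologyι 1)).1 inferInstance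

/-- A singular `2`-simplex. -/
def triSimplex (σ : C(stdSimplex ℝ (Fin 3), X)) : (TopCat.toSSet.obj (TopCat.of X)) _⦋2⦌ :=
  (TopCat.toSSetObjEquiv (TopCat.of X) (Opposite.op ⦋2⦌)).symm σ

lemma δ_triSimplex (σ : C(stdSimplex ℝ (Fin 3), X)) (i : Fin 3) (f : C(unitInterval, X))
    (h : ∀ p : stdSimplex ℝ (Fin 2), σ (stdSimplex.map (Fin.succAbove i) p) =
      f (stdSimplexHomeomorphUnitInterval p)) :
    (TopCat.toSSet.obj (TopCat.of X)).δ i (triSimplex σ) = pathSimplex f := by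
  apply (TopCat.toSSetObjEquiv (TopCat.of X) _).injective
  ext p
  refine (TopCat.toSSetObjEquiv_δ_apply (triSimplex σ) i p).trans ?_
  have e1 : TopCat.toSSetObjEquiv (TopCat.of X) _ (triSimplex σ) = σ :=
    Equiv.apply_symm_apply _ _
  refine (congrArg (fun k : C(stdSimplex ℝ (Fin 3), X) ↦
    k (stdSimplex.map i.succAbove p)) e1).trans ((h p).trans ?_)
  rfl

/-- The alternating sum of the three edges is the boundary of σ. -/
lemma pathClass_triangle (σ : C(stdSimplex ℝ (Fin 3), X)) (f : Fin 3 → C(unitInterval, X))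
    (h : ∀ i, ∀ p : stdSimplex ℝ (Fin 2), σ (stdSimplex.map (Fin.succAbove i) p) =
      f i (stdSimplexHomeomorphUnitInterval p)) :
    pathClass (f 0) + pathClass (f 2) = pathClass (f 1) := by
  have h1 := (TopCat.toSSet.obj (TopCat.of X)).ιChainComplex_d (R := ModuleCat.of ℤ ℤ)
    (triSimplex σ)
  have h2 : (((TopCat.toSSet.obj (TopCat.of X)).ιChainComplex (R := ModuleCat.of ℤ ℤ)
      (triSimplex σ) ≫ (SingChains X).d 2 1) ≫ (SingChains X).pOpcycles 1).hom (1 : ℤ) = 0 := by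
    rw [Category.assoc, HomologicalComplex.d_pOpcycles]
    simp
  have h3 : (TopCat.toSSet.obj (TopCat.of X)).ιChainComplex (R := ModuleCat.of ℤ ℤ)
      (triSimplex σ) ≫ (SingChains X).d 2 1 =
      pathChain (f 0) - pathChain (f 1) + pathChain (f 2) := by
    refine h1.trans ?_
    rw [Fin.sum_univ_three, δ_triSimplex σ 0 _ (h 0), δ_triSimplex σ 1 _ (h 1),
      δ_triSimplex σ 2 _ (h 2)]
    simp [pathChain, sub_eq_add_neg]
  rw [h3, Preadditive.add_comp, Preadditive.sub_comp] at h2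
  change pathClass (f 0) - pathClass (f 1) + pathClass (f 2) = 0 at h2
  rw [← sub_eq_zero, ← h2]
  abel

/-- A point as a singular `0`-simplex. -/
def ptSimplex (x : X) : (TopCat.toSSet.obj (TopCat.of X)) _⦋0⦌ :=
  (TopCat.toSSetObj₀Equiv (X := TopCat.of X)).symm x

lemma ptSimplex_injective : Function.Injective (ptSimplex (X := X)) :=
  (TopCat.toSSetObj₀Equiv (X := TopCat.of X)).symm.injective

/-- The `0`-chain of a point, as a homomorphism. -/
def ptChain (x : X) : ModuleCat.of ℤ ℤ ⟶ (SingChains X).X 0 :=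
  (TopCat.toSSet.obj (TopCat.of X)).ιChainComplex (ptSimplex x)

lemma pathChain_d (f : C(unitInterval, X)) :
    pathChain f ≫ (SingChains X).d 1 0 = ptChain (f 1) - ptChain (f 0) := by
  refine ((TopCat.toSSet.obj (TopCat.of X)).ιChainComplex_d (R := ModuleCat.of ℤ ℤ)
    (pathSimplex f)).trans ?_
  rw [Fin.sum_univ_two]
  have e0 : (TopCat.toSSet.obj (TopCat.of X)).δ 0 (pathSimplex f) = ptSimplex (f 1) :=
    TopCat.δ_zero_toSSetObj₁Equiv.symm _
  have e1 : (TopCat.toSSet.obj (TopCat.of X)).δ 1 (pathSimplex f) = ptSimplex (f 0) :=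
    TopCat.δ_one_toSSetObj₁Equiv.symm _
  rw [e0, e1]
  simp [ptChain, sub_eq_add_neg]

lemma pathSimplex_surjective : Function.Surjective (pathSimplex (X := X)) := fun x ↦
  ⟨(TopCat.toSSetObj₁Equiv x).hom.comp ⟨ULift.up, continuous_uliftUp⟩,
    (Equiv.symm_apply_eq _).2 rfl⟩

lemma ptSimplex_surjective : Function.Surjective (ptSimplex (X := X)) :=
  (TopCat.toSSetObj₀Equiv (X := TopCat.of X)).symm.surjective

/-- The path of a loop, as a map on the unit interval. -/
def loopMap (c : C(UnitAddCircle, X)) : C(unitInterval, X) :=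
  c.comp ⟨fun t ↦ ((t : ℝ) : UnitAddCircle),
    (AddCircle.continuous_mk' 1).comp continuous_subtype_val⟩

lemma h1Incl_loopClass (c : C(UnitAddCircle, X)) :
    (h1Incl X).hom (loopClass c) = pathClass (loopMap c) := by
  have h0 : pathChain (loopMap c) ≫ (SingChains X).d 1 0 = 0 := loopChain_d c
  have h : (HomologicalComplex.liftCycles (SingChains X) (pathChain (loopMap c)) 0 (by simp) h0 ≫
    HomologicalComplex.homologyπ (SingChains X) 1) ≫ (SingChains X).homologyι 1 =
      pathChain (loopMap c) ≫ (SingChains X).pOpcycles 1 := by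
    rw [Category.assoc, HomologicalComplex.homology_π_ι, HomologicalComplex.liftCycles_i_assoc]
  exact congrArg (fun k ↦ k.hom (1 : ℤ)) h

/-- The homomorphism from `ℤ` given by an element. -/
def elemHom {M : ModuleCat.{0} ℤ} (m : M) : ModuleCat.of ℤ ℤ ⟶ M :=
  ModuleCat.ofHom (LinearMap.toSpanSingleton ℤ M m)

lemma elemHom_one {M : ModuleCat.{0} ℤ} (m : M) : (elemHom m).hom (1 : ℤ) = m :=
  LinearMap.toSpanSingleton_apply_one ℤ M m

lemma hom_int_ext {M : ModuleCat.{0} ℤ} {f g : ModuleCat.of ℤ ℤ ⟶ M}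
    (h : f.hom (1 : ℤ) = g.hom (1 : ℤ)) : f = g :=
  ModuleCat.hom_ext (LinearMap.ext_ring h)

/-- A criterion to describe homology classes: if modulo boundaries each path differs from
an element of a submodule `A` of the first homology group by a coboundary,
then each homology class is in `A`. -/
lemma mem_of_pathClass (A : Submodule ℤ (SingularH1 X)) (s : X → ChainsModB X)
    (h : ∀ f : C(unitInterval, X), ∃ a ∈ A,
      pathClass f = (h1Incl X).hom a + (s (f 1) - s (f 0)))
    (a : SingularH1 X) : a ∈ A := by
  choose l hl hs using h
  let K := TopCat.toSSet.obj (TopCat.of X)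
  let M : ModuleCat.{0} ℤ := @ModuleCat.of ℤ _ A _ A.module
  let incl : M ⟶ SingularH1 X :=
    @ModuleCat.ofHom ℤ _ A (SingularH1 X) _ A.module _ (SingularH1 X).isModule A.subtype
  choose pt hpt using ptSimplex_surjective (X := X)
  choose pa hpa using pathSimplex_surjective (X := X)
  -- The chain groups are free on the singular simplices, so the given data on points and on paths
  -- extend to homomorphisms S and T.
  have hS : ∃ S : (SingChains X).X 0 ⟶ ChainsModB X, ∀ x, ptChain x ≫ S = elemHom (s x) := by
    refine ⟨(K.isColimitChainComplexXCofan (ModuleCat.of ℤ ℤ) 0).desc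
      (Limits.Cofan.mk _ fun x ↦ elemHom (s (pt x))), fun x ↦ ?_⟩
    refine ((K.isColimitChainComplexXCofan (ModuleCat.of ℤ ℤ) 0).fac _ ⟨ptSimplex x⟩).trans ?_
    change elemHom (s (pt _)) = _
    rw [ptSimplex_injective (hpt (ptSimplex x))]
  have hT : ∃ T : (SingChains X).X 1 ⟶ M,
      ∀ x : K _⦋1⦌, K.ιChainComplex x ≫ T =
        elemHom (M := M) ⟨l (pa x), hl (pa x)⟩ :=
    ⟨(K.isColimitChainComplexXCofan (ModuleCat.of ℤ ℤ) 1).desc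
      (Limits.Cofan.mk _ fun x ↦ elemHom (M := M) ⟨l (pa x), hl (pa x)⟩), fun x ↦
      (K.isColimitChainComplexXCofan (ModuleCat.of ℤ ℤ) 1).fac _ ⟨x⟩⟩
  obtain ⟨S, hS⟩ := hS
  obtain ⟨T, hT⟩ := hT
  -- On cycles the coboundary term dies, which leaves the class of the cycle equal to its value
  -- under T, an element of A.
  have key : (SingChains X).pOpcycles 1 =
      T ≫ incl ≫ h1Incl X + (SingChains X).d 1 0 ≫ S := by
    refine SSet.chainComplex_hom_ext fun x ↦ ?_
    have e2 : K.ιChainComplex x ≫ (SingChains X).d 1 0 =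
        ptChain (pa x 1) - ptChain (pa x 0) := by
      rw [← pathChain_d, pathChain, hpa]
    rw [Preadditive.comp_add, reassoc_of% (hT x), reassoc_of% e2, Preadditive.sub_comp, hS, hS]
    apply hom_int_ext
    have := hs (pa x)
    rw [pathClass, pathChain, hpa] at this
    refine this.trans ?_
    have e3 : (elemHom (M := M) ⟨l (pa x), hl (pa x)⟩ ≫ incl ≫ h1Incl X).hom
        (1 : ℤ) = (h1Incl X).hom (l (pa x)) := by
      rw [ModuleCat.hom_comp, LinearMap.comp_apply, elemHom_one]
      rfl
    rw [ModuleCat.hom_add, ModuleCat.hom_sub, LinearMap.add_apply, LinearMap.sub_apply, e3,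
      elemHom_one, elemHom_one]
  have hπ : Function.Surjective ((SingChains X).homologyπ 1).hom :=
    (ModuleCat.epi_iff_surjective _).1 inferInstance
  obtain ⟨z, rfl⟩ := hπ a
  have e : (SingChains X).homologyπ 1 ≫ h1Incl X =
      ((SingChains X).iCycles 1 ≫ T ≫ incl) ≫ h1Incl X := by
    have : (SingChains X).homologyπ 1 ≫ h1Incl X =
      (SingChains X).iCycles 1 ≫ (SingChains X).pOpcycles 1 := HomologicalComplex.homology_π_ι _
    rw [this, key]
    simp
  have e' := h1Incl_injective (congrArg (fun k ↦ k.hom z) e)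
  have e'' : ((SingChains X).homologyπ 1).hom z =
      ((T.hom (((SingChains X).iCycles 1).hom z) : A) : SingularH1 X) := e'
  exact e'' ▸ (T.hom (((SingChains X).iCycles 1).hom z) : A).2

end PathClass

/-! ### Triangles in the upper half-plane -/

namespace HypGeom

/-- Interpolation of boundary data on a triangle. -/
def interp (a b c : ℝ → ℝ) (p : stdSimplex ℝ (Fin 3)) : ℝ :=
  a (p 1) + c (p 2) - a 0 + (b (p 2) - a (1 - p 2) - c (p 2) + a 0) * (p 1 / (1 - p 2))

lemma stdSimplex_sum (p : stdSimplex ℝ (Fin 3)) : p 0 + p 1 + p 2 = 1 := by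
  rw [← Fin.sum_univ_three]; exact p.2.2

lemma stdSimplex_nonneg {n : ℕ} (p : stdSimplex ℝ (Fin n)) (i : Fin n) : 0 ≤ p i := p.2.1 i

lemma continuous_coord (i : Fin 3) : Continuous fun p : stdSimplex ℝ (Fin 3) ↦ p i :=
  (continuous_apply i).comp continuous_subtype_val

/-- The quotient `p 1 / (1 - p 2)` has no limit at the vertex where `p 2 = 1`, but it stays bounded
by 1, and its coefficient vanishes there because the sides b and c end at the same value. -/
lemma continuous_interp {a b c : ℝ → ℝ} (ha : Continuous a) (hb : Continuous b) (hc : Continuous c)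
    (h : b 1 = c 1) : Continuous (interp a b c) := by
  have h1 := continuous_coord 1
  have h2 := continuous_coord 2
  refine Continuous.add (((ha.comp h1).add (hc.comp h2)).sub continuous_const) ?_
  set e : stdSimplex ℝ (Fin 3) → ℝ := fun p ↦ b (p 2) - a (1 - p 2) - c (p 2) + a 0 with he
  have hec : Continuous e := (((hb.comp h2).sub (ha.comp (continuous_const.sub h2))).sub
    (hc.comp h2)).add continuous_const
  rw [continuous_iff_continuousAt]
  intro p
  by_cases hp : p 2 = 1
  · have hep : e p = 0 := by simp [he, hp, h]
    have hval : e p * (p 1 / (1 - p 2)) = 0 := by rw [hep, zero_mul]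
    rw [ContinuousAt]
    change Filter.Tendsto _ _ (nhds (e p * (p 1 / (1 - p 2))))
    rw [hval]
    have ht : Filter.Tendsto (fun x ↦ |e x|) (nhds p) (nhds 0) := by
      have := (hec.abs).tendsto p
      rwa [hep, abs_zero] at this
    refine squeeze_zero_norm (fun x ↦ ?_) ht
    rw [Real.norm_eq_abs, abs_mul]
    have hs := stdSimplex_sum x
    have n0 := stdSimplex_nonneg x 0
    have n1 := stdSimplex_nonneg x 1
    have n2 := stdSimplex_nonneg x 2
    have : abs (x 1 / (1 - x 2)) ≤ 1 := by
      rw [abs_of_nonneg (div_nonneg n1 (by linarith))]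
      exact div_le_one_of_le₀ (by linarith) (by linarith)
    exact mul_le_of_le_one_right (abs_nonneg _) this
  · exact hec.continuousAt.mul (h1.continuousAt.div (continuous_const.sub h2).continuousAt (sub_ne_zero.2 (Ne.symm hp)))

lemma map_succAbove_apply (i : Fin 3) (p : stdSimplex ℝ (Fin 2)) (j : Fin 3) :
    (stdSimplex.map (Fin.succAbove i) p : stdSimplex ℝ (Fin 3)) j =
      ∑ k : Fin 2, if i.succAbove k = j then p k else 0 := by
  have : (stdSimplex.map (Fin.succAbove i) p : stdSimplex ℝ (Fin 3)) j =
    FunOnFinite.linearMap ℝ ℝ (Fin.succAbove i) p j := rfl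
  rw [this, FunOnFinite.linearMap_apply_apply, Finset.sum_filter]

lemma interp_of_two_eq_zero {a b c : ℝ → ℝ} (h0 : a 0 = c 0) (h1 : a 1 = b 0)
    {p : stdSimplex ℝ (Fin 3)} (hp : p 2 = 0) : interp a b c p = a (p 1) := by
  simp [interp, hp, h0, h1]

lemma interp_of_one_eq_zero {a b c : ℝ → ℝ} {p : stdSimplex ℝ (Fin 3)} (hp : p 1 = 0) :
    interp a b c p = c (p 2) := by
  simp [interp, hp]

lemma interp_of_zero_eq_zero {a b c : ℝ → ℝ} (h : b 1 = c 1)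
    {p : stdSimplex ℝ (Fin 3)} (hp : p 0 = 0) : interp a b c p = b (p 2) := by
  have hs := stdSimplex_sum p
  have h1 : p 1 = 1 - p 2 := by linarith
  rw [interp, h1]
  by_cases h2 : p 2 = 1
  · simp [h2, h]
  · rw [div_self (sub_ne_zero.2 (Ne.symm h2))]; ring

/-- The point with real part `x` and imaginary part `e ^ u`. -/
def mkH (x u : ℝ) : ℍ := ⟨⟨x, Real.exp u⟩, Real.exp_pos u⟩

@[simp] lemma mkH_re (x u : ℝ) : (mkH x u).re = x := rfl
@[simp] lemma mkH_im (x u : ℝ) : (mkH x u).im = Real.exp u := rfl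

lemma continuous_mkH {A : Type*} [TopologicalSpace A] {x u : A → ℝ} (hx : Continuous x)
    (hu : Continuous u) : Continuous fun a ↦ mkH (x a) (u a) := by
  refine UpperHalfPlane.isEmbedding_coe.continuous_iff.2 ?_
  have : (UpperHalfPlane.coe ∘ fun a ↦ mkH (x a) (u a)) =
      fun a ↦ (x a : ℂ) + (Real.exp (u a) : ℝ) * Complex.I := by
    ext1 a
    apply Complex.ext <;> simp [mkH, -Complex.ofReal_exp]
  rw [this]
  fun_prop

lemma mkH_log (z : ℍ) : mkH z.re (Real.log z.im) = z :=
  hext rfl (Real.exp_log z.im_pos)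

lemma continuous_log_im : Continuous fun z : ℍ ↦ Real.log z.im :=
  continuous_im.log fun z ↦ z.im_ne_zero

/-- A path from `z` to `w`. -/
def line (z w : ℍ) (t : ℝ) : ℍ :=
  mkH (z.re + t * (w.re - z.re)) (Real.log z.im + t * (Real.log w.im - Real.log z.im))

lemma continuous_line (z w : ℍ) : Continuous (line z w) :=
  continuous_mkH (by fun_prop) (by fun_prop)

@[simp] lemma line_zero (z w : ℍ) : line z w 0 = z := by simp [line, mkH_log]
@[simp] lemma line_one (z w : ℍ) : line z w 1 = w := by simp [line, mkH_log]

end HypGeom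

/-! ### Homology classes of projected paths and of deck transformations -/

namespace HypSurface

open HypGeom

variable (Γ : Subgroup SL(2, ℝ))

/-- The class of the projection of a path, modulo boundaries. -/
def pathQ {f : ℝ → ℍ} (hf : Continuous f) : ChainsModB (HypSurface Γ) :=
  pathClass ⟨fun t : unitInterval ↦ proj Γ (f t),
    continuous_proj.comp (hf.comp continuous_subtype_val)⟩

variable {Γ}

/-- In the coordinates (re, log im) the half-plane is all of ℝ², so `interp` fills any triangle of
paths inside ℍ. The filling is then projected. -/
lemma pathQ_add {a b c : ℝ → ℍ} (ha : Continuous a) (hb : Continuous b) (hc : Continuous c)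
    (h0 : a 0 = c 0) (h1 : a 1 = b 0) (h2 : b 1 = c 1) :
    pathQ Γ ha + pathQ Γ hb = pathQ Γ hc := by
  have hre {f : ℝ → ℍ} (hf : Continuous f) : Continuous fun t ↦ (f t).re := continuous_re.comp hf
  have hlog {f : ℝ → ℍ} (hf : Continuous f) : Continuous fun t ↦ Real.log (f t).im :=
    continuous_log_im.comp hf
  let σ₀ : stdSimplex ℝ (Fin 3) → ℍ := fun p ↦
    mkH (interp (fun t ↦ (a t).re) (fun t ↦ (b t).re) (fun t ↦ (c t).re) p)
      (interp (fun t ↦ Real.log (a t).im) (fun t ↦ Real.log (b t).im)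
        (fun t ↦ Real.log (c t).im) p)
  have hσ₀ : Continuous σ₀ := continuous_mkH
    (continuous_interp (hre ha) (hre hb) (hre hc) (by rw [h2]))
    (continuous_interp (hlog ha) (hlog hb) (hlog hc) (by rw [h2]))
  let σ : C(stdSimplex ℝ (Fin 3), HypSurface Γ) := ⟨fun p ↦ proj Γ (σ₀ p), continuous_proj.comp hσ₀⟩
  let F {f : ℝ → ℍ} (hf : Continuous f) : C(unitInterval, HypSurface Γ) :=
    ⟨fun t : unitInterval ↦ proj Γ (f t), continuous_proj.comp (hf.comp continuous_subtype_val)⟩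
  have hA (p : stdSimplex ℝ (Fin 3)) (t : ℝ) (e2 : p 2 = 0) (e1 : p 1 = t) : σ₀ p = a t := by
    simp only [σ₀]
    rw [interp_of_two_eq_zero (by rw [h0]) (by rw [h1]) e2,
      interp_of_two_eq_zero (by rw [h0]) (by rw [h1]) e2, e1, mkH_log]
  have hB (p : stdSimplex ℝ (Fin 3)) (t : ℝ) (e0 : p 0 = 0) (e2 : p 2 = t) : σ₀ p = b t := by
    simp only [σ₀]
    rw [interp_of_zero_eq_zero (by rw [h2]) e0, interp_of_zero_eq_zero (by rw [h2]) e0, e2,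
      mkH_log]
  have hC (p : stdSimplex ℝ (Fin 3)) (t : ℝ) (e1 : p 1 = 0) (e2 : p 2 = t) : σ₀ p = c t := by
    simp only [σ₀]
    rw [interp_of_one_eq_zero e1, interp_of_one_eq_zero e1, e2, mkH_log]
  have key := pathClass_triangle σ ![F hb, F hc, F ha] ?_
  · rw [add_comm]
    exact key
  · intro i p
    have hm (j) := map_succAbove_apply i p j
    fin_cases i
    · have e0 := hm 0
      have e2 := hm 2
      simp [-stdSimplex.map_coe, Fin.sum_univ_two, Fin.succAbove] at e0 e2
      exact congrArg (proj Γ) (hB _ _ e0 e2)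
    · have e1 := hm 1
      have e2 := hm 2
      simp [-stdSimplex.map_coe, Fin.sum_univ_two, Fin.succAbove] at e1 e2
      exact congrArg (proj Γ) (hC _ _ e1 e2)
    · have e1 := hm 1
      have e2 := hm 2
      simp [-stdSimplex.map_coe, Fin.sum_univ_two, Fin.succAbove] at e1 e2
      exact congrArg (proj Γ) (hA _ _ e2 e1)

lemma pathQ_const (z : ℍ) : pathQ Γ (continuous_const : Continuous fun _ : ℝ ↦ z) = 0 := by
  have := pathQ_add (Γ := Γ) (continuous_const : Continuous fun _ : ℝ ↦ z)
    (continuous_const : Continuous fun _ : ℝ ↦ z) (continuous_const : Continuous fun _ : ℝ ↦ z)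
    rfl rfl rfl
  simpa using this

variable (Γ) in
/-- The class, modulo boundaries, of the projection of any path from `z` to `w`. -/
def q (z w : ℍ) : ChainsModB (HypSurface Γ) := pathQ Γ (continuous_line z w)

/-- The triangle with sides f, a constant path and `line (f 0) (f 1)` shows that only the endpoints
in ℍ matter. -/
lemma pathQ_eq {f : ℝ → ℍ} (hf : Continuous f) : pathQ Γ hf = q Γ (f 0) (f 1) := by
  have := pathQ_add (Γ := Γ) hf (continuous_const : Continuous fun _ : ℝ ↦ f 1)
    (continuous_line (f 0) (f 1)) (by simp) rfl (by simp)
  rwa [pathQ_const, add_zero] at this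

lemma q_add (z w u : ℍ) : q Γ z w + q Γ w u = q Γ z u :=
  pathQ_add _ _ _ (by simp) (by simp) (by simp)

lemma q_self (z : ℍ) : q Γ z z = 0 := by simpa using q_add (Γ := Γ) z z z

lemma q_symm (z w : ℍ) : q Γ w z = -q Γ z w := by
  rw [eq_neg_iff_add_eq_zero, q_add, q_self]

lemma q_smul {γ : SL(2, ℝ)} (hγ : γ ∈ Γ) (z w : ℍ) : q Γ (γ • z) (γ • w) = q Γ z w := by
  have h : Continuous fun t ↦ γ • line z w t := (continuous_line z w).const_smul γ
  have h1 := pathQ_eq (Γ := Γ) h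
  simp only [line_zero, line_one] at h1
  rw [← h1]
  simp only [q, pathQ, proj_smul_mem hγ]

lemma exists_loop_line {γ : SL(2, ℝ)} (hγ : γ ∈ Γ) : ∃ c : C(UnitAddCircle, HypSurface Γ),
    ∀ t ∈ Icc (0 : ℝ) 1, c (t : UnitAddCircle) = proj Γ (line I (γ • I) t) :=
  exists_loop (continuous_line _ _) hγ (by simp)

open Classical in
variable (Γ) in
/-- The homology class of an element of the group. -/
def cls (γ : SL(2, ℝ)) : SingularH1 (HypSurface Γ) :=
  if hγ : γ ∈ Γ then loopClass (exists_loop_line hγ).choose else 0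

lemma h1Incl_loopClass_eq {c : C(UnitAddCircle, HypSurface Γ)} {F : ℝ → ℍ} (hF : Continuous F)
    (h : ∀ t ∈ Icc (0 : ℝ) 1, c (t : UnitAddCircle) = proj Γ (F t)) :
    (h1Incl _).hom (loopClass c) = q Γ (F 0) (F 1) := by
  rw [h1Incl_loopClass, ← pathQ_eq hF, pathQ]
  congr 1
  ext t
  exact h t t.2

/-- Changing the base point adds `q Γ z w` at the start and removes its translate under γ at the
end; the two cancel by invariance. -/
lemma q_smul_self {γ : SL(2, ℝ)} (hγ : γ ∈ Γ) (z w : ℍ) : q Γ z (γ • z) = q Γ w (γ • w) := by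
  rw [← q_add z w, ← q_add w (γ • w) (γ • z), q_smul hγ, q_symm z w]
  abel

lemma h1Incl_cls {γ : SL(2, ℝ)} (hγ : γ ∈ Γ) (z : ℍ) :
    (h1Incl _).hom (cls Γ γ) = q Γ z (γ • z) := by
  rw [cls, dif_pos hγ, h1Incl_loopClass_eq (continuous_line _ _) (exists_loop_line hγ).choose_spec]
  simpa using q_smul_self hγ I z

lemma loopClass_eq {c : C(UnitAddCircle, HypSurface Γ)} {F : ℝ → ℍ} (hF : Continuous F)
    (h : ∀ t ∈ Icc (0 : ℝ) 1, c (t : UnitAddCircle) = proj Γ (F t)) {γ : SL(2, ℝ)} (hγ : γ ∈ Γ)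
    (hFγ : F 1 = γ • F 0) : loopClass c = cls Γ γ := by
  apply h1Incl_injective
  rw [h1Incl_loopClass_eq hF h, h1Incl_cls hγ (F 0), hFγ]

/-- Go from i to γδi through γi; the second part is the γ-translate of a path from i to δi. -/
lemma cls_mul {γ δ : SL(2, ℝ)} (hγ : γ ∈ Γ) (hδ : δ ∈ Γ) :
    cls Γ (γ * δ) = cls Γ γ + cls Γ δ := by
  apply h1Incl_injective
  rw [map_add, h1Incl_cls (mul_mem hγ hδ) I, h1Incl_cls hγ I, h1Incl_cls hδ I, mul_smul,
    ← q_add I (γ • I), q_smul hγ]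

lemma cls_eq_zero {γ : SL(2, ℝ)} (hγ : γ ∈ Γ) {z : ℍ} (h : γ • z = z) : cls Γ γ = 0 := by
  apply h1Incl_injective
  rw [map_zero, h1Incl_cls hγ z, h, q_self]

lemma cls_one : cls Γ 1 = 0 := cls_eq_zero (one_mem Γ) (one_smul _ I)

lemma cls_inv {γ : SL(2, ℝ)} (hγ : γ ∈ Γ) : cls Γ γ⁻¹ = -cls Γ γ := by
  rw [eq_neg_iff_add_eq_zero, ← cls_mul (inv_mem hγ) hγ, inv_mul_cancel, cls_one]

lemma cls_conj {γ δ : SL(2, ℝ)} (hγ : γ ∈ Γ) (hδ : δ ∈ Γ) :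
    cls Γ (δ * γ * δ⁻¹) = cls Γ γ := by
  rw [cls_mul (mul_mem hδ hγ) (inv_mem hδ), cls_mul hδ hγ, cls_inv hδ]
  abel

/-- Each homology class is the class of an element of the group. -/
lemma exists_cls_eq (hΓ : ProperFree Γ) (a : SingularH1 (HypSurface Γ)) :
    ∃ γ ∈ Γ, cls Γ γ = a := by
  let A : Submodule ℤ (SingularH1 (HypSurface Γ)) :=
    { carrier := {a | ∃ γ ∈ Γ, cls Γ γ = a}
      add_mem' := by
        rintro _ _ ⟨γ, hγ, rfl⟩ ⟨δ, hδ, rfl⟩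
        exact ⟨γ * δ, mul_mem hγ hδ, cls_mul hγ hδ⟩
      zero_mem' := ⟨1, one_mem Γ, cls_one⟩
      smul_mem' := by
        rintro n _ ⟨γ, hγ, rfl⟩
        refine ⟨γ ^ n, zpow_mem hγ n, ?_⟩
        have key : ∀ n : ℤ, cls Γ (γ ^ n) = n • cls Γ γ := by
          intro n
          induction n using Int.induction_on with
          | zero => exact (congrArg _ (zpow_zero γ)).trans (cls_one.trans (zero_smul ℤ _).symm)
          | succ n ih =>
            rw [zpow_add_one, cls_mul (zpow_mem hγ _) hγ, ih]
            exact (add_one_zsmul _ _).symm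
          | pred n ih =>
            rw [zpow_sub_one, cls_mul (zpow_mem hγ _) (inv_mem hγ), ih, cls_inv hγ]
            exact (sub_one_zsmul _ _).symm
        exact (key n).trans (int_smul_eq_zsmul _ n _).symm }
  choose lift hlift using proj_surjective (Γ := Γ)
  -- Join i to a chosen lift of each point. Up to these connecting paths, a path f whose lift runs
  -- from `γ • lift (f 0)` to `δ • lift (f 1)` has the class of `γ⁻¹ * δ`.
  refine mem_of_pathClass A (fun x ↦ q Γ I (lift x)) (fun f ↦ ?_) a
  obtain ⟨F, hF, -, h⟩ := exists_lift hΓ (f := fun t : ℝ ↦ f (projIcc 0 1 zero_le_one t))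
    (f.continuous.comp continuous_projIcc) 0 (lift _) (hlift _)
  have hpf : pathClass f = q Γ (F 0) (F 1) := by
    rw [← pathQ_eq hF, pathQ]
    congr 1
    ext t
    change f t = proj Γ (F t)
    rw [h, projIcc_val]
  have h0 : proj Γ (F 0) = f 0 := by rw [h]; congr 1; exact projIcc_left _
  have h1 : proj Γ (F 1) = f 1 := by rw [h]; congr 1; exact projIcc_right _
  obtain ⟨γ, hγ, e0⟩ := proj_eq_iff.1 (h0.trans (hlift _).symm)
  obtain ⟨δ, hδ, e1⟩ := proj_eq_iff.1 (h1.trans (hlift _).symm)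
  refine ⟨cls Γ (γ⁻¹ * δ), ⟨_, mul_mem (inv_mem hγ) hδ, rfl⟩, ?_⟩
  rw [hpf, ← e0, ← e1, h1Incl_cls (mul_mem (inv_mem hγ) hδ) (lift (f 1)),
    ← q_smul (inv_mem hγ), inv_smul_smul, ← mul_smul, ← q_add (lift (f 0)) (lift (f 1)),
    ← q_add (lift (f 0)) I (lift (f 1)), q_symm (lift (f 0)) I]
  abel

end HypSurface

/-! ### Competitors of a multicurve -/

lemma Multicurve.exists_of_fintype {X : Type} [PseudoMetricSpace X] {ι : Type*} [Fintype ι]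
    (c : ι → C(UnitAddCircle, X)) : ∃ m : Multicurve X,
      m.homologyClass = ∑ i, loopClass (c i) ∧ m.length = ∑ i, curveLength (c i) ∧
      ∃ e : Fin m.n ≃ ι, ∀ j, m.component j = c (e j) := by
  let e := (Fintype.equivFin ι).symm
  refine ⟨⟨Fintype.card ι, fun j ↦ c (e j)⟩, ?_, ?_, e, fun _ ↦ rfl⟩
  · exact Equiv.sum_comp e fun i ↦ loopClass (c i)
  · exact Equiv.sum_comp e fun i ↦ curveLength (c i)

namespace HypSurface

open HypGeom

variable (Γ : Subgroup SL(2, ℝ))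

/-- The sum of the homology classes of a list of elements of the group. -/
def clsSum (l : List (SL(2, ℝ) × ℍ)) : SingularH1 (HypSurface Γ) :=
  (l.map fun p ↦ cls Γ p.1).sum

/-- The sum of the displacements of a list of pointed elements of the group. -/
def lenSum (l : List (SL(2, ℝ) × ℍ)) : ℝ := (l.map fun p ↦ dist p.2 (p.1 • p.2)).sum

variable {Γ}

lemma lenSum_nonneg (l : List (SL(2, ℝ) × ℍ)) : 0 ≤ lenSum l :=
  List.sum_nonneg (by simp only [List.mem_map]; rintro _ ⟨p, -, rfl⟩; exact dist_nonneg)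

/-- The base points are free and corners are allowed, so every list of pointed group elements is a
competitor in the minimization. -/
lemma exists_loops (hΓ : ProperFree Γ) (l : List (SL(2, ℝ) × ℍ)) (hl : ∀ p ∈ l, p.1 ∈ Γ) :
    ∃ c : Fin l.length → C(UnitAddCircle, HypSurface Γ),
      ∑ k, loopClass (c k) = clsSum Γ l ∧ ∑ k, curveLength (c k) = ENNReal.ofReal (lenSum l) := by
  choose c F hF hF1 hcF hlen using fun k : Fin l.length ↦
    exists_geodesic_loop hΓ (hl l[k] (List.getElem_mem _)) l[k].2
  refine ⟨c, ?_, ?_⟩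
  · rw [clsSum, ← Fin.sum_univ_fun_getElem]
    exact Finset.sum_congr rfl fun k _ ↦
      loopClass_eq (hF k) (hcF k) (hl l[k] (List.getElem_mem _)) (hF1 k)
  · rw [lenSum, ← Fin.sum_univ_fun_getElem, ENNReal.ofReal_sum_of_nonneg fun _ _ ↦ dist_nonneg]
    exact Finset.sum_congr rfl fun k _ ↦ hlen k

/-- In a minimal multicurve, some components are not longer than any competitor
with the same homology class. -/
lemma sum_curveLength_le (hΓ : ProperFree Γ) {m : Multicurve (HypSurface Γ)}
    {h : SingularH1 (HypSurface Γ)} (hm : m.IsMinimalFor h) (s : Finset (Fin m.n))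
    {l : List (SL(2, ℝ) × ℍ)} (hl : ∀ p ∈ l, p.1 ∈ Γ)
    (hls : clsSum Γ l = ∑ i ∈ s, loopClass (m.component i))
    (hfin : ∑ i ∈ sᶜ, curveLength (m.component i) ≠ ⊤) :
    ∑ i ∈ s, curveLength (m.component i) ≤ ENNReal.ofReal (lenSum l) := by
  obtain ⟨c, hc, hlen⟩ := exists_loops hΓ l hl
  obtain ⟨m', h1, h2, -⟩ := Multicurve.exists_of_fintype
    (Sum.elim (fun i : {i // i ∈ sᶜ} ↦ m.component i) c)
  simp only [Fintype.sum_sum_type, Sum.elim_inl, Sum.elim_inr] at h1 h2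
  rw [Finset.sum_coe_sort sᶜ fun i ↦ loopClass (m.component i), hc, hls,
    Finset.sum_compl_add_sum] at h1
  rw [Finset.sum_coe_sort sᶜ fun i ↦ curveLength (m.component i), hlen] at h2
  have := hm.2 m' (h1.trans hm.1)
  rw [h2, Multicurve.length, ← Finset.sum_compl_add_sum s] at this
  -- Cancelling the untouched components in `ℝ≥0∞` requires their total length to be finite.
  exact (ENNReal.add_le_add_iff_left hfin).1 this

/-- The length of a closed curve is at least the length of an inscribed polygon. -/
lemma dist_add_le_of_curveLength_le (hΓ : ProperFree Γ) {c : C(UnitAddCircle, HypSurface Γ)}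
    {F : ℝ → ℍ} (hF : Continuous F) (h : ∀ t : ℝ, proj Γ (F t) = c t) {L : ℝ} (hL : 0 ≤ L)
    (hc : curveLength c ≤ ENNReal.ofReal L) {s t : ℝ} (hs : 0 ≤ s) (hst : s ≤ t) (ht : t ≤ 1) :
    dist (F 0) (F s) + dist (F s) (F t) + dist (F t) (F 1) ≤ L := by
  rw [curveLength_eq hΓ hF fun t _ ↦ (h t).symm] at hc
  have e1 := eVariationOn.Icc_add_Icc F (s := univ) hs (hst.trans ht) (mem_univ _)
  have e2 := eVariationOn.Icc_add_Icc F (s := univ) hst ht (mem_univ _)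
  simp only [univ_inter] at e1 e2
  have d1 := eVariationOn.edist_le F (left_mem_Icc.2 hs) (right_mem_Icc.2 hs)
  have d2 := eVariationOn.edist_le F (left_mem_Icc.2 hst) (right_mem_Icc.2 hst)
  have d3 := eVariationOn.edist_le F (left_mem_Icc.2 ht) (right_mem_Icc.2 ht)
  have : edist (F 0) (F s) + edist (F s) (F t) + edist (F t) (F 1) ≤ ENNReal.ofReal L := by
    refine le_trans ?_ hc
    rw [← e1, ← e2, ← add_assoc]
    gcongr
  rw [edist_dist, edist_dist, edist_dist, ← ENNReal.ofReal_add (by positivity) (by positivity),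
    ← ENNReal.ofReal_add (by positivity) (by positivity)] at this
  exact (ENNReal.ofReal_le_ofReal_iff hL).1 this

/-- A curve of minimal length, invariant under a translation, is monotone along an axis. -/
lemma _root_.HypGeom.exists_monotone_axis {F : ℝ → ℍ} (hF : Continuous F) {γ : SL(2, ℝ)} {L : ℝ}
    (hγ : ∀ t, F (t + 1) = γ • F t) (hL : dist (F 0) (γ • F 0) = L) (hpos : 0 < L)
    (hmin : ∀ z : ℍ, L ≤ dist z (γ • z))
    (h : ∀ s t, 0 ≤ s → s ≤ t → t ≤ 1 →
      dist (F 0) (F s) + dist (F s) (F t) + dist (F t) (F 1) ≤ L) :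
    ∃ (g : SL(2, ℝ)) (ψ : ℝ → ℝ), IsTrans γ g L ∧ Continuous ψ ∧ Monotone ψ ∧
      (∀ t, ψ (t + 1) = ψ t + L) ∧ ∀ t, F t = g • vert (ψ t) := by
  subst hL
  obtain ⟨g, hg, hz⟩ := exists_isTrans_of_min hpos hmin
  set L := dist (F 0) (γ • F 0) with hLdef
  have h1 : F 1 = g • vert L := by
    rw [← zero_add (1 : ℝ), hγ, hz, hg.smul_vert, zero_add]
  set ψ : ℝ → ℝ := fun t ↦ Real.log (g⁻¹ • F t).im with hψ
  have hval {t c : ℝ} (e : F t = g • vert c) : ψ t = c := by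
    simp [hψ, e]
  -- Over one period, equality in the triangle inequality puts F t on the axis; equivariance carries
  -- this to all t.
  have h01 {t : ℝ} (h0 : 0 ≤ t) (ht1 : t ≤ 1) : ∃ c, F t = g • vert c := by
    obtain ⟨c, -, -, hc⟩ := eq_vert_of_dist_add_le (L := L) (p := g⁻¹ • F t) (by
      have := h t t h0 le_rfl ht1
      rw [dist_self, add_zero] at this
      rwa [← dist_smul' g, ← dist_smul' g (g⁻¹ • F t), smul_inv_smul, ← hz, ← h1])
    exact ⟨c, by rw [← hc, smul_inv_smul]⟩
  have hstep {t c : ℝ} (e : F t = g • vert c) : F (t + 1) = g • vert (c + L) := by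
    rw [hγ, e, hg.smul_vert]
  have hstep' {t c : ℝ} (e : F (t + 1) = g • vert c) : F t = g • vert (c - L) := by
    rw [← hg.inv_smul_vert, ← e, hγ, inv_smul_smul]
  have hint (n : ℤ) {t c : ℝ} (e : F t = g • vert c) : F (t + n) = g • vert (c + n * L) := by
    induction n using Int.induction_on with
    | zero => simpa using e
    | succ n ih =>
      have := hstep ih
      push_cast at this ⊢
      convert this using 2 <;> ring_nf
    | pred n ih =>
      push_cast at ih ⊢
      have := hstep' (t := t + (-n - 1)) (by rw [← ih]; congr 1; ring)
      convert this using 2; ring_nf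
  have hall (t : ℝ) : F t = g • vert (ψ t) := by
    obtain ⟨c, hc⟩ := h01 (Int.fract_nonneg t) (Int.fract_lt_one t).le
    have := hint ⌊t⌋ hc
    rw [Int.fract_add_floor] at this
    rw [hval this, this]
  have hψint (n : ℤ) (t : ℝ) : ψ (t + n) = ψ t + n * L := hval (hint n (hall t))
  have hψ0 : ψ 0 = 0 := hval hz
  -- The steps from 0 to ψ s, to ψ t and to L have total length at most L, so none of them goes
  -- backwards.
  have hmono : MonotoneOn ψ (Icc 0 1) := by
    intro s hs t ht hst
    have e := h s t hs.1 hst ht.2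
    rw [hall 0, hall s, hall t, h1, dist_smul', dist_smul', dist_smul', dist_vert, dist_vert,
      dist_vert, hψ0] at e
    have a1 := neg_abs_le (0 - ψ s)
    have a2 := le_abs_self (ψ s - ψ t)
    have a3 := neg_abs_le (ψ t - L)
    linarith
  refine ⟨g, ψ, hg, ?_, ?_, fun t ↦ by simpa using hψint 1 t, hall⟩
  · exact continuous_log_im.comp (hF.const_smul g⁻¹)
  · intro s t hst
    have hfr (t : ℝ) : Int.fract t ∈ Icc (0 : ℝ) 1 :=
      ⟨Int.fract_nonneg t, (Int.fract_lt_one t).le⟩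
    have es := hψint ⌊s⌋ (Int.fract s)
    have et := hψint ⌊t⌋ (Int.fract t)
    rw [Int.fract_add_floor] at es et
    rcases (Int.floor_mono hst).eq_or_lt with e | e
    · rw [es, et, ← e]
      gcongr
      refine hmono (hfr s) (hfr t) ?_
      rw [Int.fract, Int.fract, e]
      linarith
    · have e1 := hmono (hfr s) (right_mem_Icc.2 zero_le_one) (hfr s).2
      have e2 := hmono (left_mem_Icc.2 zero_le_one) (hfr t) (hfr t).1
      have e3 : ψ 1 = L := hval h1
      have e4 : ((⌊s⌋ : ℝ) + 1) ≤ ⌊t⌋ := by exact_mod_cast e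
      have e5 := mul_le_mul_of_nonneg_right e4 hpos.le
      linarith

end HypSurface

namespace HypSurface

open HypGeom

variable {Γ : Subgroup SL(2, ℝ)}

/-! ### Crossings of geodesics -/

variable (Γ) in
/-- The projection of the geodesic `g • vert`. -/
def geo (g : SL(2, ℝ)) (s : ℝ) : HypSurface Γ := proj Γ (g • vert s)

lemma geo_add {γ g : SL(2, ℝ)} {L : ℝ} (hγ : γ ∈ Γ) (h : IsTrans γ g L) (s : ℝ) :
    geo Γ g (s + L) = geo Γ g s := by
  rw [geo, ← h.smul_vert, proj_smul_mem hγ, geo]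

lemma geo_add_int_mul {γ g : SL(2, ℝ)} {L : ℝ} (hγ : γ ∈ Γ) (h : IsTrans γ g L) (n : ℤ) (s : ℝ) :
    geo Γ g (s + n * L) = geo Γ g s :=
  (Function.Periodic.int_mul (f := geo Γ g) (geo_add hγ h) n) s

lemma exists_dist_geo (hΓ : ProperFree Γ) (g : SL(2, ℝ)) (t : ℝ) : ∃ r > 0,
    ∀ s ∈ Ioo (t - r) (t + r), ∀ s' ∈ Ioo (t - r) (t + r),
      dist (geo Γ g s) (geo Γ g s') = dist s s' := by
  obtain ⟨r, hr, h⟩ := exists_isometry_ball hΓ (g • vert t)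
  refine ⟨r, hr, fun s hs s' hs' ↦ ?_⟩
  have mem {s : ℝ} (hs : s ∈ Ioo (t - r) (t + r)) : g • vert s ∈ Metric.ball (g • vert t) r := by
    rw [← Real.ball_eq_Ioo] at hs
    rwa [Metric.mem_ball, dist_smul', dist_vert, ← Real.dist_eq]
  rw [geo, geo, h _ (mem hs) _ (mem hs'), dist_smul', dist_vert, Real.dist_eq]

/-- A closed curve following a geodesic at constant speed is a closed geodesic. -/
lemma isClosedGeodesic_of_geo (hΓ : ProperFree Γ) {c : C(UnitAddCircle, HypSurface Γ)}
    {g : SL(2, ℝ)} {L : ℝ} (hL : 0 < L) (h : ∀ t : ℝ, c t = geo Γ g (L * t)) :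
    IsClosedGeodesic c := by
  refine ⟨L, hL, fun t ↦ ?_⟩
  obtain ⟨r, hr, hr'⟩ := exists_dist_geo hΓ g (L * t)
  refine ⟨r / L, by positivity, fun s hs s' hs' ↦ ?_⟩
  have mem {s : ℝ} (hs : s ∈ Ioo (t - r / L) (t + r / L)) :
      L * s ∈ Ioo (L * t - r) (L * t + r) := by
    have e : r = L * (r / L) := by field_simp
    constructor
    · rw [e, ← mul_sub]; exact mul_lt_mul_of_pos_left hs.1 hL
    · rw [e, ← mul_add]; exact mul_lt_mul_of_pos_left hs.2 hL
  rw [h, h, hr' _ (mem hs) _ (mem hs'), Real.dist_eq, ← mul_sub, abs_mul, abs_of_pos hL]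

/-- Two closed geodesics that meet coincide if they cannot be shortened by joining them. -/
lemma geo_eq_of_two {γ δ g k : SL(2, ℝ)} {L M : ℝ} (hγ : γ ∈ Γ) (hδ : δ ∈ Γ)
    (hg : IsTrans γ g L) (hk : IsTrans δ k M) (hL : 0 < L) (hM : 0 < M)
    (h : ∀ l : List (SL(2, ℝ) × ℍ), (∀ p ∈ l, p.1 ∈ Γ) → clsSum Γ l = cls Γ γ + cls Γ δ →
      L + M ≤ lenSum l) {s t : ℝ} (hst : geo Γ g s = geo Γ k t) (u : ℝ) :
    geo Γ g (s + u) = geo Γ k (t + u) := by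
  obtain ⟨ε, hε, e⟩ := proj_eq_iff.1 hst
  -- Conjugating by ε makes the two axes meet in ℍ itself, not only in the quotient.
  set δ' := ε * δ * ε⁻¹ with hδ'
  have hδ'Γ : δ' ∈ Γ := mul_mem (mul_mem hε hδ) (inv_mem hε)
  have hk' : IsTrans δ' (ε * k) M := hk.conj ε
  have e' : g • vert s = (ε * k) • vert t := by rw [mul_smul, e]
  -- The joined loop follows the first axis for length L up to the meeting point, then the second
  -- for length M. Straightening a corner there would make it shorter than L + M.
  have h1 := h [(δ' * γ, g • vert (s - L))] (by simpa using mul_mem hδ'Γ hγ) (by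
    simp only [clsSum, List.map_cons, List.map_nil, List.sum_cons, List.sum_nil, add_zero]
    rw [cls_mul hδ'Γ hγ, cls_conj hδ hε, add_comm])
  simp only [lenSum, List.map_cons, List.map_nil, List.sum_cons, List.sum_nil, add_zero] at h1
  rw [mul_smul, hg.smul_vert, sub_add_cancel] at h1
  have h2 : dist (g • vert s) (δ' • g • vert s) = M := by rw [e', hk'.dist_vert hM.le]
  have h3 := eq_geodesic_of_dist_add_le (g := g) (a := s - L) (b := s) (by linarith)
    (z := δ' • g • vert s) (by rw [h2]; linarith)
  rw [h2] at h3
  have h4 := geodesic_unique hM.ne' e' (by rw [← h3, e', hk'.smul_vert]) u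
  rw [geo, h4, mul_smul, proj_smul_mem hε, geo]

/-- A closed geodesic has no transversal self-intersections if it cannot be shortened by
decomposing it into two loops. -/
lemma geo_eq_of_one {γ g : SL(2, ℝ)} {L : ℝ} (hγ : γ ∈ Γ)
    (hg : IsTrans γ g L) (hL : 0 < L)
    (h : ∀ l : List (SL(2, ℝ) × ℍ), (∀ p ∈ l, p.1 ∈ Γ) → clsSum Γ l = cls Γ γ →
      L ≤ lenSum l) {s t : ℝ} (hst : geo Γ g s = geo Γ g t) (u : ℝ) :
    geo Γ g (s + u) = geo Γ g (t + u) := by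
  -- Reduce t modulo L to a time t' in [s, s + L).
  set n := ⌊(t - s) / L⌋ with hn
  set t' := t + (-n : ℤ) * L with ht'
  have hf : t' = s + Int.fract ((t - s) / L) * L := by
    rw [ht', Int.fract, ← hn, sub_mul, div_mul_cancel₀ _ hL.ne']
    push_cast
    ring
  have htu : geo Γ g (t + u) = geo Γ g (t' + u) := by
    rw [← geo_add_int_mul hγ hg (-n), add_right_comm]
  have hst' : geo Γ g s = geo Γ g t' := by rw [hst, ht', geo_add_int_mul hγ hg]
  rw [htu]
  have hf0 := Int.fract_nonneg ((t - s) / L)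
  have hf1 := Int.fract_lt_one ((t - s) / L)
  rcases hf0.eq_or_lt with h0 | h0
  · rw [hf, ← h0, zero_mul, add_zero]
  have hlt : s < t' := by rw [hf]; have := mul_pos h0 hL; linarith
  have hlt' : t' < s + L := by rw [hf]; have := mul_lt_mul_of_pos_right hf1 hL; linarith
  obtain ⟨δ, hδ, e⟩ := proj_eq_iff.1 hst'.symm
  have hd : dist (g • vert s) (δ • g • vert s) = t' - s := by
    rw [e, dist_smul', dist_vert, abs_sub_comm, abs_of_pos (by linarith)]
  -- Split the curve at the self-intersection. The remainder `γ * δ⁻¹` has length L - (t' - s), so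
  -- the piece δ, based anywhere, needs at least t' - s. Hence δ has minimal displacement at `g •
  -- vert s`, and its axis is the given geodesic.
  have hmin (x : ℍ) : dist (g • vert s) (δ • g • vert s) ≤ dist x (δ • x) := by
    have h1 := h [(δ, x), (γ * δ⁻¹, g • vert t')] (by simp [hδ, mul_mem hγ (inv_mem hδ)]) (by
      simp only [clsSum, List.map_cons, List.map_nil, List.sum_cons, List.sum_nil, add_zero]
      rw [cls_mul hγ (inv_mem hδ), cls_inv hδ]
      abel)
    simp only [lenSum, List.map_cons, List.map_nil, List.sum_cons, List.sum_nil, add_zero] at h1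
    rw [mul_smul, ← e, inv_smul_smul, hg.smul_vert, e, dist_smul', dist_vert, abs_sub_comm,
      abs_of_pos (by linarith)] at h1
    linarith
  obtain ⟨k, hk, hk0⟩ := exists_isTrans_of_min (by rw [hd]; linarith) hmin
  rw [hd] at hk
  have h2 (v : ℝ) : g • vert (s + v) = k • vert (0 + v) := by
    refine geodesic_unique (t := t' - s) (by linarith) hk0 ?_ v
    rw [add_sub_cancel, ← e, hk0, hk.smul_vert]
  have h3 : g • vert (t' + u) = δ • g • vert (s + u) := by
    rw [h2 u, hk.smul_vert, show (0 : ℝ) + u + (t' - s) = 0 + (t' + u - s) by ring, ← h2,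
      add_sub_cancel]
  rw [geo, geo, h3, proj_smul_mem hδ]

/-- A closed geodesic that is homogeneous covers a simple closed curve. -/
lemma exists_simple_of_geo (hΓ : ProperFree Γ) {γ g : SL(2, ℝ)} {L : ℝ} (hγ : γ ∈ Γ)
    (hg : IsTrans γ g L) (hL : 0 < L)
    (h : ∀ s t, geo Γ g s = geo Γ g t → ∀ u, geo Γ g (s + u) = geo Γ g (t + u)) :
    ∃ σ : C(UnitAddCircle, HypSurface Γ), Function.Injective σ ∧ range σ = range (geo Γ g) := by
  -- By homogeneity, the return times to one point are the periods of `geo Γ g`. They are not dense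
  -- because the geodesic is locally isometric, and a generator gives the simple curve.
  let G : AddSubgroup ℝ :=
    { carrier := {τ | geo Γ g τ = geo Γ g 0}
      zero_mem' := rfl
      add_mem' := by
        intro a b ha hb
        have := h a 0 ha b
        rw [zero_add] at this
        exact this.trans hb
      neg_mem' := by
        intro a ha
        have := h a 0 ha (-a)
        rw [add_neg_cancel, zero_add] at this
        exact this.symm }
  have hG {s t : ℝ} (hst : geo Γ g s = geo Γ g t) : s - t ∈ G := by
    have := h s t hst (-t)
    rwa [add_neg_cancel, ← sub_eq_add_neg] at this
  have hLG : L ∈ G := by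
    have := geo_add hγ hg 0
    rwa [zero_add] at this
  obtain ⟨r, hr, hr'⟩ := exists_dist_geo hΓ g 0
  have hdisc : ∃ a, G = AddSubgroup.closure {a} := by
    rcases G.dense_or_cyclic with hd | hc
    · exfalso
      obtain ⟨τ, hτ, hτG⟩ := hd.exists_between (show (0 : ℝ) < r from hr)
      have := hr' τ ⟨by linarith [hτG.1], by linarith [hτG.2]⟩ 0 ⟨by linarith, by linarith⟩
      rw [show geo Γ g τ = geo Γ g 0 from hτ, dist_self] at this
      exact hτG.1.ne (dist_eq_zero.1 this.symm).symm
    · exact hc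
  obtain ⟨a, ha⟩ := hdisc
  have ha0 : a ≠ 0 := by
    rintro rfl
    rw [ha] at hLG
    rw [AddSubgroup.mem_closure_singleton] at hLG
    obtain ⟨n, hn⟩ := hLG
    exact hL.ne (by simpa using hn)
  have mem_iff (x : ℝ) : x ∈ G ↔ ∃ n : ℤ, n • a = x := by
    rw [ha, AddSubgroup.mem_closure_singleton]
  have haG : a ∈ G := (mem_iff a).2 ⟨1, one_smul _ _⟩
  obtain ⟨σ, hσ⟩ := exists_loop_periodic (Γ := Γ) (F := fun t ↦ g • vert (a * t))
    ((continuous_vert.comp (continuous_const_mul a)).const_smul g) (fun t ↦ by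
      have := h a 0 haG (a * t)
      rw [zero_add] at this
      rw [mul_add, mul_one, add_comm]
      exact this)
  refine ⟨σ, ?_, ?_⟩
  · intro x y hxy
    induction x using QuotientAddGroup.induction_on with | H x => ?_
    induction y using QuotientAddGroup.induction_on with | H y => ?_
    have e : geo Γ g (a * x) = geo Γ g (a * y) := (hσ x).symm.trans (hxy.trans (hσ y))
    obtain ⟨n, hn⟩ := (mem_iff _).1 (hG e)
    have : x - y = n := by
      have : a * (x - y) = a * n := by rw [mul_sub, ← hn, zsmul_eq_mul, mul_comm]
      exact mul_left_cancel₀ ha0 this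
    change (x : UnitAddCircle) = (y : UnitAddCircle)
    rw [eq_add_of_sub_eq' this]
    simp
  · apply Subset.antisymm
    · rintro _ ⟨x, rfl⟩
      induction x using QuotientAddGroup.induction_on with | H x => ?_
      exact ⟨a * x, (hσ x).symm⟩
    · rintro _ ⟨x, rfl⟩
      refine ⟨((x / a : ℝ) : UnitAddCircle), ?_⟩
      rw [hσ, mul_div_cancel₀ _ ha0]
      rfl

/-- Finitely many closed geodesics without transversal intersections form an
embedded multicurve. -/
lemma isEmbedded_of_geo (hΓ : ProperFree Γ) {m : Multicurve (HypSurface Γ)}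
    {γ g : Fin m.n → SL(2, ℝ)} {L : Fin m.n → ℝ} (hγ : ∀ i, γ i ∈ Γ)
    (hg : ∀ i, IsTrans (γ i) (g i) (L i)) (hL : ∀ i, 0 < L i)
    (hm : ∀ i, range (m.component i) = range (geo Γ (g i)))
    (h : ∀ i j s t, geo Γ (g i) s = geo Γ (g j) t →
      ∀ u, geo Γ (g i) (s + u) = geo Γ (g j) (t + u)) : m.IsEmbedded := by
  classical
  choose σ hσ hσr using fun i ↦ exists_simple_of_geo hΓ (hγ i) (hg i) (hL i) (h i i)
  -- Different components may cover the same simple curve; passing to the set of images keeps each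
  -- curve once.
  let R : Finset (Set (HypSurface Γ)) := Finset.univ.image fun i ↦ range (σ i)
  have hR (A : R) : ∃ i, range (σ i) = A := by
    obtain ⟨i, -, hi⟩ := Finset.mem_image.1 A.2
    exact ⟨i, hi⟩
  choose rep hrep using hR
  let e := R.equivFin.symm
  refine ⟨R.card, fun j ↦ σ (rep (e j)), fun j ↦ hσ _, fun j j' hjj ↦ ?_, ?_⟩
  · rw [Set.disjoint_iff_inter_eq_empty, ← Set.not_nonempty_iff_eq_empty]
    rintro ⟨x, hx, hx'⟩
    refine hjj (e.injective (Subtype.ext ?_))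
    rw [← hrep, ← hrep]
    rw [hσr] at hx hx' ⊢
    rw [hσr]
    obtain ⟨s, rfl⟩ := hx
    obtain ⟨t, ht⟩ := hx'
    have key := h _ _ _ _ ht
    apply Subset.antisymm
    · rintro _ ⟨u, rfl⟩
      refine ⟨t + (u - s), ?_⟩
      rw [key, add_sub_cancel]
    · rintro _ ⟨u, rfl⟩
      refine ⟨s + (u - t), ?_⟩
      rw [← key, add_sub_cancel]
  · apply Subset.antisymm
    · refine iUnion_subset fun i ↦ ?_
      have hi : range (σ i) ∈ R := Finset.mem_image_of_mem _ (Finset.mem_univ i)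
      refine subset_trans ?_ (subset_iUnion _ (e.symm ⟨_, hi⟩))
      simp only [Equiv.apply_symm_apply]
      rw [hrep, hm, ← hσr]
    · refine iUnion_subset fun j ↦ ?_
      refine subset_trans ?_ (subset_iUnion _ (rep (e j)))
      rw [hσr, hm]

/-- Regularity of minimal multicurves. -/
theorem _root_.Multicurve.IsMinimalFor.isEmbedded (hΓ : ProperFree Γ)
    {m : Multicurve (HypSurface Γ)}
    {h : SingularH1 (HypSurface Γ)} (hm : m.IsMinimalFor h)
    (hc : ∀ i, ∃ s t, m.component i s ≠ m.component i t) :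
    m.IsEmbedded ∧ ∀ i, IsClosedGeodesicUpToParam (m.component i) := by
  choose F hF hFc γ hγ hFγ using fun i ↦ exists_lift_loop hΓ (m.component i)
  have hF1 (i) : F i 1 = γ i • F i 0 := by rw [← hFγ, zero_add]
  have hcls (i) : loopClass (m.component i) = cls Γ (γ i) :=
    loopClass_eq (hF i) (fun t _ ↦ (hFc i t).symm) (hγ i) (hF1 i)
  -- Replacing every component by a geodesic loop with the same deck transformation gives a
  -- competitor of finite length.
  have hfin' : ∑ i, curveLength (m.component i) < ⊤ := by
    refine lt_of_le_of_lt (sum_curveLength_le hΓ hm Finset.univ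
      (l := (Finset.univ.toList.map fun i ↦ (γ i, F i 0))) ?_ ?_ (by simp)) ENNReal.ofReal_lt_top
    · simp only [List.mem_map]
      rintro _ ⟨i, -, rfl⟩
      exact hγ i
    · rw [clsSum, List.map_map, ← Finset.sum_map_toList]
      congr 1
      exact List.map_congr_left fun i _ ↦ (hcls i).symm
  have hfin (s : Finset (Fin m.n)) : ∑ i ∈ s, curveLength (m.component i) ≠ ⊤ :=
    (lt_of_le_of_lt (Finset.sum_le_sum_of_subset (Finset.subset_univ s)) hfin').ne
  set L : Fin m.n → ℝ := fun i ↦ dist (F i 0) (γ i • F i 0) with hLdef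
  have hone (i) (l : List (SL(2, ℝ) × ℍ)) (hl : ∀ p ∈ l, p.1 ∈ Γ)
      (hls : clsSum Γ l = cls Γ (γ i)) :
      curveLength (m.component i) ≤ ENNReal.ofReal (lenSum l) := by
    have := sum_curveLength_le hΓ hm {i} hl (by rw [Finset.sum_singleton, hcls, hls]) (hfin _)
    rwa [Finset.sum_singleton] at this
  have hdisp (i) (z : ℍ) : curveLength (m.component i) ≤ ENNReal.ofReal (dist z (γ i • z)) := by
    have := hone i [(γ i, z)] (by simpa using hγ i) (by simp [clsSum])
    simpa [lenSum] using this
  -- Each component is as short as the geodesic segment between the endpoints of its lift.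
  have hLeq (i) : curveLength (m.component i) = ENNReal.ofReal (L i) := by
    refine le_antisymm (hdisp i _) ?_
    rw [← edist_dist, ← hF1]
    exact edist_le_curveLength hΓ (hF i) fun t _ ↦ (hFc i t).symm
  -- Displacement zero would mean length zero, that is, a constant component.
  have hL (i) : 0 < L i := by
    refine lt_of_le_of_ne dist_nonneg fun h0 ↦ ?_
    have hconst (t : ℝ) (ht : t ∈ Icc (0 : ℝ) 1) : F i 0 = F i t := by
      have h1 := dist_add_le_of_curveLength_le hΓ (hF i) (hFc i) le_rfl
        (by rw [hLeq, ← h0]) ht.1 le_rfl ht.2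
      rw [← dist_le_zero]
      have h2 := dist_nonneg (x := F i t) (y := F i t)
      have h3 := dist_nonneg (x := F i t) (y := F i 1)
      linarith
    have hcc (x : UnitAddCircle) : m.component i x = proj Γ (F i 0) := by
      induction x using QuotientAddGroup.induction_on with | H x => ?_
      have : ((x : ℝ) : UnitAddCircle) = ((Int.fract x : ℝ) : UnitAddCircle) := by
        rw [← Int.self_sub_floor]
        simp
      refine (congrArg _ this).trans ?_
      rw [← hFc, ← hconst _ ⟨Int.fract_nonneg x, (Int.fract_lt_one x).le⟩]
    obtain ⟨s, t, hst⟩ := hc i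
    exact hst (by rw [hcc, hcc])
  have hmin (i) (z : ℍ) : L i ≤ dist z (γ i • z) := by
    rw [← ENNReal.ofReal_le_ofReal_iff dist_nonneg, ← hLeq]
    exact hdisp i z
  choose g ψ hg hψc hψm hψ1 hψ using fun i ↦ exists_monotone_axis (hF i) (hFγ i) rfl (hL i)
    (hmin i) fun s t h0 hst h1 ↦
      dist_add_le_of_curveLength_le hΓ (hF i) (hFc i) (hL i).le (hLeq i).le h0 hst h1
  have hcg (i) (t : ℝ) : m.component i t = geo Γ (g i) (ψ i t) := by rw [← hFc, hψ, geo]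
  constructor
  · refine isEmbedded_of_geo hΓ hγ hg hL (fun i ↦ ?_) fun i j s t hst u ↦ ?_
    · apply Subset.antisymm
      · rintro _ ⟨x, rfl⟩
        induction x using QuotientAddGroup.induction_on with | H x => ?_
        exact ⟨_, (hcg i x).symm⟩
      -- This makes ψ unbounded in both directions, hence surjective: the component covers its whole
      -- geodesic.
      · have hint (n : ℤ) : ψ i n = ψ i 0 + n * L i := by
          have : ∀ x, (fun t ↦ ψ i t - L i * t) (x + 1) = (fun t ↦ ψ i t - L i * t) x := by
            intro x; simp only; rw [hψ1]; ring
          have := (Function.Periodic.int_mul (f := fun t ↦ ψ i t - L i * t) this n) 0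
          simp at this
          linarith
        rintro _ ⟨u, rfl⟩
        obtain ⟨n, hn⟩ := exists_int_le ((u - ψ i 0) / L i)
        obtain ⟨k, hk⟩ := exists_int_ge ((u - ψ i 0) / L i)
        obtain ⟨x, hx⟩ : ∃ x, ψ i x = u := by
          refine mem_range_of_exists_le_of_exists_ge (hψc i) ⟨n, ?_⟩ ⟨k, ?_⟩
          · rw [hint]; rw [le_div_iff₀ (hL i)] at hn; linarith
          · rw [hint]; rw [div_le_iff₀ (hL i)] at hk; linarith
        exact ⟨(x : UnitAddCircle), by rw [hcg, hx]⟩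
    · by_cases hij : i = j
      · subst hij
        refine geo_eq_of_one (hγ i) (hg i) (hL i) (fun l hl hls ↦ ?_) hst u
        rw [← ENNReal.ofReal_le_ofReal_iff (lenSum_nonneg l), ← hLeq]
        exact hone i l hl hls
      · refine geo_eq_of_two (hγ i) (hγ j) (hg i) (hg j) (hL i) (hL j) (fun l hl hls ↦ ?_) hst u
        have := sum_curveLength_le hΓ hm {i, j} hl
          (by rw [Finset.sum_pair hij, hcls, hcls, hls]) (hfin _)
        rwa [Finset.sum_pair hij, hLeq, hLeq, ← ENNReal.ofReal_add (hL i).le (hL j).le,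
          ENNReal.ofReal_le_ofReal_iff (lenSum_nonneg l)] at this
  · intro i
    obtain ⟨c, hc⟩ := exists_loop_periodic (Γ := Γ) (F := fun t ↦ g i • vert (L i * t))
      ((continuous_vert.comp (continuous_const_mul (L i))).const_smul (g i)) (fun t ↦ by
        rw [mul_add, mul_one]
        exact geo_add (hγ i) (hg i) _)
    refine ⟨c, isClosedGeodesic_of_geo hΓ (hL i) hc, fun t ↦ ψ i t / L i, (hψc i).div_const _,
      (hψm i).div_const (hL i).le, fun t ↦ ?_, fun t ↦ ?_⟩
    · have e : ψ i (t + 1) = ψ i t + L i := hψ1 i t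
      change ψ i (t + 1) / L i = ψ i t / L i + 1
      rw [e, add_div, div_self (hL i).ne']
    · rw [hcg, hc, mul_div_cancel₀ _ (hL i).ne', geo]

end HypSurface

namespace HypSurface

open HypGeom

variable {Γ : Subgroup SL(2, ℝ)}

/-! ### Existence of minimal multicurves -/

/-- A bad sequence would be strictly decreasing, giving infinitely many elements below its first
term. -/
lemma isPWO_of_finite_inter {T : Set ℝ} (h : ∀ R, (T ∩ Iic R).Finite) : T.IsPWO := by
  intro f
  by_contra! hc
  have hanti : StrictAnti fun n ↦ (f n : ℝ) := fun m n hmn ↦ not_le.1 (hc m n hmn)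
  exact (infinite_range_of_injective hanti.injective) ((h (f 0)).subset (by
    rintro _ ⟨n, rfl⟩
    exact ⟨(f n).2, hanti.antitone (Nat.zero_le n)⟩))

variable (Γ) in
/-- A list of translations in the group, with their axes and lengths. -/
def IsTransList (l : List (SL(2, ℝ) × SL(2, ℝ) × ℝ)) : Prop :=
  ∀ p ∈ l, p.1 ∈ Γ ∧ 0 < p.2.2 ∧ IsTrans p.1 p.2.1 p.2.2

variable (Γ) in
/-- The set of translation lengths of the elements of the group. -/
def transLengths : Set ℝ := {L | 0 < L ∧ ∃ γ ∈ Γ, ∃ g, IsTrans γ g L}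

/-- Null-homologous non-translations are dropped, and a translation length is at most any
displacement of the element, so the homology sum is kept and the length does not grow. -/
lemma exists_transList
    (htri : ∀ γ ∈ Γ, (∃ g L, 0 < L ∧ IsTrans γ g L) ∨ cls Γ γ = 0)
    {ι : Type*} (s : Finset ι) {γ : ι → SL(2, ℝ)} (hγ : ∀ i, γ i ∈ Γ) (z : ι → ℍ) :
    ∃ l, IsTransList Γ l ∧ (l.map fun p ↦ cls Γ p.1).sum = ∑ i ∈ s, cls Γ (γ i) ∧
      (l.map fun p ↦ p.2.2).sum ≤ ∑ i ∈ s, dist (z i) (γ i • z i) := by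
  classical
  induction s using Finset.induction_on with
  | empty => exact ⟨[], by simp [IsTransList], by simp, by simp⟩
  | insert i s hi ih =>
    obtain ⟨l, h1, h2, h3⟩ := ih
    rw [Finset.sum_insert hi, Finset.sum_insert hi]
    rcases htri _ (hγ i) with ⟨g, L, hL, hg⟩ | h0
    · refine ⟨(γ i, g, L) :: l, ?_, ?_, ?_⟩
      · intro p hp
        rcases List.mem_cons.1 hp with rfl | hp
        · exact ⟨hγ i, hL, hg⟩
        · exact h1 p hp
      · rw [List.map_cons, List.sum_cons, h2]
      · rw [List.map_cons, List.sum_cons]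
        exact add_le_add (hg.le_dist _) h3
    · exact ⟨l, h1, by rw [h2, h0, zero_add], by linarith [dist_nonneg (x := z i) (y := γ i • z i)]⟩

lemma exists_multicurve (hΓ : ProperFree Γ) {l : List (SL(2, ℝ) × SL(2, ℝ) × ℝ)}
    (hl : IsTransList Γ l) : ∃ m : Multicurve (HypSurface Γ),
      m.homologyClass = (l.map fun p ↦ cls Γ p.1).sum ∧
      m.length = ENNReal.ofReal (l.map fun p ↦ p.2.2).sum ∧
      (∀ i, IsClosedGeodesic (m.component i)) ∧
      ∀ i, ∃ s t, m.component i s ≠ m.component i t := by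
  have hmem (k : Fin l.length) := hl l[k] (List.getElem_mem _)
  have hF (k : Fin l.length) : Continuous fun t : ℝ ↦ l[k].2.1 • vert (l[k].2.2 * t) :=
    (continuous_vert.comp (continuous_const_mul _)).const_smul _
  have hstep (k : Fin l.length) (t : ℝ) : l[k].2.1 • vert (l[k].2.2 * (t + 1)) =
      l[k].1 • l[k].2.1 • vert (l[k].2.2 * t) := by
    rw [(hmem k).2.2.smul_vert, mul_add, mul_one]
  choose c hc using fun k ↦ exists_loop_periodic (Γ := Γ) (hF k)
    (fun t ↦ by rw [hstep, proj_smul_mem (hmem k).1])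
  obtain ⟨m, h1, h2, e, he⟩ := Multicurve.exists_of_fintype c
  refine ⟨m, ?_, ?_, fun i ↦ ?_, fun i ↦ ?_⟩
  · rw [h1, ← Fin.sum_univ_fun_getElem]
    refine Finset.sum_congr rfl fun k _ ↦ loopClass_eq (hF k) (fun t _ ↦ hc k t) (hmem k).1 ?_
    rw [← zero_add (1 : ℝ)]
    exact hstep k 0
  · rw [h2, ← Fin.sum_univ_fun_getElem]
    refine Eq.trans ?_ (ENNReal.ofReal_sum_of_nonneg fun k _ ↦ (hmem k).2.1.le).symm
    refine Finset.sum_congr rfl fun k _ ↦ ?_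
    rw [curveLength_eq hΓ (hF k) fun t _ ↦ hc k t,
      eVariationOn_geodesic _ (hmem k).2.1.le zero_le_one, sub_zero, mul_one]
  · rw [he]
    exact isClosedGeodesic_of_geo hΓ (hmem _).2.1 (hc _)
  · rw [he]
    obtain ⟨v, hv, h⟩ := isClosedGeodesic_of_geo hΓ (hmem _).2.1 (hc (e i))
    obtain ⟨ε, hε, h⟩ := h 0
    refine ⟨((ε / 2 : ℝ) : UnitAddCircle), ((0 : ℝ) : UnitAddCircle), fun heq ↦ ?_⟩
    have := h (ε / 2) ⟨by linarith, by linarith⟩ 0 ⟨by linarith, by linarith⟩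
    rw [heq, dist_self, sub_zero, abs_of_pos (by linarith)] at this
    have : 0 < v * (ε / 2) := by positivity
    linarith

/-- If the group has only finitely many translation lengths below each bound and
if all elements that are not translations are homologically trivial, then minimal
multicurves exist. -/
theorem exists_isMinimalFor (hΓ : ProperFree Γ)
    (htri : ∀ γ ∈ Γ, (∃ g L, 0 < L ∧ IsTrans γ g L) ∨ cls Γ γ = 0)
    (hfin : ∀ R, (transLengths Γ ∩ Iic R).Finite) (h : SingularH1 (HypSurface Γ)) :
    ∃ m : Multicurve (HypSurface Γ), m.IsMinimalFor h ∧ m.length < ⊤ ∧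
      m.IsEmbedded ∧ ∀ i, IsClosedGeodesic (m.component i) := by
  set V : Set ℝ := (fun l : List (SL(2, ℝ) × SL(2, ℝ) × ℝ) ↦ (l.map fun p ↦ p.2.2).sum) ''
    {l | IsTransList Γ l ∧ (l.map fun p ↦ cls Γ p.1).sum = h} with hV
  have hne : V.Nonempty := by
    obtain ⟨γ, hγ, rfl⟩ := exists_cls_eq hΓ h
    obtain ⟨l, h1, h2, -⟩ := exists_transList htri (Finset.univ : Finset Unit)
      (γ := fun _ ↦ γ) (fun _ ↦ hγ) fun _ ↦ I
    exact ⟨_, l, ⟨h1, by simpa using h2⟩, rfl⟩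
  -- Finite sums of elements of a partially well-ordered set of non-negative reals are again
  -- partially well-ordered. This gives a minimum without bounding the number of components.
  have hwf : V.IsWF := by
    refine ((isPWO_of_finite_inter hfin).addSubmonoid_closure fun x hx ↦ hx.1.le).isWF.mono ?_
    rintro _ ⟨l, ⟨hl, -⟩, rfl⟩
    refine AddSubmonoid.list_sum_mem _ fun x hx ↦ ?_
    obtain ⟨p, hp, rfl⟩ := List.mem_map.1 hx
    exact AddSubmonoid.subset_closure ⟨(hl p hp).2.1, p.1, (hl p hp).1, p.2.1, (hl p hp).2.2⟩
  obtain ⟨l, ⟨hl, hlh⟩, hlmin⟩ := hwf.min_mem hne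
  obtain ⟨m, h1, h2, h3, h4⟩ := exists_multicurve hΓ hl
  have hmin : m.IsMinimalFor h := by
    refine ⟨h1.trans hlh, fun m' hm' ↦ ?_⟩
    choose F hF hFc γ hγ hFγ using fun i ↦ exists_lift_loop hΓ (m'.component i)
    have hF1 (i) : F i 1 = γ i • F i 0 := by rw [← hFγ, zero_add]
    obtain ⟨l', h1', h2', h3'⟩ := exists_transList htri Finset.univ hγ fun i ↦ F i 0
    have hcl : (l'.map fun p ↦ cls Γ p.1).sum = h := by
      rw [h2', ← hm']
      exact Finset.sum_congr rfl fun i _ ↦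
        (loopClass_eq (hF i) (fun t _ ↦ (hFc i t).symm) (hγ i) (hF1 i)).symm
    have hle := hwf.min_le hne (show _ ∈ V from ⟨l', ⟨h1', hcl⟩, rfl⟩)
    rw [← hlmin] at hle
    rw [h2]
    refine (ENNReal.ofReal_le_ofReal (hle.trans h3')).trans ?_
    rw [ENNReal.ofReal_sum_of_nonneg fun _ _ ↦ dist_nonneg]
    refine Finset.sum_le_sum fun i _ ↦ ?_
    rw [← edist_dist, ← hF1]
    exact edist_le_curveLength hΓ (hF i) fun t _ ↦ (hFc i t).symm
  exact ⟨m, hmin, by rw [h2]; exact ENNReal.ofReal_lt_top, (hmin.isEmbedded hΓ h4).1, h3⟩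

end HypSurface

namespace HypGeom

/-! ### The thick part of a surface of finite area -/

lemma volume_preimage_smul (g : SL(2, ℝ)) (s : Set ℍ) :
    volume ((fun z : ℍ ↦ g • z) ⁻¹' s) = volume s :=
  measure_preimage_smul volume (Matrix.SpecialLinearGroup.toGL g : GL (Fin 2) ℝ) s

lemma volume_ball_eq (z : ℍ) (r : ℝ) : volume (Metric.ball z r) = volume (Metric.ball I r) := by
  rw [← volume_preimage_smul z.toSL2R]
  congr 1
  ext w
  rw [mem_preimage, Metric.mem_ball, Metric.mem_ball, ← dist_smul' z.toSL2R w, toSL2R_smul_I]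

lemma volume_ball_ne_zero {r : ℝ} (hr : 0 < r) : volume (Metric.ball I r : Set ℍ) ≠ 0 := by
  intro h
  rw [volume_def] at h
  have h1 := withDensity_absolutelyContinuous' (μ := (volume : Measure ℂ).comap UpperHalfPlane.coe)
    (f := fun z : ℍ ↦ (((1 / NNReal.mk z.im z.im_pos.le : NNReal) ^ 2 : NNReal) : ℝ≥0∞)) (by
      refine Measurable.aemeasurable ?_
      refine measurable_coe_nnreal_ennreal.comp (Measurable.pow_const (Measurable.const_div ?_ _) _)
      exact (continuous_im.subtype_mk _).measurable)
    (Filter.Eventually.of_forall fun z ↦ by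
      have : NNReal.mk z.im z.im_pos.le ≠ 0 := NNReal.ne_iff.1 z.im_ne_zero
      exact ENNReal.coe_ne_zero.2 (pow_ne_zero 2 (one_div_ne_zero this))) h
  rw [measurableEmbedding_coe.comap_apply] at h1
  refine (IsOpen.measure_pos volume
    (isOpenEmbedding_coe.isOpenMap _ Metric.isOpen_ball) ?_).ne' h1
  exact (Metric.nonempty_ball.2 hr).image _

variable {Γ : Subgroup SL(2, ℝ)}

lemma ProperFree.countable (hΓ : ProperFree Γ) : Countable Γ := by
  have : (Γ : Set SL(2, ℝ)) = ⋃ n : ℕ, {γ | γ ∈ Γ ∧ dist I (γ • I) ≤ n} := by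
    ext γ
    simp only [mem_iUnion]
    refine ⟨fun h ↦ ?_, fun ⟨_, h⟩ ↦ h.1⟩
    obtain ⟨n, hn⟩ := exists_nat_ge (dist I (γ • I))
    exact ⟨n, h, hn⟩
  have h2 : (Γ : Set SL(2, ℝ)).Countable := by
    rw [this]
    exact countable_iUnion fun n ↦ (hΓ.finite n).countable
  exact h2

/-- Disjoint embedded discs in a surface have total area at most the area of the surface. -/
lemma card_mul_volume_le (hΓ : ProperFree Γ) {r : ℝ} (P : Finset ℍ)
    (hP : ∀ p ∈ P, ∀ γ ∈ Γ, dist p (γ • p) < 2 * r → ∀ w : ℍ, γ • w = w)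
    (hP' : ∀ p ∈ P, ∀ q ∈ P, p ≠ q → ∀ γ ∈ Γ, 2 * r ≤ dist p (γ • q)) :
    P.card * volume (Metric.ball I r) ≤ HypSurface.area Γ := by
  refine le_iInf fun ⟨D, hD, hs⟩ ↦ ?_
  have := hΓ.countable
  let G := (MulAction.toPermHom Γ ℍ).range
  have hG : Countable G := (MonoidHom.rangeRestrict_surjective _).countable
  have hG' (σ : G) : ∃ γ ∈ Γ, ∀ z : ℍ, γ • z = (σ : Equiv.Perm ℍ) z := by
    obtain ⟨_, γ, rfl⟩ := σ
    exact ⟨γ, γ.2, fun _ ↦ rfl⟩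
  choose ρ hρ hρ' using hG'
  -- The piece of D that `ρ x.2` carries into the disc around `x.1`. Indexing by G, not Γ, avoids
  -- repeating pieces for elements with the same action.
  let A : P × G → Set ℍ := fun x ↦ (fun z : ℍ ↦ ρ x.2 • z) ⁻¹' (Metric.ball (x.1 : ℍ) r) ∩ D
  have hmeas (x) : MeasurableSet (A x) :=
    (Metric.isOpen_ball.preimage (continuous_const_smul (ρ x.2))).measurableSet.inter hD
  have hdisj : Pairwise (Function.onFun Disjoint A) := by
    rintro ⟨p, σ⟩ ⟨q, τ⟩ hne
    rw [Function.onFun, Set.disjoint_left]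
    rintro z ⟨hz, -⟩ ⟨hz', -⟩
    refine hne ?_
    simp only [mem_preimage, Metric.mem_ball] at hz hz'
    have hd : dist (p : ℍ) ((ρ σ * (ρ τ)⁻¹) • (q : ℍ)) < 2 * r := by
      have h1 := dist_triangle (p : ℍ) (ρ σ • z) ((ρ σ * (ρ τ)⁻¹) • (q : ℍ))
      rw [mul_smul, dist_smul', ← dist_smul' (ρ τ) z, smul_inv_smul] at h1
      rw [dist_comm] at hz
      rw [mul_smul]
      linarith
    have hmem := mul_mem (hρ σ) (inv_mem (hρ τ))
    have hpq : p = q := by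
      by_contra h
      exact absurd hd (not_lt.2 (hP' p p.2 q q.2 (fun h' ↦ h (Subtype.ext h')) _ hmem))
    subst hpq
    have h2 := hP p p.2 _ hmem hd
    have : σ = τ := by
      apply Subtype.ext
      ext1 w
      rw [← hρ', ← hρ', ← h2 (ρ τ • w), mul_smul, inv_smul_smul]
    rw [this]
  -- Since D meets every orbit, the disc is covered by isometric copies of its pieces.
  have hball (p : P) : volume (Metric.ball I r) ≤ ∑' σ : G, volume (A (p, σ)) := by
    rw [← volume_ball_eq p]
    have hsub : Metric.ball (p : ℍ) r ⊆ ⋃ σ : G, (fun z : ℍ ↦ (ρ σ)⁻¹ • z) ⁻¹' A (p, σ) := by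
      intro x hx
      obtain ⟨z, hz, hzx⟩ := (hs ▸ mem_univ (HypSurface.proj Γ x) :
        HypSurface.proj Γ x ∈ HypSurface.proj Γ '' D)
      obtain ⟨γ, hγ⟩ := HypSurface.proj_eq_proj_iff.1 hzx.symm
      refine mem_iUnion.2 ⟨⟨_, γ, rfl⟩, ?_⟩
      have e : ρ ⟨_, γ, rfl⟩ • z = x := (hρ' _ z).trans hγ
      have e' : (ρ ⟨_, γ, rfl⟩)⁻¹ • x = z := by rw [← e, inv_smul_smul]
      simp only [A, mem_preimage, mem_inter_iff]
      rw [e', e]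
      exact ⟨hx, hz⟩
    refine (measure_mono hsub).trans ((measure_iUnion_le _).trans_eq ?_)
    exact tsum_congr fun σ ↦ volume_preimage_smul _ _
  calc (P.card : ℝ≥0∞) * volume (Metric.ball I r)
      = ∑ p : P, volume (Metric.ball I r) := by simp
    _ ≤ ∑ p : P, ∑' σ : G, volume (A (p, σ)) := Finset.sum_le_sum fun p _ ↦ hball p
    _ = ∑' x : P × G, volume (A x) := by
        rw [← tsum_fintype (L := .unconditional P)]
        exact (ENNReal.tsum_prod (f := fun p σ ↦ volume (A (p, σ)))).symm
    _ = volume (⋃ x, A x) := (measure_iUnion hdisj hmeas).symm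
    _ ≤ volume D := measure_mono (iUnion_subset fun x ↦ inter_subset_right)

/-- The thick part of a surface of finite area is bounded. -/
lemma exists_thick_bound (hΓ : ProperFree Γ) (harea : HypSurface.area Γ < ⊤) {ε : ℝ}
    (hε : 0 < ε) : ∃ R, ∀ z : ℍ, (∀ γ ∈ Γ, dist z (γ • z) < ε → ∀ w : ℍ, γ • w = w) →
      ∃ γ ∈ Γ, dist I (γ • z) ≤ R := by
  classical
  let good (P : Finset ℍ) : Prop :=
    (∀ p ∈ P, ∀ γ ∈ Γ, dist p (γ • p) < ε → ∀ w : ℍ, γ • w = w) ∧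
    ∀ p ∈ P, ∀ q ∈ P, p ≠ q → ∀ γ ∈ Γ, ε ≤ dist p (γ • q)
  have hv := volume_ball_ne_zero (half_pos hε)
  have hbdd : BddAbove {n | ∃ P, good P ∧ P.card = n} := by
    obtain ⟨N, hN⟩ := ENNReal.exists_nat_gt
      (show HypSurface.area Γ / volume (Metric.ball I (ε / 2) : Set ℍ) ≠ ⊤ from
        ENNReal.div_ne_top harea.ne hv)
    refine ⟨N, ?_⟩
    rintro _ ⟨P, hP, rfl⟩
    have h1 := card_mul_volume_le hΓ (r := ε / 2) P
      (by rw [mul_div_cancel₀ _ two_ne_zero]; exact hP.1)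
      (by rw [mul_div_cancel₀ _ two_ne_zero]; exact hP.2)
    have h2 := (ENNReal.le_div_iff_mul_le (Or.inl hv) (Or.inr harea.ne)).2 h1
    exact_mod_cast (h2.trans_lt hN).le
  -- Take a set of thick points, ε-separated modulo Γ, of maximal cardinality. The area bounds its
  -- size, and by maximality every thick point is within ε of P up to Γ.
  obtain ⟨P, hP, hcard⟩ := Nat.sSup_mem (s := {n | ∃ P, good P ∧ P.card = n})
    ⟨0, ∅, by simp [good], by simp⟩ hbdd
  refine ⟨∑ p ∈ P, dist I p + ε, fun z hz ↦ ?_⟩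
  have key : ∃ p ∈ P, ∃ γ ∈ Γ, dist p (γ • z) < ε := by
    by_contra! hcon
    have hzP : z ∉ P := fun h ↦ by
      have := hcon z h 1 (one_mem Γ)
      rw [one_smul, dist_self] at this
      linarith
    have hgood : good (insert z P) := by
      refine ⟨fun p hp ↦ ?_, fun p hp q hq hpq γ hγ ↦ ?_⟩
      · rcases Finset.mem_insert.1 hp with rfl | hp
        · exact hz
        · exact hP.1 p hp
      · rcases Finset.mem_insert.1 hp with rfl | hp' <;> rcases Finset.mem_insert.1 hq with rfl | hq'
        · exact absurd rfl hpq
        · have := hcon q hq' γ⁻¹ (inv_mem hγ)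
          rwa [← dist_smul' γ, smul_inv_smul, dist_comm] at this
        · exact hcon p hp' γ hγ
        · exact hP.2 p hp' q hq' hpq γ hγ
    have h1 := le_csSup hbdd ⟨_, hgood, rfl⟩
    rw [Finset.card_insert_of_notMem hzP, ← hcard] at h1
    omega
  obtain ⟨p, hp, γ, hγ, hd⟩ := key
  refine ⟨γ, hγ, (dist_triangle I p _).trans (add_le_add ?_ hd.le)⟩
  exact Finset.single_le_sum (f := fun p ↦ dist I p) (fun _ _ ↦ dist_nonneg) hp

end HypGeom

namespace HypGeom

/-! ### Classification of isometries -/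

lemma mul_apply' (g h : SL(2, ℝ)) (i j : Fin 2) :
    (g * h) i j = g i 0 * h 0 j + g i 1 * h 1 j := by
  rw [Matrix.SpecialLinearGroup.coe_mul, Matrix.mul_apply, Fin.sum_univ_two]

lemma inv_00 (g : SL(2, ℝ)) : g⁻¹ 0 0 = g 1 1 := by
  rw [Matrix.SpecialLinearGroup.coe_inv, Matrix.adjugate_fin_two]; rfl

lemma inv_01 (g : SL(2, ℝ)) : g⁻¹ 0 1 = -g 0 1 := by
  rw [Matrix.SpecialLinearGroup.coe_inv, Matrix.adjugate_fin_two]; rfl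

lemma inv_10 (g : SL(2, ℝ)) : g⁻¹ 1 0 = -g 1 0 := by
  rw [Matrix.SpecialLinearGroup.coe_inv, Matrix.adjugate_fin_two]; rfl

lemma inv_11 (g : SL(2, ℝ)) : g⁻¹ 1 1 = g 0 0 := by
  rw [Matrix.SpecialLinearGroup.coe_inv, Matrix.adjugate_fin_two]; rfl

/-- The horizontal translation by `x`. -/
def trn (x : ℝ) : SL(2, ℝ) := ⟨!![1, x; 0, 1], by simp [Matrix.det_fin_two_of]⟩

@[simp] lemma trn_00 (x : ℝ) : trn x 0 0 = 1 := rfl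
@[simp] lemma trn_01 (x : ℝ) : trn x 0 1 = x := rfl
@[simp] lemma trn_10 (x : ℝ) : trn x 1 0 = 0 := rfl
@[simp] lemma trn_11 (x : ℝ) : trn x 1 1 = 1 := rfl

@[simp] lemma trn_re (x : ℝ) (z : ℍ) : (trn x • z).re = z.re + x := by
  simp [re_smul, denSq]

@[simp] lemma trn_im (x : ℝ) (z : ℍ) : (trn x • z).im = z.im := by
  simp [im_smul, denSq]

lemma re_smul_of_c {g : SL(2, ℝ)} (hc : g 1 0 = 0) (z : ℍ) :
    (g • z).re = g 0 0 ^ 2 * z.re + g 0 0 * g 0 1 := by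
  have hd := det_eq g
  rw [hc, mul_zero, sub_zero] at hd
  have h1 : g 1 1 ≠ 0 := by rintro h; simp [h] at hd
  rw [re_smul, denSq, hc]
  have h0 : g 0 0 = 1 / g 1 1 := by field_simp; exact hd
  rw [h0]
  field_simp
  ring

lemma im_smul_of_c {g : SL(2, ℝ)} (hc : g 1 0 = 0) (z : ℍ) :
    (g • z).im = g 0 0 ^ 2 * z.im := by
  have hd := det_eq g
  rw [hc, mul_zero, sub_zero] at hd
  have h1 : g 1 1 ≠ 0 := by rintro h; simp [h] at hd
  rw [im_smul, denSq, hc]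
  have h0 : g 0 0 = 1 / g 1 1 := by field_simp; exact hd
  rw [h0]
  field_simp
  ring

/-- `γ` is conjugate to the translation by `x`. -/
def IsPar (γ g : SL(2, ℝ)) (x : ℝ) : Prop := ∀ z : ℍ, γ • g • z = g • trn x • z

lemma IsTrans.flip {γ g : SL(2, ℝ)} {L : ℝ} (h : IsTrans γ g L) :
    IsTrans γ (g * rot (Real.pi / 2)) (-L) := by
  have e (s : ℝ) : (g * rot (Real.pi / 2)) • vert s = g • vert (-s) := by
    rw [mul_smul, rot_pi_div_two_vert]
  refine isTrans_of_two_points (a := 0) (t := 1) one_ne_zero ?_ ?_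
  · rw [e, e, h.smul_vert]; congr 2; ring
  · rw [e, e, h.smul_vert]; congr 2; ring

lemma IsTrans.exists_pos {γ g : SL(2, ℝ)} {L : ℝ} (h : IsTrans γ g L) (hL : L ≠ 0) :
    ∃ g L, 0 < L ∧ IsTrans γ g L := by
  rcases hL.lt_or_gt with h0 | h0
  · exact ⟨_, -L, neg_pos.2 h0, h.flip⟩
  · exact ⟨g, L, h0, h⟩

/-- The action is z ↦ a²z + ab. If a² ≠ 1, the real number ab/(1 - a²) is fixed, and moving it to 0
leaves the dilation by a². -/
lemma isTrans_or_isPar_of_c {γ : SL(2, ℝ)} (hc : γ 1 0 = 0) :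
    (∃ x, ∀ z : ℍ, γ • z = trn x • z) ∨
    ∃ g L, L ≠ 0 ∧ IsTrans γ g L ∧ g 1 0 = 0 ∧ γ 0 0 ^ 2 = Real.exp L := by
  have hd := det_eq γ
  rw [hc, mul_zero, sub_zero] at hd
  have h0 : γ 0 0 ≠ 0 := by rintro h; simp [h] at hd
  by_cases h1 : γ 0 0 ^ 2 = 1
  · exact Or.inl ⟨γ 0 0 * γ 0 1, fun z ↦
      hext (by rw [re_smul_of_c hc, h1, trn_re, one_mul]) (by rw [im_smul_of_c hc, h1, trn_im, one_mul])⟩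
  · have hp : 0 < γ 0 0 ^ 2 := sq_pos_iff.2 h0
    refine Or.inr ⟨trn (γ 0 0 * γ 0 1 / (1 - γ 0 0 ^ 2)), Real.log (γ 0 0 ^ 2), ?_, fun z ↦ ?_,
      rfl, (Real.exp_log hp).symm⟩
    · exact Real.log_ne_zero_of_pos_of_ne_one hp h1
    · have h2 : 1 - γ 0 0 ^ 2 ≠ 0 := sub_ne_zero.2 (Ne.symm h1)
      apply hext
      · rw [re_smul_of_c hc, trn_re, trn_re, dil_re, Real.exp_log hp]
        field_simp
        ring
      · rw [im_smul_of_c hc, trn_im, trn_im, dil_im, Real.exp_log hp]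

/-- The fixed point equation cz² + (d - a)z - b = 0 has discriminant (a + d)² - 4; take its root in
the upper half-plane. -/
lemma exists_fixed_of_discr_neg {γ : SL(2, ℝ)} (h : (γ 0 0 + γ 1 1) ^ 2 < 4) :
    ∃ z : ℍ, γ • z = z := by
  have hd := det_eq γ
  have hc : γ 1 0 ≠ 0 := by
    intro hc
    rw [hc] at hd
    nlinarith [sq_nonneg (γ 0 0 - γ 1 1)]
  set D := 4 - (γ 0 0 + γ 1 1) ^ 2 with hD
  have hDpos : 0 < D := by linarith
  have hy : 0 < √D / (2 * abs (γ 1 0)) := div_pos (Real.sqrt_pos.2 hDpos) (by positivity)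
  let z : ℍ := ⟨⟨(γ 0 0 - γ 1 1) / (2 * γ 1 0), √D / (2 * abs (γ 1 0))⟩, hy⟩
  have hre : z.re = (γ 0 0 - γ 1 1) / (2 * γ 1 0) := rfl
  have him : z.im ^ 2 = D / (4 * γ 1 0 ^ 2) := by
    change (√D / (2 * abs (γ 1 0))) ^ 2 = _
    rw [div_pow, Real.sq_sqrt hDpos.le, mul_pow, sq_abs]
    norm_num
  have hden : denSq γ z = 1 := by
    rw [denSq, mul_pow, him, hre, hD]
    field_simp
    ring
  refine ⟨z, hext ?_ ?_⟩
  · rw [re_smul, hden, him, hre, hD]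
    field_simp
    linear_combination (-8 * (γ 0 0 + γ 1 1)) * hd
  · rw [im_smul, hden, div_one]

/-- An isometry that maps `∞` to `x`. -/
def infTo (x : ℝ) : SL(2, ℝ) := ⟨!![x, -1; 1, 0], by simp [Matrix.det_fin_two_of]⟩

/-- This is cx² + (d - a)x - b, so it vanishes exactly when γ fixes the boundary point x. -/
lemma infTo_conj (x : ℝ) (γ : SL(2, ℝ)) : ((infTo x)⁻¹ * γ * infTo x) 1 0 =
    -(γ 0 0 * x) - γ 0 1 + x * (γ 1 0 * x + γ 1 1) := by
  have h00 : infTo x 0 0 = x := rfl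
  have h01 : infTo x 0 1 = -1 := rfl
  have h10 : infTo x 1 0 = 1 := rfl
  have h11 : infTo x 1 1 = 0 := rfl
  simp only [mul_apply', inv_10, inv_11, h00, h10]
  ring

/-- Each isometry has a fixed point, or is a translation along a geodesic or
conjugate to a horizontal translation. -/
lemma classification (γ : SL(2, ℝ)) :
    (∃ z : ℍ, γ • z = z) ∨ (∃ g L, 0 < L ∧ IsTrans γ g L) ∨ ∃ g x, x ≠ 0 ∧ IsPar γ g x := by
  by_cases hD : (γ 0 0 + γ 1 1) ^ 2 < 4
  · exact Or.inl (exists_fixed_of_discr_neg hD)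
  have hd := det_eq γ
  -- The discriminant is non-negative, so γ fixes a boundary point, which is moved to ∞.
  have hk : ∃ k : SL(2, ℝ), (k⁻¹ * γ * k) 1 0 = 0 := by
    by_cases hc : γ 1 0 = 0
    · exact ⟨1, by simpa using hc⟩
    · set s := √((γ 0 0 + γ 1 1) ^ 2 - 4) with hs
      have hs2 : s ^ 2 = (γ 0 0 + γ 1 1) ^ 2 - 4 := Real.sq_sqrt (by linarith)
      set x := (γ 0 0 - γ 1 1 + s) / (2 * γ 1 0) with hx
      have hx2 : γ 1 0 * x ^ 2 + (γ 1 1 - γ 0 0) * x - γ 0 1 = 0 := by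
        rw [hx]
        field_simp
        linear_combination hs2 + 4 * hd
      refine ⟨infTo x, ?_⟩
      rw [infTo_conj]
      linear_combination hx2
  obtain ⟨k, hk⟩ := hk
  have e (z : ℍ) : γ • k • z = k • (k⁻¹ * γ * k) • z := by
    rw [mul_smul, mul_smul, smul_inv_smul]
  rcases isTrans_or_isPar_of_c hk with ⟨x, hx⟩ | ⟨g, L, hL, hg, -⟩
  · by_cases h0 : x = 0
    · refine Or.inl ⟨k • I, ?_⟩
      rw [e, hx, h0]
      congr 1
      exact hext (by simp) (by simp)
    · exact Or.inr (Or.inr ⟨k, x, h0, fun z ↦ by rw [e, hx]⟩)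
  · refine Or.inr (Or.inl (IsTrans.exists_pos (g := k * g) (L := L) (fun z ↦ ?_) hL))
    rw [mul_smul, e, hg, mul_smul]

end HypGeom

namespace HypGeom

/-! ### Elements of small displacement -/

lemma cosh_dist_dil (L : ℝ) (z : ℍ) : Real.cosh (dist z (dil L • z)) =
    1 + (Real.cosh L - 1) * (z.re ^ 2 + z.im ^ 2) / z.im ^ 2 := by
  have hp := z.im_pos
  have hE := Real.exp_pos L
  rw [cosh_dist_eq, dil_re, dil_im, Real.cosh_eq, Real.exp_neg]
  field_simp
  ring

lemma sl_ext {g h : SL(2, ℝ)} (h00 : g 0 0 = h 0 0) (h01 : g 0 1 = h 0 1) (h10 : g 1 0 = h 1 0)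
    (h11 : g 1 1 = h 1 1) : g = h := by
  apply Matrix.SpecialLinearGroup.ext
  intro i j
  fin_cases i <;> fin_cases j <;> assumption

lemma neg_apply' (g : SL(2, ℝ)) (i j : Fin 2) : (-g) i j = -g i j := by
  rw [Matrix.SpecialLinearGroup.coe_neg, Matrix.neg_apply]

lemma neg_smul' (g : SL(2, ℝ)) (z : ℍ) : (-g) • z = g • z := by
  have : denSq (-g) z = denSq g z := by simp only [denSq, neg_apply']; ring
  apply hext
  · rw [re_smul, re_smul, this]
    simp only [neg_apply']
    ring
  · rw [im_smul, im_smul, this]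

lemma eq_one_or_eq_neg_one {k : SL(2, ℝ)} (h : ∀ z : ℍ, k • z = z) : k = 1 ∨ k = -1 := by
  have hd := det_eq k
  have h2 : (0 : ℝ) < 2 := two_pos
  have e (z : ℍ) : denSq k z = 1 := by
    have := congrArg UpperHalfPlane.im (h z)
    rw [im_smul, div_eq_iff (denSq_pos k z).ne'] at this
    exact (mul_left_cancel₀ z.im_ne_zero (by linarith)).symm
  have e0 := e I
  have e1 := e (vert (Real.log 2))
  have e2 := congrArg UpperHalfPlane.re (h I)
  rw [re_smul, e] at e2
  simp only [denSq, I_re, I_im, vert_re, vert_im, Real.exp_log h2] at e0 e1 e2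
  have hc : k 1 0 = 0 := by
    have : k 1 0 ^ 2 = 0 := by linarith
    simpa using this
  rw [hc] at e0 e2 hd
  have hb : k 0 1 = 0 := by
    have h5 : k 0 1 * k 1 1 = 0 := by linarith
    rcases mul_eq_zero.1 h5 with h | h
    · exact h
    · rw [h] at e0; norm_num at e0
  have hdd : k 1 1 * k 1 1 = 1 := by linarith
  rcases mul_self_eq_one_iff.1 hdd with h | h
  · exact Or.inl (sl_ext (by rw [h] at hd; simp; linarith) (by simpa using hb)
      (by simpa using hc) (by simpa using h))
  · exact Or.inr (sl_ext (by rw [h] at hd; rw [neg_apply']; simp; linarith)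
      (by rw [neg_apply']; simpa using hb)
      (by rw [neg_apply']; simpa using hc) (by rw [neg_apply']; simpa using h))

/-- The matrix of a translation along a geodesic is diagonal in suitable coordinates. -/
lemma IsTrans.diag {γ g : SL(2, ℝ)} {L : ℝ} (h : IsTrans γ g L) :
    (g⁻¹ * γ * g) 0 1 = 0 ∧ (g⁻¹ * γ * g) 1 0 = 0 ∧
      ((g⁻¹ * γ * g) 0 0) ^ 2 = Real.exp L ∧ ((g⁻¹ * γ * g) 1 1) ^ 2 = Real.exp (-L) := by
  have e : g⁻¹ * γ * g = dil L ∨ g⁻¹ * γ * g = -dil L := by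
    have h1 : ∀ z : ℍ, ((dil L)⁻¹ * (g⁻¹ * γ * g)) • z = z := fun z ↦ by
      rw [mul_smul, mul_smul, mul_smul, h, inv_smul_smul, inv_smul_smul]
    rcases eq_one_or_eq_neg_one h1 with h2 | h2
    · exact Or.inl (inv_mul_eq_one.1 h2).symm
    · right
      rw [inv_mul_eq_iff_eq_mul] at h2
      rw [h2, mul_neg, mul_one]
  have e1 : Real.exp (L / 2) ^ 2 = Real.exp L := by rw [sq, ← Real.exp_add]; ring_nf
  have e2 : Real.exp (-(L / 2)) ^ 2 = Real.exp (-L) := by rw [sq, ← Real.exp_add]; ring_nf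
  rcases e with e | e
  · rw [e]; exact ⟨rfl, rfl, e1, e2⟩
  · rw [e]; simp only [neg_apply', dil_00, dil_01, dil_10, dil_11, neg_sq, neg_zero]
    exact ⟨trivial, trivial, e1, e2⟩

lemma IsTrans.diag_ne {γ g : SL(2, ℝ)} {L : ℝ} (h : IsTrans γ g L) (hL : L ≠ 0) :
    (g⁻¹ * γ * g) 0 0 ≠ (g⁻¹ * γ * g) 1 1 := by
  obtain ⟨-, -, h0, h1⟩ := h.diag
  intro h2
  rw [h2, h1] at h0
  have := Real.exp_injective h0
  exact hL (by linarith)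

/-- An isometry that commutes with a translation along a geodesic is a translation
along the same geodesic. -/
lemma IsTrans.of_commute {A B g : SL(2, ℝ)} {L : ℝ} (h : IsTrans A g L) (hL : L ≠ 0)
    (hc : A * B = B * A) : ∃ l, IsTrans B g l := by
  obtain ⟨h01, h10, -, -⟩ := h.diag
  have hne := h.diag_ne hL
  set D := g⁻¹ * A * g
  set E := g⁻¹ * B * g with hE
  have hDE : D * E = E * D := by
    have e1 : D * E = g⁻¹ * (A * B) * g := by simp only [D, E]; group
    have e2 : E * D = g⁻¹ * (B * A) * g := by simp only [D, E]; group
    rw [e1, e2, hc]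
  have e01 := congrArg (fun M : SL(2, ℝ) ↦ M 0 1) hDE
  have e10 := congrArg (fun M : SL(2, ℝ) ↦ M 1 0) hDE
  simp only [mul_apply', h01, h10] at e01 e10
  have hE01 : E 0 1 = 0 := by
    have : (D 0 0 - D 1 1) * E 0 1 = 0 := by linarith
    exact (mul_eq_zero.1 this).resolve_left (sub_ne_zero.2 hne)
  have hE10 : E 1 0 = 0 := by
    have : (D 0 0 - D 1 1) * E 1 0 = 0 := by linarith
    exact (mul_eq_zero.1 this).resolve_left (sub_ne_zero.2 hne)
  have hd := det_eq E
  rw [hE01, zero_mul, sub_zero] at hd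
  have h0 : E 0 0 ≠ 0 := fun h ↦ by simp [h] at hd
  refine ⟨Real.log (E 0 0 ^ 2), fun z ↦ ?_⟩
  have : B • g • z = g • E • z := by rw [hE, mul_smul, mul_smul, smul_inv_smul]
  rw [this]
  congr 1
  apply hext
  · rw [re_smul_of_c hE10, hE01, dil_re, Real.exp_log (sq_pos_iff.2 h0)]; ring
  · rw [im_smul_of_c hE10, dil_im, Real.exp_log (sq_pos_iff.2 h0)]

/-- If a translation commutes with its commutator with `C`, then it commutes with `C`,
or `C` is a half-turn. -/
lemma IsTrans.commute_of_commute_commutator {A C g : SL(2, ℝ)} {L : ℝ} (h : IsTrans A g L)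
    (hL : L ≠ 0) (hc : A * (A * C * A⁻¹ * C⁻¹) = (A * C * A⁻¹ * C⁻¹) * A) :
    A * C = C * A ∨ ∃ z : ℍ, C • z = z ∧ ∃ w : ℍ, C • w ≠ w := by
  obtain ⟨h01, h10, -, -⟩ := h.diag
  have hne := h.diag_ne hL
  set D := g⁻¹ * A * g with hD
  set E := g⁻¹ * C * g with hE
  have hX : D * (E * D⁻¹ * E⁻¹) = (E * D⁻¹ * E⁻¹) * D := by
    have e1 : D * (E * D⁻¹ * E⁻¹) = g⁻¹ * A⁻¹ * (A * (A * C * A⁻¹ * C⁻¹)) * g := by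
      simp only [D, E]; group
    have e2 : (E * D⁻¹ * E⁻¹) * D = g⁻¹ * A⁻¹ * ((A * C * A⁻¹ * C⁻¹) * A) * g := by
      simp only [D, E]; group
    rw [e1, e2, hc]
  -- X commutes with the diagonal matrix D, whose diagonal entries differ, so X is diagonal. As a
  -- conjugate of D⁻¹ it is D⁻¹ or D; E is diagonal in the first case and antidiagonal, hence a
  -- half-turn, in the second.
  set X := E * D⁻¹ * E⁻¹ with hXdef
  have hXE : X * E = E * D⁻¹ := by rw [hXdef, inv_mul_cancel_right]
  have e01 := congrArg (fun M : SL(2, ℝ) ↦ M 0 1) hX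
  have e10 := congrArg (fun M : SL(2, ℝ) ↦ M 1 0) hX
  have f00 := congrArg (fun M : SL(2, ℝ) ↦ M 0 0) hXE
  have f01 := congrArg (fun M : SL(2, ℝ) ↦ M 0 1) hXE
  have f10 := congrArg (fun M : SL(2, ℝ) ↦ M 1 0) hXE
  have f11 := congrArg (fun M : SL(2, ℝ) ↦ M 1 1) hXE
  have hd := det_eq D
  have hdX := det_eq X
  have hdE := det_eq E
  simp only [mul_apply', inv_00, inv_01, inv_10, inv_11, h01, h10] at e01 e10 f00 f01 f10 f11 hd
  have hX01 : X 0 1 = 0 := by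
    have : (D 0 0 - D 1 1) * X 0 1 = 0 := by linarith
    exact (mul_eq_zero.1 this).resolve_left (sub_ne_zero.2 hne)
  have hX10 : X 1 0 = 0 := by
    have : (D 0 0 - D 1 1) * X 1 0 = 0 := by linarith
    exact (mul_eq_zero.1 this).resolve_left (sub_ne_zero.2 hne)
  simp only [hX01, hX10] at f00 f01 f10 f11 hdX
  by_cases hE0 : E 0 0 = 0
  · right
    have hE01 : E 0 1 ≠ 0 := fun h ↦ by rw [hE0, h] at hdE; norm_num at hdE
    have hE10 : E 1 0 ≠ 0 := fun h ↦ by rw [hE0, h] at hdE; norm_num at hdE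
    have hX1 : X 1 1 = D 1 1 := by
      have : E 1 0 * (X 1 1 - D 1 1) = 0 := by linarith
      exact sub_eq_zero.1 ((mul_eq_zero.1 this).resolve_left hE10)
    have hE1 : E 1 1 = 0 := by
      have : (D 0 0 - D 1 1) * E 1 1 = 0 := by rw [hX1] at f11; linarith
      exact (mul_eq_zero.1 this).resolve_left (sub_ne_zero.2 hne)
    obtain ⟨z, hz⟩ := exists_fixed_of_discr_neg (γ := E) (by rw [hE0, hE1]; norm_num)
    have hC (w : ℍ) : C • g • w = g • E • w := by rw [hE, mul_smul, mul_smul, smul_inv_smul]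
    refine ⟨g • z, by rw [hC, hz], ?_⟩
    by_contra! hcon
    have hEt (w : ℍ) : E • w = w := by
      have := hcon (g • w)
      rw [hC] at this
      exact (MulAction.injective g) this
    rcases eq_one_or_eq_neg_one hEt with h1 | h1
    · exact hE01 (by rw [h1]; simp)
    · exact hE01 (by rw [h1, neg_apply']; simp)
  · left
    have hX0 : X 0 0 = D 1 1 := by
      have : E 0 0 * (X 0 0 - D 1 1) = 0 := by linarith
      exact sub_eq_zero.1 ((mul_eq_zero.1 this).resolve_left hE0)
    have hD1 : D 1 1 ≠ 0 := fun h ↦ by rw [h] at hd; norm_num at hd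
    have hX1 : X 1 1 = D 0 0 := by
      rw [hX0] at hdX
      exact mul_left_cancel₀ hD1 (by linarith)
    have hE01 : E 0 1 = 0 := by
      have : (D 0 0 - D 1 1) * E 0 1 = 0 := by rw [hX0] at f01; linarith
      exact (mul_eq_zero.1 this).resolve_left (sub_ne_zero.2 hne)
    have hE10 : E 1 0 = 0 := by
      have : (D 0 0 - D 1 1) * E 1 0 = 0 := by rw [hX1] at f10; linarith
      exact (mul_eq_zero.1 this).resolve_left (sub_ne_zero.2 hne)
    have hDE : D * E = E * D := by
      apply sl_ext <;> simp only [mul_apply', h01, h10, hE01, hE10] <;> ring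
    have e1 : A * C = g * (D * E) * g⁻¹ := by simp only [D, E]; group
    have e2 : C * A = g * (E * D) * g⁻¹ := by simp only [D, E]; group
    rw [e1, e2, hDE]

/-- Iterated commutators. -/
def comSeq (A B : SL(2, ℝ)) (n : ℕ) : SL(2, ℝ) := (fun C ↦ A * C * A⁻¹ * C⁻¹)^[n] B

lemma comSeq_zero (A B : SL(2, ℝ)) : comSeq A B 0 = B := rfl

lemma comSeq_succ (A B : SL(2, ℝ)) (n : ℕ) :
    comSeq A B (n + 1) = A * comSeq A B n * A⁻¹ * (comSeq A B n)⁻¹ :=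
  Function.iterate_succ_apply' _ n B

/-- Commutators ignore signs, so A and B may be replaced by their representatives near 1, even if
these are not in Γ. -/
lemma comSeq_succ_sign {A B A' B' : SL(2, ℝ)} (hA : A' = A ∨ A' = -A) (hB : B' = B ∨ B' = -B)
    (n : ℕ) : comSeq A' B' (n + 1) = comSeq A B (n + 1) := by
  have key (C : SL(2, ℝ)) : A' * C * A'⁻¹ = A * C * A⁻¹ := by
    rcases hA with rfl | rfl
    · rfl
    · simp [inv_neg]
  induction n with
  | zero =>
    simp only [comSeq_succ, comSeq_zero, key]
    rcases hB with rfl | rfl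
    · rfl
    · simp [inv_neg]
  | succ n ih => rw [comSeq_succ, ih, key, ← comSeq_succ]

lemma comSeq_mem {Γ : Subgroup SL(2, ℝ)} {A B : SL(2, ℝ)} (hA : A ∈ Γ) (hB : B ∈ Γ) (n : ℕ) :
    comSeq A B n ∈ Γ := by
  induction n with
  | zero => exact hB
  | succ n ih =>
    rw [comSeq_succ]
    exact mul_mem (mul_mem (mul_mem hA ih) (inv_mem hA)) (inv_mem ih)

/-! ### Contraction of commutators near the identity -/

section Frobenius

attribute [local instance] Matrix.frobeniusNormedRing

lemma frobenius_sq (M : Matrix (Fin 2) (Fin 2) ℝ) :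
    ‖M‖ ^ 2 = M 0 0 ^ 2 + M 0 1 ^ 2 + M 1 0 ^ 2 + M 1 1 ^ 2 := by
  have h := Matrix.frobenius_norm_def M
  have hnn : 0 ≤ ∑ i, ∑ j, ‖M i j‖ ^ (2 : ℝ) := by positivity
  rw [← Real.sqrt_eq_rpow] at h
  rw [h, Real.sq_sqrt hnn]
  simp [Fin.sum_univ_two]
  ring

lemma frobenius_inv (g : SL(2, ℝ)) :
    ‖((g⁻¹ : SL(2, ℝ)) : Matrix (Fin 2) (Fin 2) ℝ)‖ = ‖(g : Matrix (Fin 2) (Fin 2) ℝ)‖ := by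
  rw [← sq_eq_sq₀ (norm_nonneg _) (norm_nonneg _), frobenius_sq, frobenius_sq, inv_00, inv_01,
    inv_10, inv_11]
  ring

/-- The distance of an element to `1` in the Frobenius norm. -/
def distOne (g : SL(2, ℝ)) : ℝ := ‖(g : Matrix (Fin 2) (Fin 2) ℝ) - 1‖

lemma distOne_nonneg (g : SL(2, ℝ)) : 0 ≤ distOne g := norm_nonneg _

/-- With the trace at least 2, this bounds the distance to 1 by the displacement of i alone. -/
lemma distOne_sq (g : SL(2, ℝ)) :
    distOne g ^ 2 = 2 * Real.cosh (dist I (g • I)) - 2 * (g 0 0 + g 1 1) + 2 := by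
  rw [distOne, frobenius_sq, cosh_dist_I_smul]
  simp
  ring

lemma eq_one_of_distOne_eq_zero {g : SL(2, ℝ)} (h : distOne g = 0) : g = 1 := by
  rw [distOne, norm_eq_zero, sub_eq_zero] at h
  exact Subtype.ext h

lemma norm_le_of_distOne_le {g : SL(2, ℝ)} (h : distOne g ≤ 1 / 16) :
    ‖(g : Matrix (Fin 2) (Fin 2) ℝ)‖ ≤ 3 / 2 := by
  -- The Frobenius norm of 1 is √2, and 23/16 + 1/16 = 3/2.
  have h1 : ‖(1 : Matrix (Fin 2) (Fin 2) ℝ)‖ ≤ 23 / 16 := by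
    rw [← pow_le_pow_iff_left₀ (norm_nonneg _) (by norm_num) two_ne_zero]
    rw [frobenius_sq]
    simp
    norm_num
  have h2 := norm_add_le ((g : Matrix (Fin 2) (Fin 2) ℝ) - 1) 1
  rw [sub_add_cancel] at h2
  rw [distOne] at h
  linarith

lemma dist_le_of_distOne_le {g : SL(2, ℝ)} (h : distOne g ≤ 1 / 16) : dist I (g • I) ≤ 1 := by
  have h1 := norm_le_of_distOne_le h
  have h2 := cosh_dist_I_smul g
  rw [← frobenius_sq] at h2
  have h3 : ‖(g : Matrix (Fin 2) (Fin 2) ℝ)‖ ^ 2 ≤ (3 / 2) ^ 2 :=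
    pow_le_pow_left₀ (norm_nonneg _) h1 2
  have h4 : Real.cosh (dist I (g • I)) ≤ Real.cosh 1 := by
    have := Real.exp_one_gt_d9
    have := Real.exp_pos (-1)
    rw [Real.cosh_eq 1]
    linarith
  rw [Real.cosh_le_cosh, abs_of_nonneg dist_nonneg, abs_one] at h4
  exact h4

/-- ABA⁻¹B⁻¹ - 1 is the additive commutator of A - 1 and B - 1, times A⁻¹B⁻¹. This gives the factor
2 · (1/16) · (3/2)² = 9/32 < 1/2. -/
lemma distOne_commutator_le {A B : SL(2, ℝ)} (hA : distOne A ≤ 1 / 16) (hB : distOne B ≤ 1 / 16) :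
    distOne (A * B * A⁻¹ * B⁻¹) ≤ distOne B / 2 := by
  have e : ((A * B * A⁻¹ * B⁻¹ : SL(2, ℝ)) : Matrix (Fin 2) (Fin 2) ℝ) - 1 =
      (((A : Matrix (Fin 2) (Fin 2) ℝ) - 1) * ((B : Matrix (Fin 2) (Fin 2) ℝ) - 1) -
        ((B : Matrix (Fin 2) (Fin 2) ℝ) - 1) * ((A : Matrix (Fin 2) (Fin 2) ℝ) - 1)) *
      ((A⁻¹ : SL(2, ℝ)) : Matrix (Fin 2) (Fin 2) ℝ) *
      ((B⁻¹ : SL(2, ℝ)) : Matrix (Fin 2) (Fin 2) ℝ) := by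
    have e1 : (1 : Matrix (Fin 2) (Fin 2) ℝ) = ((B * A * A⁻¹ * B⁻¹ : SL(2, ℝ)) :
        Matrix (Fin 2) (Fin 2) ℝ) := by
      rw [mul_inv_cancel_right, mul_inv_cancel, Matrix.SpecialLinearGroup.coe_one]
    rw [show ∀ x y : Matrix (Fin 2) (Fin 2) ℝ, (x - 1) * (y - 1) - (y - 1) * (x - 1) =
      x * y - y * x from fun x y ↦ by noncomm_ring]
    conv_lhs => rw [e1]
    simp only [Matrix.SpecialLinearGroup.coe_mul]
    noncomm_ring
  have hA' := norm_le_of_distOne_le hA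
  have hB' := norm_le_of_distOne_le hB
  rw [← frobenius_inv] at hA' hB'
  have hA0 := distOne_nonneg A
  have hB0 := distOne_nonneg B
  have h1 : ‖((A : Matrix (Fin 2) (Fin 2) ℝ) - 1) * ((B : Matrix (Fin 2) (Fin 2) ℝ) - 1) -
        ((B : Matrix (Fin 2) (Fin 2) ℝ) - 1) * ((A : Matrix (Fin 2) (Fin 2) ℝ) - 1)‖ ≤
        distOne B / 8 := by
    refine (norm_sub_le _ _).trans ?_
    have a1 := norm_mul_le ((A : Matrix (Fin 2) (Fin 2) ℝ) - 1)
      ((B : Matrix (Fin 2) (Fin 2) ℝ) - 1)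
    have a2 := norm_mul_le ((B : Matrix (Fin 2) (Fin 2) ℝ) - 1)
      ((A : Matrix (Fin 2) (Fin 2) ℝ) - 1)
    change _ ≤ distOne A * distOne B at a1
    change _ ≤ distOne B * distOne A at a2
    have a3 : distOne A * distOne B ≤ 1 / 16 * distOne B := mul_le_mul_of_nonneg_right hA hB0
    rw [mul_comm (distOne B)] at a2
    linarith
  rw [distOne, e]
  calc _ ≤ _ := norm_mul_le _ _
    _ ≤ (distOne B / 8 * (3 / 2)) * (3 / 2) := by
      refine mul_le_mul ((norm_mul_le _ _).trans ?_) hB' (norm_nonneg _) (by positivity)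
      exact mul_le_mul h1 hA' (norm_nonneg _) (by positivity)
    _ ≤ _ := by linarith

lemma distOne_comSeq_le {A B : SL(2, ℝ)} (hA : distOne A ≤ 1 / 16) (hB : distOne B ≤ 1 / 16)
    (n : ℕ) : distOne (comSeq A B n) ≤ (1 / 2) ^ n * (1 / 16) := by
  induction n with
  | zero => simpa [comSeq_zero] using hB
  | succ n ih =>
    have h1 : ((1 : ℝ) / 2) ^ n ≤ 1 := pow_le_one₀ (by norm_num) (by norm_num)
    have := distOne_commutator_le hA (ih.trans (by linarith))
    rw [comSeq_succ, pow_succ]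
    linarith

end Frobenius

variable {Γ : Subgroup SL(2, ℝ)}

/-- The iterated commutators converge to 1 but lie in the finite set of elements moving i by at most
1, so they must reach 1. -/
lemma ProperFree.exists_comSeq_eq_one (hΓ : ProperFree Γ) {A B : SL(2, ℝ)}
    (hA : distOne A ≤ 1 / 16) (hB : distOne B ≤ 1 / 16) (hmem : ∀ n, comSeq A B (n + 1) ∈ Γ) :
    ∃ n, comSeq A B (n + 1) = 1 := by
  by_contra! hcon
  have hfin : (range fun n ↦ distOne (comSeq A B (n + 1))).Finite :=
    ((hΓ.finite 1).image distOne).subset (by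
      rintro _ ⟨n, rfl⟩
      refine ⟨_, ⟨hmem n, dist_le_of_distOne_le ((distOne_comSeq_le hA hB _).trans ?_)⟩, rfl⟩
      have h1 : ((1 : ℝ) / 2) ^ (n + 1) ≤ 1 := pow_le_one₀ (by norm_num) (by norm_num)
      linarith)
  obtain ⟨x, ⟨n, rfl⟩, hx⟩ := exists_min_image _ id hfin (range_nonempty _)
  have hpos : 0 < distOne (comSeq A B (n + 1)) :=
    (distOne_nonneg _).lt_of_ne' fun h ↦ hcon n (eq_one_of_distOne_eq_zero h)
  obtain ⟨m, hm⟩ := exists_pow_lt_of_lt_one hpos (show (1 : ℝ) / 2 < 1 by norm_num)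
  have h1 : distOne (comSeq A B (n + 1)) ≤ distOne (comSeq A B (m + 1)) := hx _ ⟨m, rfl⟩
  have h2 := distOne_comSeq_le hA hB (m + 1)
  have h3 : ((1 : ℝ) / 2) ^ (m + 1) * (1 / 16) ≤ (1 / 2) ^ m := by
    rw [pow_succ]
    have : (0 : ℝ) ≤ (1 / 2) ^ m := by positivity
    linarith
  linarith

/-- Choose the sign that makes the trace at least 2. Then the squared distance to 1 is at most
2(cosh(1/32) - 1) ≤ 1/256. -/
lemma exists_sign_distOne_le {A : SL(2, ℝ)} (htr : 4 ≤ (A 0 0 + A 1 1) ^ 2)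
    (hd : dist I (A • I) ≤ 1 / 32) : ∃ A', (A' = A ∨ A' = -A) ∧ distOne A' ≤ 1 / 16 := by
  have key (A' : SL(2, ℝ)) (h : dist I (A' • I) ≤ 1 / 32) (h2 : 2 ≤ A' 0 0 + A' 1 1) :
      distOne A' ≤ 1 / 16 := by
    rw [← pow_le_pow_iff_left₀ (distOne_nonneg _) (by norm_num) two_ne_zero]
    rw [distOne_sq]
    have h3 : Real.cosh (dist I (A' • I)) ≤ Real.cosh (1 / 32) := by
      rw [Real.cosh_le_cosh, abs_of_nonneg dist_nonneg, abs_of_pos (by norm_num)]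
      exact h
    have h4 := Real.cosh_le_exp_half_sq (1 / 32)
    have h5 := (le_abs_self _).trans (Real.abs_exp_sub_one_le (x := (1 / 32) ^ 2 / 2)
      (by rw [abs_of_pos (by norm_num)]; norm_num))
    rw [abs_of_pos (by norm_num)] at h5
    norm_num at h4 h5 ⊢
    linarith
  rcases le_total 0 (A 0 0 + A 1 1) with h | h
  · exact ⟨A, Or.inl rfl, key A hd (by nlinarith)⟩
  · exact ⟨-A, Or.inr rfl, key (-A) (by rwa [neg_smul']) (by
      rw [neg_apply', neg_apply']; nlinarith)⟩

/-- A smaller trace would give a fixed point in ℍ. By freeness the element would then be ±1, whose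
squared trace is 4. -/
lemma ProperFree.four_le_trace_sq (hΓ : ProperFree Γ) {A : SL(2, ℝ)} (hA : A ∈ Γ) :
    4 ≤ (A 0 0 + A 1 1) ^ 2 := by
  by_contra! h
  obtain ⟨z, hz⟩ := exists_fixed_of_discr_neg h
  rcases eq_one_or_eq_neg_one (hΓ.free A hA z hz) with rfl | rfl
  · simp at h; norm_num at h
  · rw [neg_apply', neg_apply'] at h; simp at h; norm_num at h

/-- Some iterated commutator is 1. Walking back, A commutes with each earlier one and finally with
B, since freeness excludes the half-turns of `commute_of_commute_commutator`. -/
lemma ProperFree.commute_of_dist_I_le (hΓ : ProperFree Γ) {A B g : SL(2, ℝ)} {L : ℝ}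
    (hA : A ∈ Γ) (hB : B ∈ Γ) (hg : IsTrans A g L) (hL : L ≠ 0)
    (hdA : dist I (A • I) ≤ 1 / 32) (hdB : dist I (B • I) ≤ 1 / 32) : A * B = B * A := by
  obtain ⟨A', hA', hA1⟩ := exists_sign_distOne_le (hΓ.four_le_trace_sq hA) hdA
  obtain ⟨B', hB', hB1⟩ := exists_sign_distOne_le (hΓ.four_le_trace_sq hB) hdB
  have hs := comSeq_succ_sign hA' hB'
  obtain ⟨n, hn⟩ := hΓ.exists_comSeq_eq_one hA1 hB1 fun n ↦ by
    rw [hs]; exact comSeq_mem hA hB _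
  rw [hs] at hn
  have hback (n : ℕ) (h : A * comSeq A B (n + 1) = comSeq A B (n + 1) * A) :
      A * comSeq A B n = comSeq A B n * A := by
    rw [comSeq_succ] at h
    rcases hg.commute_of_commute_commutator hL h with h1 | ⟨z, hz, w, hw⟩
    · exact h1
    · exact absurd (hΓ.free _ (comSeq_mem hA hB n) z hz w) hw
  have hall (m : ℕ) : A * comSeq A B m = comSeq A B m * A → A * B = B * A := by
    induction m with
    | zero => exact id
    | succ m ih => exact fun h ↦ ih (hback m h)
  exact hall (n + 1) (by rw [hn, mul_one, one_mul])

/-- Elements of small displacement at a point commute if one of them is a translation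
along a geodesic. -/
lemma ProperFree.commute_of_dist_le (hΓ : ProperFree Γ) {A B g : SL(2, ℝ)} {L : ℝ}
    (hA : A ∈ Γ) (hB : B ∈ Γ) (hg : IsTrans A g L) (hL : L ≠ 0) {z : ℍ}
    (hdA : dist z (A • z) ≤ 1 / 32) (hdB : dist z (B • z) ≤ 1 / 32) : A * B = B * A := by
  set k := z.toSL2R
  have hk : z = k • I := (toSL2R_smul_I z).symm
  have hd (C : SL(2, ℝ)) : dist I ((k⁻¹ * C * k) • I) = dist z (C • z) := by
    rw [mul_smul, mul_smul, ← hk, ← dist_smul' k, smul_inv_smul, ← hk]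
  have := (hΓ.conj k).commute_of_dist_I_le (A := k⁻¹ * A * k) (B := k⁻¹ * B * k)
    (mem_conjGroup'.2 hA) (mem_conjGroup'.2 hB) (g := k⁻¹ * g) (L := L)
    (by have := hg.conj k⁻¹; rwa [inv_inv] at this) hL (by rwa [hd]) (by rwa [hd])
  have e1 : A * B = k * ((k⁻¹ * A * k) * (k⁻¹ * B * k)) * k⁻¹ := by group
  have e2 : B * A = k * ((k⁻¹ * B * k) * (k⁻¹ * A * k)) * k⁻¹ := by group
  rw [e1, e2, this]

end HypGeom

namespace HypGeom

variable {Γ : Subgroup SL(2, ℝ)}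

/-! ### The thin part -/

lemma IsTrans.length_unique {γ g k : SL(2, ℝ)} {L M : ℝ} (hg : IsTrans γ g L) (hk : IsTrans γ k M)
    (hL : 0 < L) (hM : 0 < M) : L = M := by
  apply le_antisymm
  · rw [← hk.dist_vert hM.le 0]; exact hg.le_dist _
  · rw [← hg.dist_vert hL.le 0]; exact hk.le_dist _

lemma finite_lengths {F : Set SL(2, ℝ)} (hF : F.Finite) :
    {L | 0 < L ∧ ∃ γ ∈ F, ∃ g, IsTrans γ g L}.Finite := by
  have : {L | 0 < L ∧ ∃ γ ∈ F, ∃ g, IsTrans γ g L} =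
      ⋃ γ ∈ F, {L | 0 < L ∧ ∃ g, IsTrans γ g L} := by
    ext L
    simp only [mem_iUnion, mem_ofPred_eq]
    exact ⟨fun ⟨h, γ, hγ, hg⟩ ↦ ⟨γ, hγ, h, hg⟩, fun ⟨γ, hγ, h, hg⟩ ↦ ⟨h, γ, hγ, hg⟩⟩
  rw [this]
  refine hF.biUnion fun γ _ ↦ Set.Subsingleton.finite ?_
  rintro L ⟨hL, g, hg⟩ M ⟨hM, k, hk⟩
  exact hg.length_unique hk hL hM

lemma IsTrans.mul_dil {γ g : SL(2, ℝ)} {L : ℝ} (h : IsTrans γ g L) (s : ℝ) :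
    IsTrans γ (g * dil s) L := fun z ↦ by
  rw [mul_smul, mul_smul, h, ← dil_add, ← dil_add, add_comm]

/-- The least translation length along an axis. -/
lemma ProperFree.exists_min_length (hΓ : ProperFree Γ) {γ g : SL(2, ℝ)} {L : ℝ} (hγ : γ ∈ Γ)
    (hg : IsTrans γ g L) (hL : 0 < L) : ∃ l, 0 < l ∧ l ≤ L ∧ (∃ δ ∈ Γ, IsTrans δ g l) ∧
      ∀ δ ∈ Γ, ∀ m, IsTrans δ g m → m ≠ 0 → l ≤ |m| := by
  set S : Set ℝ := {l | 0 < l ∧ l ≤ L ∧ ∃ δ ∈ Γ, IsTrans δ g l}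
  have hS : S.Finite := by
    refine ((hΓ.finite_dist_le (g • vert 0) L).image
      fun δ ↦ dist (g • vert 0) (δ • g • vert 0)).subset ?_
    rintro l ⟨h0, hl, δ, hδ, h⟩
    exact ⟨δ, ⟨hδ, by rwa [h.dist_vert h0.le]⟩, h.dist_vert h0.le 0⟩
  obtain ⟨l, ⟨h0, hl, hδ⟩, hmin⟩ := exists_min_image S id hS ⟨L, hL, le_rfl, γ, hγ, hg⟩
  refine ⟨l, h0, hl, hδ, fun δ hδ m hm hm0 ↦ ?_⟩
  rcases le_total L |m| with h | h
  · exact hl.trans h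
  · rcases hm0.lt_or_gt with h1 | h1
    · rw [abs_of_neg h1] at h ⊢
      exact hmin _ ⟨neg_pos.2 h1, h, δ⁻¹, inv_mem hδ, hm.inv⟩
    · rw [abs_of_pos h1] at h ⊢
      exact hmin _ ⟨h1, h, δ, hδ, hm⟩

/-- On the unit semicircle, which is orthogonal to the imaginary axis, cosh of the distance to i is
1 / im u; a distance is at most its cosh. -/
lemma dist_I_le {u : ℍ} (hu : u.re ^ 2 + u.im ^ 2 = 1) {y : ℝ} (hy : 0 < y) (h : y ≤ u.im) :
    dist I u ≤ 1 / y := by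
  have h1 := cosh_dist_eq I u
  have hp := u.im_pos
  have h2 : Real.cosh (dist I u) = 1 / u.im := by
    rw [h1, I_re, I_im]
    field_simp
    linarith
  have h3 : dist I u ≤ Real.cosh (dist I u) :=
    (Real.self_le_sinh_iff.2 dist_nonneg).trans (Real.sinh_lt_cosh _).le
  rw [h2] at h3
  exact h3.trans (one_div_le_one_div_of_le hy h)

/-- In the thin part around a closed geodesic, there is a thick point at bounded distance. -/
lemma ProperFree.exists_thick_of_thin (hΓ : ProperFree Γ) {A g : SL(2, ℝ)} {L : ℝ} (hA : A ∈ Γ)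
    (hg : IsTrans A g L) (hL : 0 < L) {z : ℍ} (hz : dist z (A • z) < 1 / 32) :
    ∃ l, 0 < l ∧ ∃ z' : ℍ, (∀ γ ∈ Γ, dist z' (γ • z') < 1 / 32 → ∀ w : ℍ, γ • w = w) ∧
      (∃ δ ∈ Γ, ∃ k, IsTrans δ k l ∧ dist z' (δ • z') = 1 / 32) ∧
      dist z z' ≤ 2 / √((Real.cosh l - 1) / (Real.cosh (1 / 32) - 1)) := by
  obtain ⟨l, h0, hl, ⟨δ, hδ, hδg⟩, hmin⟩ := hΓ.exists_min_length hA hg hL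
  set p := g⁻¹ • z with hp
  have hpp : 0 < p.re ^ 2 + p.im ^ 2 := by have := p.im_pos; positivity
  -- Slide along the axis until z lies on the unit semicircle, where displacements depend only on
  -- the height.
  set s := Real.log √(p.re ^ 2 + p.im ^ 2) with hs
  have hes : Real.exp s = √(p.re ^ 2 + p.im ^ 2) := Real.exp_log (Real.sqrt_pos.2 hpp)
  set u := dil (-s) • p with hu
  set k := g * dil s with hk
  have hzu : z = k • u := by rw [hk, hu, hp, mul_smul, dil_smul_dil_neg, smul_inv_smul]
  have hu1 : u.re ^ 2 + u.im ^ 2 = 1 := by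
    rw [hu, dil_re, dil_im, mul_pow, mul_pow, ← mul_add, Real.exp_neg, hes, inv_pow,
      Real.sq_sqrt hpp.le, inv_mul_cancel₀ hpp.ne']
  have hcosh {δ : SL(2, ℝ)} {m : ℝ} (h : IsTrans δ g m) {w : ℍ} (hw : w.re ^ 2 + w.im ^ 2 = 1) :
      Real.cosh (dist (k • w) (δ • k • w)) = 1 + (Real.cosh m - 1) / w.im ^ 2 := by
    rw [h.mul_dil s, dist_smul', cosh_dist_dil, hw, mul_one]
  have hε : 0 < Real.cosh (1 / 32) - 1 := sub_pos.2 (Real.one_lt_cosh.2 (by norm_num))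
  have hl1 : 0 < Real.cosh l - 1 := sub_pos.2 (Real.one_lt_cosh.2 h0.ne')
  -- The height on the unit semicircle at which the translation by l displaces by exactly 1/32.
  set y := √((Real.cosh l - 1) / (Real.cosh (1 / 32) - 1)) with hy
  have hypos : 0 < y := Real.sqrt_pos.2 (div_pos hl1 hε)
  have hy2 : y ^ 2 = (Real.cosh l - 1) / (Real.cosh (1 / 32) - 1) :=
    Real.sq_sqrt (div_pos hl1 hε).le
  have hcl {a b : ℝ} (ha : 0 ≤ a) (hb : 0 ≤ b) : Real.cosh a ≤ Real.cosh b ↔ a ≤ b := by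
    rw [Real.cosh_le_cosh, abs_of_nonneg ha, abs_of_nonneg hb]
  have hyu : y < u.im := by
    have h1 : Real.cosh (dist z (A • z)) < Real.cosh (1 / 32) := by
      rw [← not_le, hcl (by norm_num) dist_nonneg, not_le]
      exact hz
    rw [hzu, hcosh hg hu1] at h1
    have h2 := (hcl h0.le hL.le).2 hl
    have hup := u.im_pos
    rw [← pow_lt_pow_iff_left₀ hypos.le hup.le two_ne_zero, hy2, div_lt_iff₀ hε]
    have h3 : (Real.cosh L - 1) / u.im ^ 2 < Real.cosh (1 / 32) - 1 := by linarith
    rw [div_lt_iff₀ (by positivity)] at h3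
    linarith
  have hy1 : y ^ 2 ≤ 1 := by
    have : y ^ 2 ≤ u.im ^ 2 := pow_le_pow_left₀ hypos.le hyu.le 2
    nlinarith [sq_nonneg u.re]
  let p₀ : ℍ := ⟨⟨√(1 - y ^ 2), y⟩, hypos⟩
  have hp₀ : p₀.re ^ 2 + p₀.im ^ 2 = 1 := by
    change √(1 - y ^ 2) ^ 2 + y ^ 2 = 1
    rw [Real.sq_sqrt (by linarith)]
    ring
  have hp₀im : p₀.im = y := rfl
  have hdε : dist (k • p₀) (δ • k • p₀) = 1 / 32 := by
    have h1 := hcosh hδg hp₀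
    rw [hp₀im, hy2, div_div_cancel₀ hl1.ne', add_sub_cancel] at h1
    exact le_antisymm ((hcl dist_nonneg (by norm_num)).1 h1.le)
      ((hcl (by norm_num) dist_nonneg).1 h1.ge)
  refine ⟨l, h0, k • p₀, fun γ hγ hd ↦ ?_, ⟨δ, hδ, g, hδg, hdε⟩, ?_⟩
  -- An element moving the new point by less than 1/32 commutes with δ, so it shares the axis. Its
  -- translation length is 0 or at least l, and the latter displaces by at least 1/32.
  · obtain ⟨m, hm⟩ := hδg.of_commute h0.ne' (hΓ.commute_of_dist_le hδ hγ hδg h0.ne' hdε.le hd.le)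
    by_cases hm0 : m = 0
    · intro w
      have := hm (g⁻¹ • w)
      rwa [hm0, dil_zero_smul, smul_inv_smul] at this
    · exfalso
      have h1 := hmin γ hγ m hm hm0
      have h2 := hcosh hm hp₀
      have h3 : Real.cosh l ≤ Real.cosh m := by
        rw [Real.cosh_le_cosh, abs_of_pos h0]; exact h1
      have h4 : Real.cosh (1 / 32) ≤ Real.cosh (dist (k • p₀) (γ • k • p₀)) := by
        rw [h2, hp₀im, hy2]
        have : (Real.cosh l - 1) / ((Real.cosh l - 1) / (Real.cosh (1 / 32) - 1)) ≤
            (Real.cosh m - 1) / ((Real.cosh l - 1) / (Real.cosh (1 / 32) - 1)) :=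
          div_le_div_of_nonneg_right (by linarith) (div_pos hl1 hε).le
        rw [div_div_cancel₀ hl1.ne'] at this
        linarith
      rw [hcl (by norm_num) dist_nonneg] at h4
      linarith
  · rw [hzu, dist_smul']
    have h1 := dist_I_le hu1 hypos hyu.le
    have h2 := dist_I_le hp₀ hypos hp₀im.ge
    have h3 := dist_triangle u I p₀
    rw [dist_comm u I] at h3
    rw [show 2 / y = 1 / y + 1 / y by ring]
    linarith

/-- On a surface of finite area, all points outside a bounded part are moved a small amount
by a parabolic element. -/
lemma ProperFree.thick_thin (hΓ : ProperFree Γ) (harea : HypSurface.area Γ < ⊤) :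
    ∃ R, ∀ z : ℍ, (∃ γ ∈ Γ, dist I (γ • z) ≤ R) ∨
      ∃ δ ∈ Γ, ∃ g x, x ≠ 0 ∧ IsPar δ g x ∧ dist z (δ • z) < 1 / 32 := by
  obtain ⟨R, hR⟩ := exists_thick_bound hΓ harea (ε := 1 / 32) (by norm_num)
  -- The core lengths of the thin tubes. The thick point on a tube's boundary can be moved within R
  -- of i, where the core translation displaces by 1/32. So T is finite, and the distance from thin
  -- points to thick ones is bounded.
  set T : Set ℝ := {l | 0 < l ∧ ∃ γ ∈ {γ | γ ∈ Γ ∧ dist I (γ • I) ≤ 2 * R + 1 / 32},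
    ∃ g, IsTrans γ g l}
  have hT : T.Finite := finite_lengths (hΓ.finite _)
  obtain ⟨M, hM⟩ := (hT.image fun l ↦
    2 / √((Real.cosh l - 1) / (Real.cosh (1 / 32) - 1))).bddAbove
  refine ⟨R + max M 0, fun z ↦ ?_⟩
  by_cases hz : ∀ γ ∈ Γ, dist z (γ • z) < 1 / 32 → ∀ w : ℍ, γ • w = w
  · obtain ⟨γ, hγ, h⟩ := hR z hz
    exact Or.inl ⟨γ, hγ, h.trans (le_add_of_nonneg_right (le_max_right _ _))⟩
  · push Not at hz
    obtain ⟨A, hA, hd, w, hw⟩ := hz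
    rcases classification A with ⟨v, hv⟩ | ⟨g, L, hL, hg⟩ | ⟨g, x, hx, hg⟩
    · exact absurd (hΓ.free A hA v hv w) hw
    · left
      obtain ⟨l, hl, z', hthick, ⟨δ, hδ, k, hk, hδz⟩, hzz⟩ :=
        hΓ.exists_thick_of_thin hA hg hL hd
      obtain ⟨γ, hγ, h⟩ := hR z' hthick
      have hlT : l ∈ T := by
        refine ⟨hl, γ * δ * γ⁻¹, ⟨mul_mem (mul_mem hγ hδ) (inv_mem hγ), ?_⟩, γ * k, hk.conj γ⟩
        have h1 := dist_triangle4 I (γ • z') ((γ * δ * γ⁻¹) • γ • z') ((γ * δ * γ⁻¹) • I)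
        rw [dist_smul' (γ * δ * γ⁻¹), show (γ * δ * γ⁻¹) • γ • z' = γ • δ • z' by
          rw [mul_smul, mul_smul, inv_smul_smul], dist_smul' γ, hδz, dist_comm (γ • z') I] at h1
        linarith
      refine ⟨γ, hγ, (dist_triangle I (γ • z') _).trans (add_le_add h ?_)⟩
      rw [dist_smul', dist_comm]
      exact hzz.trans ((hM ⟨l, hlT, rfl⟩).trans (le_max_left _ _))
    · exact Or.inr ⟨A, hA, g, x, hx, hg, hd⟩

end HypGeom

namespace HypGeom

variable {Γ : Subgroup SL(2, ℝ)}

/-! ### The Ford domain -/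

lemma cosh_dist_trn (x : ℝ) (z : ℍ) :
    Real.cosh (dist z (trn x • z)) = 1 + x ^ 2 / (2 * z.im ^ 2) := by
  have := z.im_pos
  rw [cosh_dist_eq, trn_re, trn_im]
  field_simp
  ring

lemma trn_smul_injective {x y : ℝ} {z : ℍ} (h : trn x • z = trn y • z) : x = y := by
  have := congrArg UpperHalfPlane.re h
  simpa using this

lemma c_eq_zero_of_trn {p : SL(2, ℝ)} {x : ℝ} (hp : ∀ z : ℍ, p • z = trn x • z) : p 1 0 = 0 := by
  have : ∀ z : ℍ, ((trn x)⁻¹ * p) • z = z := fun z ↦ by rw [mul_smul, hp, inv_smul_smul]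
  rcases eq_one_or_eq_neg_one this with h | h
  · rw [← inv_mul_eq_one.1 h]; rfl
  · rw [inv_mul_eq_iff_eq_mul] at h
    rw [h, mul_neg, mul_one, neg_apply', trn_10, neg_zero]

/-- The stabilizer of `∞` in the group `Γ` is generated by the translation by `w`, and each
orbit has a point of height at least `y₀`. -/
structure CuspGroup (Γ : Subgroup SL(2, ℝ)) (w y₀ : ℝ) : Prop where
  pf : ProperFree Γ
  pos : 0 < w
  per : ∀ n : ℤ, ∃ p ∈ Γ, ∀ z : ℍ, p • z = trn (n * w) • z
  stab : ∀ γ ∈ Γ, γ 1 0 = 0 → ∃ n : ℤ, ∀ z : ℍ, γ • z = trn (n * w) • z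
  y_pos : 0 < y₀
  deep : ∀ z : ℍ, ∃ γ ∈ Γ, y₀ ≤ (γ • z).im

namespace CuspGroup

variable {w y₀ : ℝ}

lemma im_eq_of_c (hC : CuspGroup Γ w y₀) {γ : SL(2, ℝ)} (hγ : γ ∈ Γ) (hc : γ 1 0 = 0) (z : ℍ) :
    (γ • z).im = z.im := by
  obtain ⟨n, hn⟩ := hC.stab γ hγ hc
  rw [hn, trn_im]

/-- The lower left entries are bounded from below. -/
lemma exists_le_c_sq (hC : CuspGroup Γ w y₀) :
    ∃ c₀ > 0, ∀ γ ∈ Γ, γ 1 0 ≠ 0 → c₀ ≤ γ 1 0 ^ 2 := by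
  obtain ⟨r, hr, h⟩ := hC.pf.exists_injRadius I
  have hw := hC.pos
  obtain ⟨p, hp, hpw⟩ := hC.per 1
  rw [Int.cast_one, one_mul] at hpw
  have hr1 : 0 < Real.cosh r - 1 := sub_pos.2 (Real.one_lt_cosh.2 hr.ne')
  set K := w * (w ^ 2 + 1) with hK
  have hKpos : 0 < K := by positivity
  refine ⟨√(2 * (Real.cosh r - 1)) / K, div_pos (Real.sqrt_pos.2 (by linarith)) hKpos,
    fun γ hγ hc ↦ ?_⟩
  -- Choose u = i + nw so that |c · nw + d| ≤ |c|w. If c were small, γu would be high and the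
  -- parabolic p would barely move it, against the injectivity radius at i for the conjugate η.
  set n := -⌊γ 1 1 / (γ 1 0 * w)⌋ with hn
  obtain ⟨k, hk, hkw⟩ := hC.per n
  set u := k • I with hu
  have hden : denSq γ u ≤ γ 1 0 ^ 2 * (w ^ 2 + 1) := by
    have e : γ 1 0 * (n * w) + γ 1 1 = Int.fract (γ 1 1 / (γ 1 0 * w)) * (γ 1 0 * w) := by
      rw [hn, Int.fract, sub_mul, div_mul_cancel₀ _ (mul_ne_zero hc hw.ne')]
      push_cast
      ring
    have e1 := Int.fract_nonneg (γ 1 1 / (γ 1 0 * w))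
    have e2 := (Int.fract_lt_one (γ 1 1 / (γ 1 0 * w))).le
    have e3 : Int.fract (γ 1 1 / (γ 1 0 * w)) ^ 2 ≤ 1 := pow_le_one₀ e1 e2
    rw [denSq, hu, hkw, trn_re, trn_im, I_re, I_im, zero_add, e, mul_one, mul_pow]
    have e4 := mul_le_mul_of_nonneg_right e3 (sq_nonneg (γ 1 0 * w))
    rw [mul_pow] at e4 ⊢
    linarith
  set η := k⁻¹ * (γ⁻¹ * p * γ) * k with hη
  have hηΓ : η ∈ Γ := mul_mem (mul_mem (inv_mem hk) (mul_mem (mul_mem (inv_mem hγ) hp) hγ)) hk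
  have hd : dist I (η • I) = dist (γ • u) (trn w • γ • u) := by
    rw [← dist_smul' k, ← dist_smul' γ, ← hpw, hη, hu]
    simp only [mul_smul, smul_inv_smul]
  have hη1 : r ≤ dist I (η • I) := by
    by_contra! hlt
    have := h η hηΓ hlt I
    rw [this, dist_self] at hd
    have h0 : γ • u = trn w • γ • u := dist_eq_zero.1 hd.symm
    have h1 := congrArg UpperHalfPlane.re h0
    rw [trn_re] at h1
    linarith
  have h2 : Real.cosh r ≤ 1 + w ^ 2 / (2 * (γ • u).im ^ 2) := by
    rw [← cosh_dist_trn, ← hd, Real.cosh_le_cosh, abs_of_pos hr, abs_of_nonneg dist_nonneg]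
    exact hη1
  have hui : u.im = 1 := by rw [hu, hkw, trn_im, I_im]
  rw [im_smul, hui] at h2
  have hdp := denSq_pos γ u
  have h3 : w ^ 2 / (2 * (1 / denSq γ u) ^ 2) = (w * denSq γ u) ^ 2 / 2 := by field_simp
  rw [h3] at h2
  have h4 : w * denSq γ u ≤ K * γ 1 0 ^ 2 := by
    rw [hK, mul_assoc, mul_comm (w ^ 2 + 1)]
    exact mul_le_mul_of_nonneg_left hden hw.le
  rw [div_le_iff₀ hKpos, mul_comm _ K]
  refine Real.sqrt_le_iff.2 ⟨by positivity, ?_⟩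
  have h5 : (w * denSq γ u) ^ 2 ≤ (K * γ 1 0 ^ 2) ^ 2 := pow_le_pow_left₀ (by positivity) h4 2
  linarith

/-- The squared height of the isometric circle of `γ` above `x`. -/
def ht (γ : SL(2, ℝ)) (x : ℝ) : ℝ := (1 - (γ 1 0 * x + γ 1 1) ^ 2) / γ 1 0 ^ 2

lemma continuous_ht (γ : SL(2, ℝ)) : Continuous (ht γ) := by
  unfold ht
  fun_prop

lemma im_smul_le_iff {γ : SL(2, ℝ)} (hc : γ 1 0 ≠ 0) (z : ℍ) :
    (γ • z).im ≤ z.im ↔ ht γ z.re ≤ z.im ^ 2 := by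
  rw [im_smul, div_le_iff₀ (denSq_pos γ z), ht, div_le_iff₀ (sq_pos_iff.2 hc), denSq,
    le_mul_iff_one_le_right z.im_pos, mul_pow]
  constructor <;> intro h <;> linarith

lemma im_smul_eq_iff {γ : SL(2, ℝ)} (hc : γ 1 0 ≠ 0) (z : ℍ) :
    (γ • z).im = z.im ↔ ht γ z.re = z.im ^ 2 := by
  have hc2 : γ 1 0 ^ 2 ≠ 0 := pow_ne_zero 2 hc
  rw [im_smul, div_eq_iff (denSq_pos γ z).ne', ht, div_eq_iff hc2, denSq, eq_comm,
    mul_eq_left₀ z.im_ne_zero, mul_pow]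
  constructor <;> intro h <;> linarith

/-- `γ` and `δ` differ by an element of the stabilizer of `∞`. -/
def SameCoset (γ δ : SL(2, ℝ)) : Prop := γ 1 0 * δ 1 1 = γ 1 1 * δ 1 0

lemma sameCoset_iff (γ δ : SL(2, ℝ)) : SameCoset γ δ ↔ (γ * δ⁻¹) 1 0 = 0 := by
  rw [mul_apply', inv_00, inv_10, SameCoset, ← sub_eq_zero, mul_neg, sub_eq_add_neg]

lemma SameCoset.im_eq (hC : CuspGroup Γ w y₀) {γ δ : SL(2, ℝ)} (hγ : γ ∈ Γ) (hδ : δ ∈ Γ)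
    (h : SameCoset γ δ) (z : ℍ) : (γ • z).im = (δ • z).im := by
  have := hC.im_eq_of_c (mul_mem hγ (inv_mem hδ)) ((sameCoset_iff _ _).1 h) (δ • z)
  rwa [mul_smul, inv_smul_smul] at this

lemma SameCoset.ht_eq (hC : CuspGroup Γ w y₀) {γ δ : SL(2, ℝ)} (hγ : γ ∈ Γ) (hδ : δ ∈ Γ)
    (h : SameCoset γ δ) (x : ℝ) : ht γ x = ht δ x := by
  -- Comparing at the two heights 1 and 2 above x separates c² from (cx + d)².
  have h1 := SameCoset.im_eq hC hγ hδ h (⟨⟨x, 1⟩, one_pos⟩ : ℍ)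
  have h2 := SameCoset.im_eq hC hγ hδ h (⟨⟨x, 2⟩, two_pos⟩ : ℍ)
  rw [im_smul, im_smul, div_eq_div_iff (denSq_pos _ _).ne' (denSq_pos _ _).ne'] at h1 h2
  have h1' := mul_left_cancel₀ (UpperHalfPlane.im_ne_zero _) h1
  have h2' := mul_left_cancel₀ (UpperHalfPlane.im_ne_zero _) h2
  change (δ 1 0 * x + δ 1 1) ^ 2 + (δ 1 0 * 1) ^ 2 = (γ 1 0 * x + γ 1 1) ^ 2 + (γ 1 0 * 1) ^ 2
    at h1'
  change (δ 1 0 * x + δ 1 1) ^ 2 + (δ 1 0 * 2) ^ 2 = (γ 1 0 * x + γ 1 1) ^ 2 + (γ 1 0 * 2) ^ 2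
    at h2'
  have h3 : γ 1 0 ^ 2 = δ 1 0 ^ 2 := by linarith
  have h4 : (γ 1 0 * x + γ 1 1) ^ 2 = (δ 1 0 * x + δ 1 1) ^ 2 := by linarith
  rw [ht, ht, h3, h4]

/-- Two different isometric circles meet at most once. -/
lemma ht_subsingleton {γ δ : SL(2, ℝ)} (hc : γ 1 0 ≠ 0) (hc' : δ 1 0 ≠ 0)
    (h : ¬ SameCoset γ δ) : {x | ht γ x = ht δ x}.Subsingleton := by
  intro x hx y hy
  have hx : ht γ x = ht δ x := hx
  have hy : ht γ y = ht δ y := hy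
  -- Since `ht γ x` = 1/c² - (x + d/c)², the difference of two such functions is affine, with
  -- non-zero slope when the centres differ.
  have e : ∀ (γ : SL(2, ℝ)), γ 1 0 ≠ 0 → ht γ x - ht γ y =
      (y ^ 2 - x ^ 2) + 2 * (γ 1 1 / γ 1 0) * (y - x) := by
    intro γ hc
    unfold ht
    field_simp
    ring
  have e1 := e γ hc
  have e2 := e δ hc'
  have e3 : (γ 1 1 / γ 1 0 - δ 1 1 / δ 1 0) * (y - x) = 0 := by
    rw [hx, hy] at e1
    linarith
  rcases mul_eq_zero.1 e3 with h4 | h4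
  · exfalso
    apply h
    rw [SameCoset]
    rw [sub_eq_zero, div_eq_div_iff hc hc'] at h4
    linarith
  · linarith

/-- Locally, there are finitely many isometric circles of a given height. -/
lemma exists_finite_circles (hC : CuspGroup Γ w y₀) (M : ℝ) :
    ∃ E : Set SL(2, ℝ), E.Finite ∧ (∀ η ∈ E, η ∈ Γ ∧ η 1 0 ≠ 0) ∧
      ∀ γ ∈ Γ, γ 1 0 ≠ 0 → ∀ x, abs x ≤ M → y₀ ^ 2 / 4 ≤ ht γ x → ∃ η ∈ E, SameCoset γ η := by
  obtain ⟨c₀, hc₀, hc₀'⟩ := hC.exists_le_c_sq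
  have hy := hC.y_pos
  have hw := hC.pos
  set B := 4 / y₀ ^ 2 + (1 + (4 / y₀ ^ 2 + 1) * (abs M)) ^ 2 with hB
  have hBpos : 0 < B := by positivity
  set R := 1 + (w ^ 2 + (1 / c₀ + 1) ^ 2) / (2 / B) with hR
  refine ⟨{η | (η ∈ Γ ∧ dist I (η • I) ≤ R) ∧ η 1 0 ≠ 0}, (hC.pf.finite R).subset fun η h ↦ h.1,
    fun η h ↦ ⟨h.1.1, h.2⟩, fun γ hγ hc x hx hh ↦ ?_⟩
  have hc2 : 0 < γ 1 0 ^ 2 := sq_pos_iff.2 hc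
  rw [ht, le_div_iff₀ hc2] at hh
  have h1 : (γ 1 0 * x + γ 1 1) ^ 2 ≤ 1 := by
    have : 0 ≤ y₀ ^ 2 / 4 * γ 1 0 ^ 2 := by positivity
    linarith
  have h2 : γ 1 0 ^ 2 ≤ 4 / y₀ ^ 2 := by
    rw [le_div_iff₀ (by positivity)]
    have := sq_nonneg (γ 1 0 * x + γ 1 1)
    linarith
  have h3 : abs (γ 1 0) ≤ 4 / y₀ ^ 2 + 1 := by
    have := sq_abs (γ 1 0)
    nlinarith [sq_nonneg (abs (γ 1 0) - 1)]
  have h4 : abs (γ 1 1) ≤ 1 + (4 / y₀ ^ 2 + 1) * abs M := by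
    have e1 : abs (γ 1 0 * x + γ 1 1) ≤ 1 := by rwa [← sq_le_one_iff_abs_le_one]
    have e2 : abs (γ 1 0 * x) ≤ (4 / y₀ ^ 2 + 1) * abs M := by
      rw [abs_mul]
      exact mul_le_mul h3 (hx.trans (le_abs_self M)) (abs_nonneg _) (by positivity)
    have e3 := abs_sub (γ 1 0 * x + γ 1 1) (γ 1 0 * x)
    rw [add_sub_cancel_left] at e3
    linarith
  have h5 : denSq γ I ≤ B := by
    have : γ 1 1 ^ 2 ≤ (1 + (4 / y₀ ^ 2 + 1) * abs M) ^ 2 := by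
      rw [← sq_abs]
      exact pow_le_pow_left₀ (abs_nonneg _) h4 2
    simp only [denSq, I_re, I_im, mul_zero, zero_add, mul_one]
    linarith
  have h6 : c₀ ≤ denSq γ I := by
    have := hc₀' γ hγ hc
    simp only [denSq, I_re, I_im, mul_zero, zero_add, mul_one]
    have := sq_nonneg (γ 1 1)
    linarith
  -- The height condition bounds c and d, hence the height of γi on both sides. A horizontal
  -- translation, which keeps the coset, also bounds its real part, so finitely many representatives
  -- suffice.
  obtain ⟨p, hp, hpw⟩ := hC.per (-⌊(γ • I).re / w⌋)
  have hpc : p 1 0 = 0 := c_eq_zero_of_trn hpw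
  refine ⟨p * γ, ⟨⟨mul_mem hp hγ, ?_⟩, ?_⟩, ?_⟩
  · set u := (p * γ) • I with hu
    have hre : u.re = Int.fract ((γ • I).re / w) * w := by
      rw [hu, mul_smul, hpw, trn_re, Int.fract, sub_mul, div_mul_cancel₀ _ hw.ne']
      push_cast
      ring
    have him : u.im = 1 / denSq γ I := by rw [hu, mul_smul, hpw, trn_im, im_smul, I_im]
    have hre2 : u.re ^ 2 ≤ w ^ 2 := by
      rw [hre, mul_pow]
      have := pow_le_one₀ (n := 2) (Int.fract_nonneg ((γ • I).re / w)) (Int.fract_lt_one _).le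
      exact mul_le_of_le_one_left (sq_nonneg w) this
    have him1 : u.im ≤ 1 / c₀ := by rw [him]; exact one_div_le_one_div_of_le hc₀ h6
    have him2 : 1 / B ≤ u.im := by rw [him]; exact one_div_le_one_div_of_le (denSq_pos _ _) h5
    have h7 : dist I u ≤ Real.cosh (dist I u) :=
      (Real.self_le_sinh_iff.2 dist_nonneg).trans (Real.sinh_lt_cosh _).le
    refine h7.trans ?_
    rw [cosh_dist_eq, I_re, I_im, hR]
    have hup := u.im_pos
    have h8 : (0 - u.re) ^ 2 + (1 - u.im) ^ 2 ≤ w ^ 2 + (1 / c₀ + 1) ^ 2 := by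
      have : (1 - u.im) ^ 2 ≤ (1 / c₀ + 1) ^ 2 := by
        apply sq_le_sq'
        · linarith
        · have : 0 < 1 / c₀ := by positivity
          linarith
      nlinarith
    have h9 : 2 / B ≤ 2 * 1 * u.im := by rw [show 2 / B = 2 * (1 / B) by ring]; linarith
    have := div_le_div₀ (by positivity) h8 (by positivity) h9
    linarith
  · rw [mul_apply', hpc, zero_mul, zero_add]
    refine mul_ne_zero (fun h ↦ ?_) hc
    have := det_eq p
    rw [hpc, h] at this
    norm_num at this
  · rw [SameCoset, mul_apply', mul_apply', hpc]
    ring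

end CuspGroup

end HypGeom

/-! ### Boundary points and vertices of the Ford domain -/

namespace HypGeom

lemma smul_eq_self_of_fix {k : SL(2, ℝ)} {z w : ℍ} (hz : k • z = z) (hw : k • w = w) (h : z ≠ w)
    (u : ℍ) : k • u = u := by
  obtain ⟨g, rfl, hg⟩ := exists_geodesic z w
  have := smul_eq_self_of_fix_vert (k := g⁻¹ * k * g) (dist_ne_zero.2 h)
    (by rw [mul_smul, mul_smul, hz, inv_smul_smul])
    (by rw [mul_smul, mul_smul, ← hg, hw, inv_smul_eq_iff]; exact hg) (g⁻¹ • u)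
  rwa [mul_smul, mul_smul, smul_inv_smul, smul_left_cancel_iff] at this

namespace CuspGroup

variable {Γ : Subgroup SL(2, ℝ)} {w y₀ : ℝ}

lemma SameCoset.symm {γ δ : SL(2, ℝ)} (h : SameCoset γ δ) : SameCoset δ γ := by
  rw [SameCoset] at h ⊢
  linarith

lemma SameCoset.trans {γ δ ε : SL(2, ℝ)} (h : SameCoset γ δ) (h' : SameCoset δ ε) :
    SameCoset γ ε := by
  rw [sameCoset_iff] at *
  have := mul_apply' (γ * δ⁻¹) (δ * ε⁻¹) 1 0
  rwa [h, h', zero_mul, mul_zero, add_zero, mul_assoc, inv_mul_cancel_left] at this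

lemma sameCoset_mul {γ δ ε : SL(2, ℝ)} : SameCoset (γ * ε) (δ * ε) ↔ SameCoset γ δ := by
  rw [sameCoset_iff, sameCoset_iff, mul_inv_rev, mul_assoc, mul_inv_cancel_left]

lemma sameCoset_of_c {γ δ : SL(2, ℝ)} (hγ : γ 1 0 = 0) (hδ : δ 1 0 = 0) : SameCoset γ δ := by
  rw [SameCoset, hγ, hδ]
  ring

lemma sameCoset_one {γ : SL(2, ℝ)} : SameCoset γ 1 ↔ γ 1 0 = 0 := by
  rw [sameCoset_iff, inv_one, mul_one]

/-- `z` has maximal height in its orbit. -/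
def Top (Γ : Subgroup SL(2, ℝ)) (z : ℍ) : Prop := ∀ γ ∈ Γ, (γ • z).im ≤ z.im

/-- `z` lies on the boundary of the Ford domain. -/
def Bd (Γ : Subgroup SL(2, ℝ)) (z : ℍ) : Prop :=
  Top Γ z ∧ ∃ γ ∈ Γ, γ 1 0 ≠ 0 ∧ (γ • z).im = z.im

/-- `z` is a vertex of the Ford domain. -/
def Vert (Γ : Subgroup SL(2, ℝ)) (z : ℍ) : Prop :=
  ∃ e : Fin 3 → SL(2, ℝ), (∀ i, e i ∈ Γ ∧ (e i • z).im = z.im) ∧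
    ∀ i j, i ≠ j → ¬ SameCoset (e i) (e j)

lemma Bd.smul {z : ℍ} (hz : Bd Γ z) {γ : SL(2, ℝ)} (hγ : γ ∈ Γ) (h : (γ • z).im = z.im) :
    Bd Γ (γ • z) := by
  refine ⟨fun δ hδ ↦ ?_, ?_⟩
  · rw [h, ← mul_smul]
    exact hz.1 _ (mul_mem hδ hγ)
  by_cases hc : γ 1 0 = 0
  · obtain ⟨η, hη, hηc, hηz⟩ := hz.2
    refine ⟨η * γ⁻¹, mul_mem hη (inv_mem hγ), ?_, ?_⟩
    · exact fun h ↦ hηc (sameCoset_one.1 (((sameCoset_iff _ _).2 h).trans (sameCoset_one.2 hc)))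
    · rw [mul_smul, inv_smul_smul, hηz, h]
  · refine ⟨γ⁻¹, inv_mem hγ, ?_, ?_⟩
    · rwa [inv_10, neg_ne_zero]
    · rw [inv_smul_smul, h]

lemma Vert.smul {z : ℍ} (hz : Vert Γ z) {γ : SL(2, ℝ)} (hγ : γ ∈ Γ) (h : (γ • z).im = z.im) :
    Vert Γ (γ • z) := by
  obtain ⟨e, he, he'⟩ := hz
  refine ⟨fun i ↦ e i * γ⁻¹, fun i ↦ ⟨mul_mem (he i).1 (inv_mem hγ), ?_⟩, fun i j hij ↦ ?_⟩
  · rw [mul_smul, inv_smul_smul, (he i).2, h]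
  · rw [sameCoset_mul]
    exact he' i j hij

/-- At most one of the three cosets in `Vert` is trivial, which leaves two distinct isometric
circles through z. The symmetric form in `Vert` is the one that visibly passes to translates. -/
lemma vert_iff {z : ℍ} : Vert Γ z ↔ ∃ γ ∈ Γ, ∃ δ ∈ Γ, γ 1 0 ≠ 0 ∧ δ 1 0 ≠ 0 ∧ ¬ SameCoset γ δ ∧
    (γ • z).im = z.im ∧ (δ • z).im = z.im := by
  constructor
  · rintro ⟨e, he, he'⟩
    by_cases h0 : e 0 1 0 = 0
    · exact ⟨e 1, (he 1).1, e 2, (he 2).1, fun h ↦ he' 0 1 (by decide) (sameCoset_of_c h0 h),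
        fun h ↦ he' 0 2 (by decide) (sameCoset_of_c h0 h), he' 1 2 (by decide), (he 1).2, (he 2).2⟩
    by_cases h1 : e 1 1 0 = 0
    · exact ⟨e 0, (he 0).1, e 2, (he 2).1, h0,
        fun h ↦ he' 1 2 (by decide) (sameCoset_of_c h1 h), he' 0 2 (by decide), (he 0).2, (he 2).2⟩
    · exact ⟨e 0, (he 0).1, e 1, (he 1).1, h0, h1, he' 0 1 (by decide), (he 0).2, (he 1).2⟩
  · rintro ⟨γ, hγ, δ, hδ, hγc, hδc, hn, h1, h2⟩
    have a1 : ¬ SameCoset γ 1 := fun h ↦ hγc (sameCoset_one.1 h)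
    have a2 : ¬ SameCoset δ 1 := fun h ↦ hδc (sameCoset_one.1 h)
    refine ⟨![1, γ, δ], ?_, ?_⟩
    · intro i
      fin_cases i
      · exact ⟨one_mem Γ, congrArg _ (one_smul _ z)⟩
      · exact ⟨hγ, h1⟩
      · exact ⟨hδ, h2⟩
    · intro i j hij
      fin_cases i <;> fin_cases j <;> try exact absurd rfl hij
      · exact fun h ↦ a1 h.symm
      · exact fun h ↦ a2 h.symm
      · exact a1
      · exact hn
      · exact a2
      · exact fun h ↦ hn h.symm

/-- The point at height y₀/2 above x can be raised by Γ, so it lies below some isometric circle.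
Among the finitely many relevant circles, take the highest one above x. -/
lemma exists_bd (hC : CuspGroup Γ w y₀) (x : ℝ) : ∃ z, Bd Γ z ∧ z.re = x := by
  have hy := hC.y_pos
  obtain ⟨E, hE, hEΓ, hE'⟩ := hC.exists_finite_circles (abs x)
  obtain ⟨γ, hγ, hγy⟩ := hC.deep ⟨⟨x, y₀ / 2⟩, by positivity⟩
  set z₀ : ℍ := ⟨⟨x, y₀ / 2⟩, by positivity⟩ with hz₀
  have hz₀i : z₀.im = y₀ / 2 := rfl
  have hz₀r : z₀.re = x := rfl
  have hγc : γ 1 0 ≠ 0 := fun h ↦ by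
    rw [hC.im_eq_of_c hγ h] at hγy
    linarith
  have h1 : y₀ ^ 2 / 4 < ht γ x := by
    have h : ¬ (γ • z₀).im ≤ z₀.im := by
      rw [not_le]
      linarith
    rw [im_smul_le_iff hγc, hz₀i, hz₀r, not_le] at h
    linarith
  obtain ⟨η₀, hη₀, hη₀c⟩ := hE' γ hγ hγc x le_rfl h1.le
  obtain ⟨η, hη, hmax⟩ := Set.exists_max_image E (fun η ↦ ht η x) hE ⟨η₀, hη₀⟩
  have h2 : y₀ ^ 2 / 4 < ht η x := by
    rw [hη₀c.ht_eq hC hγ (hEΓ _ hη₀).1] at h1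
    exact h1.trans_le (hmax _ hη₀)
  have h3 : 0 < ht η x := lt_of_le_of_lt (by positivity) h2
  refine ⟨⟨⟨x, √(ht η x)⟩, Real.sqrt_pos.2 h3⟩, ⟨fun δ hδ ↦ ?_, η, (hEΓ η hη).1, (hEΓ η hη).2, ?_⟩,
    rfl⟩
  · by_cases hc : δ 1 0 = 0
    · exact (hC.im_eq_of_c hδ hc _).le
    · rw [im_smul_le_iff hc]
      change ht δ x ≤ √(ht η x) ^ 2
      rw [Real.sq_sqrt h3.le]
      by_contra! hlt
      obtain ⟨η₁, hη₁, hη₁c⟩ := hE' δ hδ hc x le_rfl (h2.trans hlt).le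
      rw [hη₁c.ht_eq hC hδ (hEΓ _ hη₁).1] at hlt
      exact (hmax _ hη₁).not_gt hlt
  · rw [im_smul_eq_iff (hEΓ η hη).2]
    exact (Real.sq_sqrt h3.le).symm

/-- The point above `x` on the boundary of the Ford domain. -/
def v (hC : CuspGroup Γ w y₀) (x : ℝ) : ℍ := (hC.exists_bd x).choose

lemma bd_v (hC : CuspGroup Γ w y₀) (x : ℝ) : Bd Γ (hC.v x) := (hC.exists_bd x).choose_spec.1

@[simp] lemma v_re (hC : CuspGroup Γ w y₀) (x : ℝ) : (hC.v x).re = x :=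
  (hC.exists_bd x).choose_spec.2

/-- The circle through z bounds from below the height of any point on its vertical line that is
highest in its orbit. So the boundary is a graph over ℝ. -/
lemma Bd.sq_im_le {z z' : ℍ} (hz : Bd Γ z) (hz' : Bd Γ z') (h : z.re = z'.re) :
    z.im ^ 2 ≤ z'.im ^ 2 := by
  obtain ⟨η, hη, hηc, hηz⟩ := hz.2
  rw [im_smul_eq_iff hηc] at hηz
  rw [← hηz, h, ← im_smul_le_iff hηc]
  exact hz'.1 η hη

lemma v_eq (hC : CuspGroup Γ w y₀) {z : ℍ} (hz : Bd Γ z) : hC.v z.re = z := by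
  refine hext (v_re hC _) ?_
  have h1 := (hC.bd_v z.re).sq_im_le hz (v_re hC _)
  have h2 := hz.sq_im_le (hC.bd_v z.re) (v_re hC _).symm
  exact (pow_left_inj₀ (im_pos _).le (im_pos _).le two_ne_zero).1 (le_antisymm h1 h2)

lemma le_v_im (hC : CuspGroup Γ w y₀) (x : ℝ) : y₀ ≤ (hC.v x).im := by
  obtain ⟨γ, hγ, h⟩ := hC.deep (hC.v x)
  exact h.trans ((hC.bd_v x).1 γ hγ)

lemma im_eq_of_smul_v (hC : CuspGroup Γ w y₀) {γ : SL(2, ℝ)} (hγ : γ ∈ Γ) {x y : ℝ}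
    (h : γ • hC.v x = hC.v y) : (γ • hC.v x).im = (hC.v x).im := by
  refine le_antisymm ((hC.bd_v x).1 γ hγ) ?_
  have := (hC.bd_v y).1 γ⁻¹ (inv_mem hγ)
  rwa [← h, inv_smul_smul] at this

lemma smul_v (hC : CuspGroup Γ w y₀) {γ : SL(2, ℝ)} (hγ : γ ∈ Γ) {x : ℝ}
    (h : (γ • hC.v x).im = (hC.v x).im) : γ • hC.v x = hC.v (γ • hC.v x).re :=
  (hC.v_eq ((hC.bd_v x).smul hγ h)).symm

lemma v_add (hC : CuspGroup Γ w y₀) (x : ℝ) (n : ℤ) : hC.v (x + n * w) = trn (n * w) • hC.v x := by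
  obtain ⟨p, hp, hpw⟩ := hC.per n
  have := hC.smul_v hp (x := x) (by rw [hpw, trn_im])
  rw [hpw, trn_re, v_re] at this
  exact this.symm

lemma vert_smul_iff (hC : CuspGroup Γ w y₀) {γ : SL(2, ℝ)} (hγ : γ ∈ Γ) {x y : ℝ}
    (h : γ • hC.v x = hC.v y) : Vert Γ (hC.v x) ↔ Vert Γ (hC.v y) := by
  have h' : γ⁻¹ • hC.v y = hC.v x := by rw [← h, inv_smul_smul]
  constructor
  · intro hv
    rw [← h]
    exact hv.smul hγ (hC.im_eq_of_smul_v hγ h)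
  · intro hv
    rw [← h']
    exact hv.smul (inv_mem hγ) (hC.im_eq_of_smul_v (inv_mem hγ) h')

/-- On its isometric circle γ preserves heights and acts on abscissas by a reflection of ℝ. This
reversal makes paired sides cancel. -/
lemma smul_v_of_c (hC : CuspGroup Γ w y₀) {γ : SL(2, ℝ)} (hγ : γ ∈ Γ) (hc : γ 1 0 ≠ 0) {x : ℝ}
    (h : (γ • hC.v x).im = (hC.v x).im) :
    γ • hC.v x = hC.v ((γ 0 0 - γ 1 1) / γ 1 0 - x) := by
  rw [hC.smul_v hγ h]
  congr 1
  have hd : denSq γ (hC.v x) = 1 := by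
    rw [im_smul, div_eq_iff (denSq_pos _ _).ne', eq_comm] at h
    exact (mul_eq_left₀ (im_ne_zero _)).1 h
  have hdet := det_eq γ
  rw [re_smul, hd, div_one, eq_sub_iff_add_eq, eq_div_iff hc]
  rw [denSq] at hd
  simp only [v_re] at hd ⊢
  linear_combination γ 0 0 * hd - (γ 1 0 * x + γ 1 1) * hdet

end CuspGroup

end HypGeom

/-! ### Sides and consecutive vertices of the Ford domain -/

namespace HypGeom

namespace CuspGroup

variable {Γ : Subgroup SL(2, ℝ)} {w y₀ : ℝ}

lemma ht_eq_of_im_eq (hC : CuspGroup Γ w y₀) {γ : SL(2, ℝ)} (hc : γ 1 0 ≠ 0) {x : ℝ}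
    (h : (γ • hC.v x).im = (hC.v x).im) : ht γ x = (hC.v x).im ^ 2 := by
  have := (im_smul_eq_iff hc _).1 h
  rwa [v_re] at this

lemma sq_le_of_im_eq (hC : CuspGroup Γ w y₀) {γ : SL(2, ℝ)} (hc : γ 1 0 ≠ 0) {x : ℝ}
    (h : (γ • hC.v x).im = (hC.v x).im) : y₀ ^ 2 / 4 ≤ ht γ x := by
  rw [hC.ht_eq_of_im_eq hc h]
  have := pow_le_pow_left₀ hC.y_pos.le (hC.le_v_im x) 2
  have := sq_nonneg y₀
  linarith

/-- Between two consecutive vertices, the boundary of the Ford domain lies on one isometric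
circle. -/
lemma exists_edge (hC : CuspGroup Γ w y₀) {x y : ℝ} (hxy : x < y)
    (hV : ∀ t ∈ Ioo x y, ¬ Vert Γ (hC.v t)) :
    ∃ η ∈ Γ, η 1 0 ≠ 0 ∧ ∀ t ∈ Icc x y, (η • hC.v t).im = (hC.v t).im := by
  obtain ⟨E, hE, hEΓ, hE'⟩ := hC.exists_finite_circles (max (abs x) (abs y))
  have hM : ∀ t ∈ Icc x y, abs t ≤ max (abs x) (abs y) := fun t ht ↦ abs_le_max_abs_abs ht.1 ht.2
  set S : SL(2, ℝ) → Set ℝ := fun η ↦ {t | ∀ η' ∈ E, ht η' t ≤ ht η t} with hS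
  have hSc : ∀ η, IsClosed (S η) := fun η ↦ by
    have : S η = ⋂ η' ∈ E, {t | ht η' t ≤ ht η t} := by
      ext t
      simp [hS]
    rw [this]
    exact isClosed_biInter fun η' _ ↦ isClosed_le (continuous_ht η') (continuous_ht η)
  have hcov : ∀ t ∈ Icc x y, ∃ η ∈ E, (η • hC.v t).im = (hC.v t).im := by
    intro t htt
    obtain ⟨γ, hγ, hγc, hγt⟩ := (hC.bd_v t).2
    obtain ⟨η, hη, hγη⟩ := hE' γ hγ hγc t (hM t htt) (hC.sq_le_of_im_eq hγc hγt)
    exact ⟨η, hη, by rw [← hγη.im_eq hC hγ (hEΓ η hη).1, hγt]⟩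
  have hle : ∀ η ∈ E, ∀ t, ht η t ≤ (hC.v t).im ^ 2 := fun η hη t ↦ by
    have := (im_smul_le_iff (hEΓ η hη).2 _).1 ((hC.bd_v t).1 η (hEΓ η hη).1)
    rwa [v_re] at this
  have hSiff : ∀ η ∈ E, ∀ t ∈ Icc x y, t ∈ S η ↔ (η • hC.v t).im = (hC.v t).im := by
    intro η hη t htt
    constructor
    · intro h
      obtain ⟨η', hη', h'⟩ := hcov t htt
      rw [im_smul_eq_iff (hEΓ η hη).2, v_re]
      refine le_antisymm (hle η hη t) ?_
      rw [← hC.ht_eq_of_im_eq (hEΓ η' hη').2 h']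
      exact h η' hη'
    · intro h η' hη'
      rw [hC.ht_eq_of_im_eq (hEΓ η hη).2 h]
      exact hle η' hη' t
  have hmid : (x + y) / 2 ∈ Ioo x y := ⟨by linarith, by linarith⟩
  obtain ⟨η, hη, hηm⟩ := hcov _ (Ioo_subset_Icc_self hmid)
  refine ⟨η, (hEΓ η hη).1, (hEΓ η hη).2, fun t htt ↦ (hSiff η hη t htt).1 ?_⟩
  -- The closed sets where η, respectively a different circle, is highest cover the open interval.
  -- If both met it, connectedness would give a common point, which is a vertex.
  have key : Ioo x y ⊆ S η := by
    intro t htt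
    by_contra hn
    set U := ⋃ η' ∈ {η' | η' ∈ E ∧ ¬ SameCoset η' η}, S η' with hU
    have hUc : IsClosed U := (hE.subset (fun _ h ↦ h.1)).isClosed_biUnion fun η' _ ↦ hSc η'
    have hcovU : ∀ t ∈ Ioo x y, t ∉ S η → t ∈ U := by
      intro t htt hn
      obtain ⟨η', hη', h'⟩ := hcov t (Ioo_subset_Icc_self htt)
      refine mem_biUnion (x := η') ⟨hη', fun hs ↦ hn ?_⟩
        ((hSiff η' hη' t (Ioo_subset_Icc_self htt)).2 h')
      rw [hSiff η hη t (Ioo_subset_Icc_self htt), ← hs.im_eq hC (hEΓ η' hη').1 (hEΓ η hη).1, h']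
    obtain ⟨u, hu, hu1, hu2⟩ := isPreconnected_closed_iff.1 isPreconnected_Ioo (S η) U (hSc η) hUc
      (fun t htt ↦ by
        by_cases h : t ∈ S η
        · exact Or.inl h
        · exact Or.inr (hcovU t htt h))
      ⟨_, hmid, (hSiff η hη _ (Ioo_subset_Icc_self hmid)).2 hηm⟩ ⟨t, htt, hcovU t htt hn⟩
    obtain ⟨η', ⟨hη', hns⟩, hu3⟩ := mem_iUnion₂.1 hu2
    have huI := Ioo_subset_Icc_self hu
    exact hV u hu (vert_iff.2 ⟨η', (hEΓ η' hη').1, η, (hEΓ η hη).1, (hEΓ η' hη').2, (hEΓ η hη).2,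
      hns, (hSiff η' hη' u huI).1 hu3, (hSiff η hη u huI).1 hu1⟩)
  rw [← closure_Ioo hxy.ne] at htt
  exact closure_minimal key (hSc η) htt

/-- The abscissas of the vertices. -/
def verts (hC : CuspGroup Γ w y₀) : Set ℝ := {x | Vert Γ (hC.v x)}

/-- A vertex is an intersection of two different circles from a finite family, and two circles meet
at most once. -/
lemma finite_verts (hC : CuspGroup Γ w y₀) (x y : ℝ) : (hC.verts ∩ Icc x y).Finite := by
  obtain ⟨E, hE, hEΓ, hE'⟩ := hC.exists_finite_circles (max (abs x) (abs y))
  have hfin : (⋃ p ∈ {p | p ∈ E ×ˢ E ∧ ¬ SameCoset p.1 p.2}, {t | ht p.1 t = ht p.2 t}).Finite :=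
    ((hE.prod hE).subset (fun _ h ↦ h.1)).biUnion fun p hp ↦
      (ht_subsingleton (hEΓ _ hp.1.1).2 (hEΓ _ hp.1.2).2 hp.2).finite
  refine hfin.subset ?_
  rintro t ⟨htV, htt⟩
  have hM := abs_le_max_abs_abs htt.1 htt.2
  obtain ⟨γ, hγ, δ, hδ, hγc, hδc, hns, hγt, hδt⟩ := vert_iff.1 htV
  obtain ⟨η, hη, hγη⟩ := hE' γ hγ hγc t hM (hC.sq_le_of_im_eq hγc hγt)
  obtain ⟨ε, hε, hδε⟩ := hE' δ hδ hδc t hM (hC.sq_le_of_im_eq hδc hδt)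
  refine mem_iUnion₂.2 ⟨(η, ε), ⟨⟨hη, hε⟩, fun h ↦ hns ((hγη.trans h).trans hδε.symm)⟩, ?_⟩
  change ht η t = ht ε t
  rw [← hγη.ht_eq hC hγ (hEΓ _ hη).1, ← hδε.ht_eq hC hδ (hEΓ _ hε).1,
    hC.ht_eq_of_im_eq hγc hγt, hC.ht_eq_of_im_eq hδc hδt]

/-- A vertex-free interval lies under one circle, where |cx + d| ≤ 1, so its length D satisfies c₀D²
≤ 4. The choice D = 4/c₀ + 1 violates this. -/
lemma exists_vert_between (hC : CuspGroup Γ w y₀) :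
    ∃ D > 0, ∀ x, ∃ t ∈ Ioo x (x + D), t ∈ hC.verts := by
  obtain ⟨c₀, hc₀, h⟩ := hC.exists_le_c_sq
  refine ⟨4 / c₀ + 1, by positivity, fun x ↦ ?_⟩
  set D := 4 / c₀ + 1 with hD
  have hDp : 0 < D := by positivity
  by_contra! hn
  obtain ⟨η, hη, hηc, hηt⟩ := hC.exists_edge (lt_add_of_pos_right x hDp) hn
  have e : ∀ t ∈ Icc x (x + D), abs (η 1 0 * t + η 1 1) ≤ 1 := by
    intro t htt
    rw [← sq_le_one_iff_abs_le_one]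
    have h1 := hC.ht_eq_of_im_eq hηc (hηt t htt)
    rw [ht, div_eq_iff (pow_ne_zero 2 hηc)] at h1
    have : 0 ≤ (hC.v t).im ^ 2 * η 1 0 ^ 2 := by positivity
    linarith
  have e1 := abs_le.1 (e x ⟨le_rfl, by linarith⟩)
  have e2 := abs_le.1 (e (x + D) ⟨by linarith, le_rfl⟩)
  have e3 : (η 1 0 * D) ^ 2 ≤ 2 ^ 2 := sq_le_sq' (by linarith) (by linarith)
  have e4 : c₀ * D ^ 2 ≤ 4 := by
    have := mul_le_mul_of_nonneg_right (h η hη hηc) (sq_nonneg D)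
    rw [mul_pow] at e3
    linarith
  have e5 : c₀ * D ^ 2 = 16 / c₀ + 8 + c₀ := by
    rw [hD]
    field_simp
    ring
  have : 0 < 16 / c₀ := by positivity
  linarith

lemma exists_next (hC : CuspGroup Γ w y₀) (x : ℝ) :
    ∃ y, x < y ∧ y ∈ hC.verts ∧ ∀ t ∈ Ioo x y, t ∉ hC.verts := by
  obtain ⟨D, -, h⟩ := hC.exists_vert_between
  obtain ⟨u, hu, huV⟩ := h x
  have hfin : (hC.verts ∩ Ioc x u).Finite :=
    (hC.finite_verts x u).subset (inter_subset_inter_right _ Ioc_subset_Icc_self)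
  obtain ⟨y, hy, hmin⟩ := Set.exists_min_image _ id hfin ⟨u, huV, hu.1, le_rfl⟩
  refine ⟨y, hy.2.1, hy.1, fun t htt htV ↦ ?_⟩
  exact (hmin t ⟨htV, htt.1, htt.2.le.trans hy.2.2⟩).not_gt htt.2

/-- The abscissa of the next vertex to the right. -/
def next (hC : CuspGroup Γ w y₀) (x : ℝ) : ℝ := (hC.exists_next x).choose

lemma lt_next (hC : CuspGroup Γ w y₀) (x : ℝ) : x < hC.next x := (hC.exists_next x).choose_spec.1

lemma next_mem (hC : CuspGroup Γ w y₀) (x : ℝ) : hC.next x ∈ hC.verts :=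
  (hC.exists_next x).choose_spec.2.1

lemma notMem_of_lt_next (hC : CuspGroup Γ w y₀) {x t : ℝ} (h : t ∈ Ioo x (hC.next x)) :
    t ∉ hC.verts := (hC.exists_next x).choose_spec.2.2 t h

lemma next_le (hC : CuspGroup Γ w y₀) {x y : ℝ} (hxy : x < y) (hy : y ∈ hC.verts) :
    hC.next x ≤ y := by
  by_contra! h
  exact hC.notMem_of_lt_next ⟨hxy, h⟩ hy

lemma next_eq (hC : CuspGroup Γ w y₀) {x y : ℝ} (hxy : x < y) (hy : y ∈ hC.verts)
    (h : ∀ t ∈ Ioo x y, t ∉ hC.verts) : hC.next x = y := by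
  refine (hC.next_le hxy hy).antisymm ?_
  by_contra! h'
  exact h _ ⟨hC.lt_next x, h'⟩ (hC.next_mem x)

lemma finite_verts_Ico (hC : CuspGroup Γ w y₀) (x y : ℝ) : (hC.verts ∩ Ico x y).Finite :=
  (hC.finite_verts x y).subset (inter_subset_inter_right _ Ico_subset_Icc_self)

/-- A telescoping sum over consecutive vertices, by induction on their number. -/
lemma sum_next {A : Type*} [AddCommGroup A] (hC : CuspGroup Γ w y₀) (Q : ℝ → ℝ → A)
    (hQ : ∀ x y z, Q x y + Q y z = Q x z) {b : ℝ} (hb : b ∈ hC.verts) (n : ℕ) :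
    ∀ a ∈ hC.verts, a ≤ b → (hC.finite_verts_Ico a b).toFinset.card = n →
    ∑ x ∈ (hC.finite_verts_Ico a b).toFinset, Q x (hC.next x) = Q a b := by
  induction n with
  | zero =>
    intro a ha hab hcard
    rcases hab.eq_or_lt with rfl | hlt
    · have := hQ a a a
      rw [Finset.card_eq_zero] at hcard
      rw [hcard, Finset.sum_empty]
      exact (by simpa using this : Q a a = 0).symm
    · rw [Finset.card_eq_zero, Finite.toFinset_eq_empty] at hcard
      exact absurd (show a ∈ hC.verts ∩ Ico a b from ⟨ha, le_rfl, hlt⟩) (by simp [hcard])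
  | succ n ih =>
    intro a ha hab hcard
    have hlt : a < b := by
      refine hab.lt_of_ne ?_
      rintro rfl
      simp at hcard
    have hnb := hC.next_le hlt hb
    have hlt' := hC.lt_next a
    have hins : (hC.finite_verts_Ico a b).toFinset =
        insert a (hC.finite_verts_Ico (hC.next a) b).toFinset := by
      ext t
      simp only [Finite.mem_toFinset, Finset.mem_insert, mem_inter_iff, mem_Ico]
      constructor
      · rintro ⟨h1, h2, h3⟩
        rcases h2.eq_or_lt with rfl | h2
        · exact Or.inl rfl
        · exact Or.inr ⟨h1, hC.next_le h2 h1, h3⟩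
      · rintro (rfl | ⟨h1, h2, h3⟩)
        · exact ⟨ha, le_rfl, hlt⟩
        · exact ⟨h1, (hlt'.trans_le h2).le, h3⟩
    have hnot : a ∉ (hC.finite_verts_Ico (hC.next a) b).toFinset := by
      simp only [Finite.mem_toFinset, mem_inter_iff, mem_Ico]
      rintro ⟨-, h, -⟩
      linarith
    rw [hins, Finset.card_insert_of_notMem hnot] at hcard
    rw [hins, Finset.sum_insert hnot, ih _ (hC.next_mem a) hnb (by omega), hQ]

end CuspGroup

end HypGeom

/-! ### Side pairings and the loop around the cusp -/

namespace HypGeom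

namespace CuspGroup

variable {Γ : Subgroup SL(2, ℝ)} {w y₀ : ℝ}

lemma mem_verts_iff_of_smul (hC : CuspGroup Γ w y₀) {γ : SL(2, ℝ)} (hγ : γ ∈ Γ) {x y : ℝ}
    (h : γ • hC.v x = hC.v y) : x ∈ hC.verts ↔ y ∈ hC.verts := hC.vert_smul_iff hγ h

lemma add_mem_verts_iff (hC : CuspGroup Γ w y₀) (x : ℝ) (n : ℤ) :
    x + n * w ∈ hC.verts ↔ x ∈ hC.verts := by
  obtain ⟨p, hp, hpw⟩ := hC.per n
  exact (hC.mem_verts_iff_of_smul hp (by rw [hpw, v_add])).symm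

/-- The side of the Ford domain over `[x, next x]` is glued to the side that begins over `x'`. -/
def Paired (hC : CuspGroup Γ w y₀) (x x' : ℝ) : Prop :=
  ∃ γ ∈ Γ, ∃ κ : ℝ, (∀ t ∈ Icc x (hC.next x), γ • hC.v t = hC.v (κ - t)) ∧
    x' = κ - hC.next x ∧ x' ∈ hC.verts ∧ hC.next x' = κ - x

/-- The element whose circle carries the side maps it, reversed, to another side, since vertices go
to vertices. A translation by a multiple of w brings the new left end into [a, a + w). -/
lemma exists_paired (hC : CuspGroup Γ w y₀) (a : ℝ) {x : ℝ} (hx : x ∈ hC.verts) :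
    ∃ x' ∈ Ico a (a + w), hC.Paired x x' := by
  obtain ⟨η, hη, hηc, hηt⟩ := hC.exists_edge (hC.lt_next x) fun t htt ↦ hC.notMem_of_lt_next htt
  set κ₀ := (η 0 0 - η 1 1) / η 1 0 with hκ₀
  have hlt := hC.lt_next x
  set n := -toIcoDiv hC.pos a (κ₀ - hC.next x) with hn
  obtain ⟨p, hp, hpw⟩ := hC.per n
  have hmap : ∀ t ∈ Icc x (hC.next x), (p * η) • hC.v t = hC.v (κ₀ + n * w - t) := by
    intro t htt
    rw [mul_smul, hC.smul_v_of_c hη hηc (hηt t htt), hpw, ← v_add]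
    congr 1
    ring
  have hpη := mul_mem hp hη
  have hmem : ∀ t ∈ Icc x (hC.next x), t ∈ hC.verts ↔ κ₀ + n * w - t ∈ hC.verts :=
    fun t htt ↦ hC.mem_verts_iff_of_smul hpη (hmap t htt)
  refine ⟨κ₀ + n * w - hC.next x, ?_, p * η, hpη, κ₀ + n * w, hmap, rfl, ?_, ?_⟩
  · have := sub_toIcoDiv_zsmul_mem_Ico hC.pos a (κ₀ - hC.next x)
    rw [zsmul_eq_mul] at this
    convert this using 1
    rw [hn]
    push_cast
    ring
  · exact (hmem _ ⟨hlt.le, le_rfl⟩).1 (hC.next_mem x)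
  · refine hC.next_eq (by linarith) ((hmem x ⟨le_rfl, hlt.le⟩).1 hx) fun t htt ht ↦ ?_
    have h1 : κ₀ + n * w - t ∈ Ioo x (hC.next x) := ⟨by linarith [htt.2], by linarith [htt.1]⟩
    refine hC.notMem_of_lt_next h1 ((hmem _ (Ioo_subset_Icc_self h1)).2 ?_)
    rwa [sub_sub_cancel]

/-- A reversed side glued to itself would have its point over the midpoint fixed, against freeness.
-/
lemma Paired.ne (hC : CuspGroup Γ w y₀) {x x' : ℝ} (h : hC.Paired x x') : x' ≠ x := by
  rintro rfl
  obtain ⟨γ, hγ, κ, hmap, he, -, -⟩ := h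
  have hlt := hC.lt_next x'
  have h1 := hmap ((x' + hC.next x') / 2) ⟨by linarith, by linarith⟩
  have e1 : κ - (x' + hC.next x') / 2 = (x' + hC.next x') / 2 := by linarith
  rw [e1] at h1
  have h2 := hmap x' ⟨le_rfl, hlt.le⟩
  rw [hC.pf.free γ hγ _ h1 (hC.v x')] at h2
  have h3 := congrArg UpperHalfPlane.re h2
  rw [v_re, v_re] at h3
  linarith

/-- The composite of the two pairings agrees with a horizontal translation at both ends of the side,
so it is one, by a multiple of w. Both abscissas lie in one half-open period, so the multiple is 0.
-/
lemma Paired.eq (hC : CuspGroup Γ w y₀) {a x x' x'' : ℝ} (h : hC.Paired x x')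
    (h' : hC.Paired x' x'') (hx : x ∈ Ico a (a + w)) (hx'' : x'' ∈ Ico a (a + w)) : x'' = x := by
  obtain ⟨γ, hγ, κ, hmap, he, -, hnext⟩ := h
  obtain ⟨γ', hγ', κ', hmap', he', -, -⟩ := h'
  have hlt := hC.lt_next x
  rw [hnext] at he' hmap'
  have hcomp : ∀ t ∈ Icc x (hC.next x), (γ' * γ) • hC.v t = trn (κ' - κ) • hC.v t := by
    intro t htt
    have h1 : (γ' * γ) • hC.v t = hC.v (t + (κ' - κ)) := by
      rw [mul_smul, hmap t htt, hmap' _ ⟨by linarith [htt.2], by linarith [htt.1]⟩]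
      congr 1
      ring
    refine hext ?_ ?_
    · rw [h1, v_re, trn_re, v_re]
    · rw [trn_im, hC.im_eq_of_smul_v (mul_mem hγ' hγ) h1]
  have hfix : ∀ t ∈ Icc x (hC.next x), ((trn (κ' - κ))⁻¹ * (γ' * γ)) • hC.v t = hC.v t := by
    intro t htt
    rw [mul_smul, hcomp t htt, inv_smul_smul]
  have htriv := smul_eq_self_of_fix (hfix x ⟨le_rfl, hlt.le⟩) (hfix _ ⟨hlt.le, le_rfl⟩)
    (fun h ↦ hlt.ne (by simpa using congrArg UpperHalfPlane.re h))
  have htrn : ∀ z : ℍ, (γ' * γ) • z = trn (κ' - κ) • z := by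
    intro z
    have := htriv z
    rwa [mul_smul, inv_smul_eq_iff] at this
  obtain ⟨n, hn⟩ := hC.stab _ (mul_mem hγ' hγ) (c_eq_zero_of_trn htrn)
  have hs : κ' - κ = n * w := trn_smul_injective ((htrn I).symm.trans (hn I))
  have hd : x'' - x = n * w := by linarith
  have hw := hC.pos
  have h1 : abs ((n : ℝ) * w) < w := by
    rw [← hd, abs_lt]
    exact ⟨by linarith [hx.2, hx''.1], by linarith [hx.1, hx''.2]⟩
  rw [abs_mul, abs_of_pos hw] at h1
  have h2 : abs (n : ℝ) < 1 := by
    by_contra! h3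
    exact absurd (le_mul_of_one_le_left hw.le h3) (not_le.2 h1)
  have h3 : n = 0 := by
    rw [← Int.abs_lt_one_iff]
    exact_mod_cast h2
  rw [h3] at hd
  push_cast at hd
  linarith

/-- An additive invariant function vanishes on the loop around the cusp. -/
lemma loop_eq_zero {A : Type*} [AddCommGroup A] (hC : CuspGroup Γ w y₀) (q : ℍ → ℍ → A)
    (hadd : ∀ x y z, q x y + q y z = q x z) (hinv : ∀ γ ∈ Γ, ∀ z u, q (γ • z) (γ • u) = q z u) :
    ∃ z, q z (trn w • z) = 0 := by
  have hself : ∀ z, q z z = 0 := fun z ↦ by simpa using hadd z z z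
  set a := hC.next 0 with ha
  have haV : a ∈ hC.verts := hC.next_mem 0
  have hw := hC.pos
  have hbV : a + w ∈ hC.verts := by
    have := (hC.add_mem_verts_iff a 1).2 haV
    rwa [Int.cast_one, one_mul] at this
  have hsum := hC.sum_next (fun x y ↦ q (hC.v x) (hC.v y)) (fun x y z ↦ hadd _ _ _) hbV _ a haV
    (by linarith) rfl
  have hv : hC.v (a + w) = trn w • hC.v a := by
    have := hC.v_add a 1
    rwa [Int.cast_one, one_mul] at this
  refine ⟨hC.v a, ?_⟩
  rw [← hv, ← hsum]
  have hex : ∀ x ∈ (hC.finite_verts_Ico a (a + w)).toFinset, ∃ x' ∈ Ico a (a + w),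
      hC.Paired x x' := fun x hx ↦ hC.exists_paired a ((Finite.mem_toFinset _).1 hx).1
  choose σ hσ hσp using hex
  have hσm : ∀ x hx, σ x hx ∈ (hC.finite_verts_Ico a (a + w)).toFinset := fun x hx ↦ by
    obtain ⟨γ, hγ, κ, hmap, he, hm, hnext⟩ := hσp x hx
    exact (Finite.mem_toFinset _).2 ⟨hm, hσ x hx⟩
  -- The loop is the sum of the sides over one period. Pairing is an involution without fixed
  -- points, and paired sides are translates of each other in opposite directions.
  refine Finset.sum_involution σ ?_ ?_ hσm ?_
  · intro x hx
    obtain ⟨γ, hγ, κ, hmap, he, hm, hnext⟩ := hσp x hx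
    have hlt := hC.lt_next x
    rw [hnext, he, ← hmap x ⟨le_rfl, hlt.le⟩, ← hmap _ ⟨hlt.le, le_rfl⟩, hinv γ hγ, hadd, hself]
  · exact fun x hx _ ↦ (hσp x hx).ne hC
  · exact fun x hx ↦ (hσp x hx).eq hC (hσp _ (hσm x hx)) ((Finite.mem_toFinset _).1 hx).2
      (hσ _ (hσm x hx))

end CuspGroup

end HypGeom

namespace HypGeom

variable {Γ : Subgroup SL(2, ℝ)}

/-! ### Parabolic elements -/

lemma trn_add_smul (s t : ℝ) (z : ℍ) : trn (s + t) • z = trn s • trn t • z :=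
  hext (by rw [trn_re, trn_re, trn_re]; ring) (by rw [trn_im, trn_im, trn_im])

lemma trn_zero_smul (z : ℍ) : trn 0 • z = z :=
  hext (by rw [trn_re, add_zero]) (trn_im _ _)

lemma trn_neg_smul (s : ℝ) (z : ℍ) : trn (-s) • z = (trn s)⁻¹ • z := by
  rw [eq_inv_smul_iff, ← trn_add_smul, add_neg_cancel, trn_zero_smul]

lemma smul_trn_of_c {γ : SL(2, ℝ)} (hc : γ 1 0 = 0) (s : ℝ) (z : ℍ) :
    γ • trn s • z = trn (γ 0 0 ^ 2 * s) • γ • z := by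
  apply hext
  · rw [re_smul_of_c hc, trn_re, trn_re, re_smul_of_c hc]
    ring
  · rw [im_smul_of_c hc, trn_im, trn_im, im_smul_of_c hc]

/-- The translations of a discrete group are bounded from below. -/
lemma ProperFree.exists_trn_bound (hΓ : ProperFree Γ) :
    ∃ a > 0, ∀ γ ∈ Γ, ∀ s : ℝ, (∀ z : ℍ, γ • z = trn s • z) → abs s < a → s = 0 := by
  obtain ⟨r, hr, h⟩ := hΓ.exists_injRadius I
  have hr1 : 0 < Real.cosh r - 1 := sub_pos.2 (Real.one_lt_cosh.2 hr.ne')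
  refine ⟨√(2 * (Real.cosh r - 1)), Real.sqrt_pos.2 (by linarith), fun γ hγ s hs hlt ↦ ?_⟩
  have hd : dist I (γ • I) < r := by
    rw [← abs_of_pos hr, ← abs_of_nonneg (dist_nonneg (x := I) (y := γ • I)), ← Real.cosh_lt_cosh,
      hs, cosh_dist_trn, I_im]
    have := Real.lt_sqrt (abs_nonneg s) |>.1 hlt
    rw [sq_abs] at this
    linarith
  have h1 := h γ hγ hd I
  rw [hs] at h1
  exact trn_smul_injective (h1.trans (trn_zero_smul I).symm)

/-- If γ scaled by a² ≠ 1, conjugating p repeatedly by γ or γ⁻¹ would produce arbitrarily short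
non-zero translations. -/
lemma ProperFree.exists_trn_of_c (hΓ : ProperFree Γ) {p : SL(2, ℝ)} {t : ℝ} (hp : p ∈ Γ)
    (ht : t ≠ 0) (hpt : ∀ z : ℍ, p • z = trn t • z) {γ : SL(2, ℝ)} (hγ : γ ∈ Γ)
    (hc : γ 1 0 = 0) : ∃ s, ∀ z : ℍ, γ • z = trn s • z := by
  have hcontr : ∀ γ ∈ Γ, γ 1 0 = 0 → γ 0 0 ^ 2 < 1 → False := by
    intro γ hγ hc hlt
    obtain ⟨a, ha, hbd⟩ := hΓ.exists_trn_bound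
    have h0 : γ 0 0 ≠ 0 := by
      intro h
      have := det_eq γ
      rw [hc, h] at this
      norm_num at this
    have hpow : ∀ n : ℕ, ∃ q ∈ Γ, ∀ z : ℍ, q • z = trn ((γ 0 0 ^ 2) ^ n * t) • z := by
      intro n
      induction n with
      | zero => exact ⟨p, hp, by simpa using hpt⟩
      | succ n ih =>
        obtain ⟨q, hq, hqz⟩ := ih
        refine ⟨γ * q * γ⁻¹, mul_mem (mul_mem hγ hq) (inv_mem hγ), fun z ↦ ?_⟩
        rw [mul_smul, mul_smul, hqz, smul_trn_of_c hc, smul_inv_smul, pow_succ']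
        congr 2
        ring
    have hlim : Filter.Tendsto (fun n : ℕ ↦ abs ((γ 0 0 ^ 2) ^ n * t)) Filter.atTop (nhds 0) := by
      have := ((tendsto_pow_atTop_nhds_zero_of_lt_one (sq_nonneg (γ 0 0)) hlt).mul_const t).abs
      rwa [zero_mul, abs_zero] at this
    obtain ⟨n, hn⟩ := (hlim.eventually_lt_const ha).exists
    obtain ⟨q, hq, hqz⟩ := hpow n
    exact mul_ne_zero (pow_ne_zero _ (pow_ne_zero 2 h0)) ht (hbd q hq _ hqz hn)
  rcases isTrans_or_isPar_of_c hc with h | ⟨g, L, hL, -, -, he⟩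
  · exact h
  exfalso
  rcases hL.lt_or_gt with h | h
  · exact hcontr γ hγ hc (he.trans_lt (Real.exp_lt_one_iff.2 h))
  · refine hcontr γ⁻¹ (inv_mem hγ) (by rw [inv_10, hc, neg_zero]) ?_
    have hd := det_eq γ
    rw [hc, mul_zero, sub_zero] at hd
    have h1 : 1 < γ 0 0 ^ 2 := by rw [he]; exact Real.one_lt_exp_iff.2 h
    have h2 : γ 0 0 ^ 2 * γ 1 1 ^ 2 = 1 := by rw [← mul_pow, hd, one_pow]
    rw [inv_00]
    nlinarith [sq_nonneg (γ 1 1)]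

/-- If a discrete group contains a translation, then the stabilizer of `∞` is an infinite
cyclic group of translations. -/
lemma ProperFree.exists_width (hΓ : ProperFree Γ) {p : SL(2, ℝ)} {t : ℝ} (hp : p ∈ Γ)
    (ht : t ≠ 0) (hpt : ∀ z : ℍ, p • z = trn t • z) :
    ∃ w > 0, (∀ n : ℤ, ∃ p ∈ Γ, ∀ z : ℍ, p • z = trn (n * w) • z) ∧
      ∀ γ ∈ Γ, γ 1 0 = 0 → ∃ n : ℤ, ∀ z : ℍ, γ • z = trn (n * w) • z := by
  obtain ⟨a, ha, hbd⟩ := hΓ.exists_trn_bound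
  let T : AddSubgroup ℝ :=
    { carrier := {s | ∃ γ ∈ Γ, ∀ z : ℍ, γ • z = trn s • z}
      add_mem' := by
        rintro s s' ⟨γ, hγ, h⟩ ⟨γ', hγ', h'⟩
        exact ⟨γ * γ', mul_mem hγ hγ', fun z ↦ by rw [mul_smul, h', h, trn_add_smul]⟩
      zero_mem' := ⟨1, one_mem Γ, fun z ↦ by rw [one_smul, trn_zero_smul]⟩
      neg_mem' := by
        rintro s ⟨γ, hγ, h⟩
        exact ⟨γ⁻¹, inv_mem hγ, fun z ↦ by
          rw [trn_neg_smul, inv_smul_eq_iff, h, smul_inv_smul]⟩ }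
  have hT : ∀ s, s ∈ T ↔ ∃ γ ∈ Γ, ∀ z : ℍ, γ • z = trn s • z := fun s ↦ Iff.rfl
  obtain ⟨b, hb⟩ := AddSubgroup.cyclic_of_isolated_zero (H := T) ha (by
    rw [Set.disjoint_left]
    rintro s ⟨γ, hγ, h⟩ ⟨h1, h2⟩
    exact h1.ne' (hbd γ hγ s h (by rwa [abs_of_pos h1])))
  have hTb : ∀ s, s ∈ T ↔ ∃ n : ℤ, n * b = s := fun s ↦ by
    rw [hb, AddSubgroup.mem_closure_singleton]
    simp only [zsmul_eq_mul]
  have hb0 : b ≠ 0 := by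
    rintro rfl
    obtain ⟨n, hn⟩ := (hTb t).1 ((hT t).2 ⟨p, hp, hpt⟩)
    exact ht (by rw [← hn, mul_zero])
  have hTw : ∀ s, s ∈ T ↔ ∃ n : ℤ, n * abs b = s := fun s ↦ by
    rw [hTb]
    rcases abs_choice b with h | h
    · rw [h]
    · rw [h]
      constructor
      · rintro ⟨n, rfl⟩
        exact ⟨-n, by push_cast; ring⟩
      · rintro ⟨n, rfl⟩
        exact ⟨-n, by push_cast; ring⟩
  refine ⟨abs b, abs_pos.2 hb0, fun n ↦ (hT _).1 ((hTw _).2 ⟨n, rfl⟩), fun γ hγ hc ↦ ?_⟩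
  obtain ⟨s, hs⟩ := hΓ.exists_trn_of_c hp ht hpt hγ hc
  obtain ⟨n, rfl⟩ := (hTw s).1 ((hT s).2 ⟨γ, hγ, hs⟩)
  exact ⟨n, hs⟩

lemma IsPar.isCusp {δ g : SL(2, ℝ)} {x : ℝ} (hδ : δ ∈ Γ) (hx : x ≠ 0) (h : IsPar δ g x) :
    IsCusp (Matrix.SpecialLinearGroup.mapGL ℝ g • (OnePoint.infty : OnePoint ℝ))
      (Γ.map (Matrix.SpecialLinearGroup.mapGL ℝ)) := by
  have h1 : ∀ z : ℍ, ((trn x)⁻¹ * (g⁻¹ * δ * g)) • z = z := fun z ↦ by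
    rw [mul_smul, mul_smul, mul_smul, h, inv_smul_smul, inv_smul_smul]
  set m := g⁻¹ * δ * g with hm
  have hmt : m = trn x ∨ m = -trn x := by
    rcases eq_one_or_eq_neg_one h1 with h2 | h2
    · exact Or.inl (inv_mul_eq_one.1 h2).symm
    · rw [inv_mul_eq_iff_eq_mul, mul_neg, mul_one] at h2
      exact Or.inr h2
  have hm10 : m 1 0 = 0 := by
    rcases hmt with h | h <;> simp [h, neg_apply']
  have hδm : δ = g * m * g⁻¹ := by rw [hm]; group
  refine ⟨Matrix.SpecialLinearGroup.mapGL ℝ δ, ⟨δ, hδ, rfl⟩, ?_, ?_⟩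
  · rw [hδm, map_mul, map_mul, map_inv, Matrix.GeneralLinearGroup.isParabolic_conj_iff,
      Matrix.GeneralLinearGroup.isParabolic_iff_of_upperTriangular (by exact hm10)]
    change m 0 0 = m 1 1 ∧ m 0 1 ≠ 0
    rcases hmt with h | h <;> simp [h, neg_apply', hx]
  · rw [hδm, map_mul, map_mul, map_inv, mul_smul, mul_smul, inv_smul_smul,
      OnePoint.smul_infty_eq_self_iff.2 (by exact hm10)]

/-- If there is at most one cusp, then all parabolic elements are conjugate to translations
of one fixed parabolic element's axis. -/
lemma IsPar.exists_conj (hcusp : HypSurface.AtMostOneCusp Γ) {δ g δ' g' : SL(2, ℝ)} {x x' : ℝ}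
    (hδ : δ ∈ Γ) (hx : x ≠ 0) (h : IsPar δ g x) (hδ' : δ' ∈ Γ) (hx' : x' ≠ 0)
    (h' : IsPar δ' g' x') : ∃ γ ∈ Γ, ∃ s ≠ 0, IsPar (γ * δ' * γ⁻¹) g s := by
  obtain ⟨γ, hγ, he⟩ := hcusp _ _ (h'.isCusp hδ' hx') (h.isCusp hδ hx)
  -- k fixes ∞, so it conjugates horizontal translations to horizontal translations.
  set k := g⁻¹ * γ * g' with hk
  have hk10 : k 1 0 = 0 := by
    have : Matrix.SpecialLinearGroup.mapGL ℝ k • (OnePoint.infty : OnePoint ℝ) =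
        OnePoint.infty := by
      rw [hk, map_mul, map_mul, map_inv, mul_smul, mul_smul, he, inv_smul_smul]
    exact OnePoint.smul_infty_eq_self_iff.1 this
  have hk00 : k 0 0 ≠ 0 := by
    intro h
    have := det_eq k
    rw [hk10, h] at this
    norm_num at this
  refine ⟨γ, hγ, k 0 0 ^ 2 * x', mul_ne_zero (pow_ne_zero 2 hk00) hx', fun z ↦ ?_⟩
  have hkz : ∀ z : ℍ, g • k • z = γ • g' • z := fun z ↦ by
    rw [hk, mul_smul, mul_smul, smul_inv_smul]
  obtain ⟨u, rfl⟩ : ∃ u, z = k • u := ⟨k⁻¹ • z, (smul_inv_smul k z).symm⟩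
  rw [← smul_trn_of_c hk10, hkz, hkz, mul_smul, mul_smul, inv_smul_smul, h']

/-- In a group of finite coarea with a single cusp, the cusp can be moved to `∞`. -/
lemma IsPar.exists_cuspGroup (hΓ : ProperFree Γ) (harea : HypSurface.area Γ < ⊤)
    (hcusp : HypSurface.AtMostOneCusp Γ) {δ g : SL(2, ℝ)} {x : ℝ} (hδ : δ ∈ Γ) (hx : x ≠ 0)
    (h : IsPar δ g x) : ∃ w y₀, CuspGroup (conjGroup Γ g) w y₀ := by
  have hpf := hΓ.conj g
  obtain ⟨w, hw, hper, hstab⟩ := hpf.exists_width (mem_conjGroup'.2 hδ) hx fun z ↦ by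
    rw [mul_smul, mul_smul, h, inv_smul_smul]
  obtain ⟨R, hR⟩ := hΓ.thick_thin harea
  have hch : 0 < Real.cosh (1 / 32) - 1 := sub_pos.2 (Real.one_lt_cosh.2 (by norm_num))
  -- y₁ serves points that Γ moves near i. y₂ serves points moved less than 1/32 by a parabolic
  -- element, which is conjugate to a translation by at least w.
  set y₁ := (g⁻¹ • I).im / Real.exp R with hy₁
  set y₂ := w / √(2 * (Real.cosh (1 / 32) - 1)) with hy₂
  have hy₁p : 0 < y₁ := div_pos (im_pos _) (Real.exp_pos _)
  have hy₂p : 0 < y₂ := div_pos hw (Real.sqrt_pos.2 (by linarith))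
  refine ⟨w, min y₁ y₂, hpf, hw, hper, hstab, lt_min hy₁p hy₂p, fun z ↦ ?_⟩
  rcases hR (g • z) with ⟨γ, hγ, hd⟩ | ⟨δ', hδ', g', x', hx', h', hd⟩
  · refine ⟨g⁻¹ * γ * g, mem_conjGroup'.2 hγ, (min_le_left _ _).trans ?_⟩
    rw [← dist_smul' g⁻¹] at hd
    have h1 := im_div_exp_dist_le (g⁻¹ • I) (g⁻¹ • γ • g • z)
    rw [mul_smul, mul_smul]
    refine le_trans ?_ h1
    exact div_le_div_of_nonneg_left (im_pos _).le (Real.exp_pos _) (Real.exp_le_exp.2 hd)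
  · obtain ⟨γ, hγ, s, hs, hpar⟩ := IsPar.exists_conj hcusp hδ hx h hδ' hx' h'
    refine ⟨g⁻¹ * γ * g, mem_conjGroup'.2 hγ, (min_le_right _ _).trans ?_⟩
    set u := (g⁻¹ * γ * g) • z with hu
    set ε := g⁻¹ * (γ * δ' * γ⁻¹) * g with hε
    have hεs : ∀ z : ℍ, ε • z = trn s • z := fun z ↦ by
      rw [hε, mul_smul, mul_smul, hpar, inv_smul_smul]
    have hεΓ : ε ∈ conjGroup Γ g := mem_conjGroup'.2 (mul_mem (mul_mem hγ hδ') (inv_mem hγ))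
    obtain ⟨n, hn⟩ := hstab ε hεΓ (c_eq_zero_of_trn hεs)
    have hsn : s = n * w := trn_smul_injective ((hεs I).symm.trans (hn I))
    have hn0 : n ≠ 0 := by
      rintro rfl
      exact hs (by rw [hsn]; simp)
    have hn1 : (1 : ℝ) ≤ n ^ 2 := by
      have : 0 < n ^ 2 := sq_pos_iff.2 hn0
      exact_mod_cast this
    have hdu : dist u (trn s • u) = dist (g • z) (δ' • g • z) := by
      have e1 : u = g⁻¹ • γ • g • z := by rw [hu, mul_smul, mul_smul]
      have e2 : ε • u = g⁻¹ • γ • δ' • g • z := by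
        rw [hε, e1]
        simp only [mul_smul, smul_inv_smul, inv_smul_smul]
      rw [← hεs, e2, e1, dist_smul' g⁻¹, dist_smul' γ]
    rw [← hdu, ← abs_of_nonneg (dist_nonneg (x := u)), ← abs_of_pos (show (0 : ℝ) < 1 / 32 by norm_num),
      ← Real.cosh_lt_cosh, cosh_dist_trn] at hd
    have hup := u.im_pos
    rw [hy₂, div_le_iff₀ (Real.sqrt_pos.2 (by linarith)), ← abs_of_pos hw,
      ← abs_of_pos (mul_pos hup (Real.sqrt_pos.2 (show 0 < 2 * (Real.cosh (1 / 32) - 1) by linarith))),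
      ← sq_le_sq, mul_pow, Real.sq_sqrt (by linarith)]
    have h2 : s ^ 2 / (2 * u.im ^ 2) ≤ Real.cosh (1 / 32) - 1 := by linarith
    rw [div_le_iff₀ (by positivity)] at h2
    have h3 : w ^ 2 ≤ s ^ 2 := by
      rw [hsn, mul_pow]
      exact le_mul_of_one_le_left (sq_nonneg w) hn1
    linarith

end HypGeom

/-! ### Translations at the cusp, and geodesics meeting a compact set -/

namespace HypGeom

/-- An additive invariant function vanishes on all translations in the stabilizer of the cusp. -/
lemma CuspGroup.trn_eq_zero {A : Type*} [AddCommGroup A] {Γ : Subgroup SL(2, ℝ)} {w y₀ : ℝ}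
    (hC : CuspGroup Γ w y₀) (q : ℍ → ℍ → A)
    (hadd : ∀ x y z, q x y + q y z = q x z) (hinv : ∀ γ ∈ Γ, ∀ z u, q (γ • z) (γ • u) = q z u)
    (n : ℤ) (z : ℍ) : q z (trn (n * w) • z) = 0 := by
  have hself : ∀ z, q z z = 0 := fun z ↦ by simpa using hadd z z z
  obtain ⟨z₀, hz₀⟩ := hC.loop_eq_zero q hadd hinv
  obtain ⟨p, hp, hpw⟩ := hC.per 1
  rw [Int.cast_one, one_mul] at hpw
  -- By invariance the value does not depend on the base point, so vanishing at z₀ suffices.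
  have h1 : ∀ z, q z (trn w • z) = 0 := fun z ↦ by
    rw [← hadd z z₀, ← hadd z₀ (trn w • z₀), hz₀, zero_add, ← hpw, ← hpw, hinv p hp, hadd, hself]
  induction n with
  | zero => rw [Int.cast_zero, zero_mul, trn_zero_smul, hself]
  | succ n ih =>
    have e : ((n + 1 : ℤ) : ℝ) * w = w + ((n : ℤ) : ℝ) * w := by push_cast; ring
    rw [e, trn_add_smul, ← hadd z (trn (((n : ℤ) : ℝ) * w) • z), ih, h1, zero_add]
  | pred n ih =>
    have e : ((-n : ℤ) : ℝ) * w = w + ((-n - 1 : ℤ) : ℝ) * w := by push_cast; ring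
    rw [e, trn_add_smul, ← hadd z (trn (((-n - 1 : ℤ) : ℝ) * w) • z), h1, add_zero] at ih
    exact ih

/-- A geodesic contains points of arbitrarily small height. -/
lemma exists_vert_im_lt (k : SL(2, ℝ)) {y : ℝ} (hy : 0 < y) : ∃ s, (k • vert s).im < y := by
  have hd := det_eq k
  by_cases hc : k 1 0 = 0
  · have h1 : 0 < k 0 0 ^ 2 := by
      rw [sq_pos_iff]
      intro h
      rw [hc, h] at hd
      norm_num at hd
    refine ⟨Real.log (y / (2 * k 0 0 ^ 2)), ?_⟩
    rw [im_smul_of_c hc, vert_im, Real.exp_log (by positivity)]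
    have h2 : k 0 0 ^ 2 * (y / (2 * k 0 0 ^ 2)) = y / 2 := by
      rw [mul_div_assoc', mul_comm 2, mul_div_mul_left _ _ h1.ne']
    linarith
  · have h1 : 0 < k 1 0 ^ 2 := sq_pos_iff.2 hc
    refine ⟨Real.log (2 / (y * k 1 0 ^ 2)), ?_⟩
    set t := 2 / (y * k 1 0 ^ 2) with ht
    have htp : 0 < t := by positivity
    rw [im_smul, div_lt_iff₀ (denSq_pos _ _), denSq, vert_re, vert_im, Real.exp_log htp]
    have h2 : t * (y * k 1 0 ^ 2) = 2 := by rw [ht]; field_simp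
    have h3 : y * (k 1 0 * t) ^ 2 = 2 * t := by rw [← h2]; ring
    have h4 : 0 ≤ y * (k 1 0 * 0 + k 1 1) ^ 2 := by positivity
    linarith

variable {Γ : Subgroup SL(2, ℝ)}

/-- All geodesics meet a bounded set up to the group. -/
lemma CuspGroup.exists_vert_dist_le {w y₀ : ℝ} (hC : CuspGroup Γ w y₀) :
    ∃ R, ∀ k : SL(2, ℝ), ∃ s, ∃ γ ∈ Γ, dist I (γ • k • vert s) ≤ R := by
  have hy := hC.y_pos
  have hw := hC.pos
  refine ⟨1 + (w ^ 2 + (1 - y₀) ^ 2) / (2 * 1 * y₀), fun k ↦ ?_⟩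
  obtain ⟨γ, hγ, hdeep⟩ := hC.deep (k • vert 0)
  rw [← mul_smul] at hdeep
  obtain ⟨s₁, hs₁⟩ := exists_vert_im_lt (γ * k) hy
  have hcont : Continuous fun s ↦ ((γ * k) • vert s).im :=
    UpperHalfPlane.continuous_im.comp (continuous_vert.const_smul _)
  -- After applying γ, the geodesic has a point of height at least y₀ and others of small height, so
  -- it crosses height y₀ exactly. The horizontal translations make that horocycle compact.
  obtain ⟨s, hs⟩ : ∃ s, ((γ * k) • vert s).im = y₀ :=
    mem_range_of_exists_le_of_exists_ge hcont ⟨s₁, hs₁.le⟩ ⟨0, hdeep⟩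
  set u := (γ * k) • vert s with hu
  obtain ⟨p, hp, hpw⟩ := hC.per (-⌊u.re / w⌋)
  refine ⟨s, p * γ, mul_mem hp hγ, ?_⟩
  have e : (p * γ) • k • vert s = p • u := by rw [hu, mul_smul, mul_smul]
  have h7 : dist I (p • u) ≤ Real.cosh (dist I (p • u)) :=
    (Real.self_le_sinh_iff.2 dist_nonneg).trans (Real.sinh_lt_cosh _).le
  rw [e]
  refine h7.trans ?_
  have hre : (p • u).re = Int.fract (u.re / w) * w := by
    rw [hpw, trn_re, Int.fract, sub_mul, div_mul_cancel₀ _ hw.ne']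
    push_cast
    ring
  have hre2 : (p • u).re ^ 2 ≤ w ^ 2 := by
    rw [hre, mul_pow]
    exact mul_le_of_le_one_left (sq_nonneg w)
      (pow_le_one₀ (Int.fract_nonneg _) (Int.fract_lt_one _).le)
  have him : (p • u).im = y₀ := by rw [hpw, trn_im, hs]
  rw [cosh_dist_eq, I_re, I_im, him, zero_sub, neg_sq]
  gcongr

/-- On a surface of finite area with at most one cusp, all geodesics meet a compact set. -/
lemma ProperFree.exists_vert_dist_le (hΓ : ProperFree Γ) (harea : HypSurface.area Γ < ⊤)
    (hcusp : HypSurface.AtMostOneCusp Γ) :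
    ∃ R, ∀ k : SL(2, ℝ), ∃ s, ∃ γ ∈ Γ, dist I (γ • k • vert s) ≤ R := by
  by_cases hpar : ∃ δ ∈ Γ, ∃ g x, x ≠ 0 ∧ IsPar δ g x
  · obtain ⟨δ, hδ, g, x, hx, h⟩ := hpar
    obtain ⟨w, y₀, hC⟩ := h.exists_cuspGroup hΓ harea hcusp hδ hx
    obtain ⟨R, hR⟩ := hC.exists_vert_dist_le
    refine ⟨dist I (g • I) + R, fun k ↦ ?_⟩
    obtain ⟨s, γ, hγ, hd⟩ := hR (g⁻¹ * k)
    refine ⟨s, g * γ * g⁻¹, mem_conjGroup.1 hγ, ?_⟩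
    have h1 := dist_triangle I (g • I) ((g * γ * g⁻¹) • k • vert s)
    rw [mul_smul, mul_smul, dist_smul' g, ← mul_smul g⁻¹] at h1
    rw [mul_smul, mul_smul, ← mul_smul g⁻¹]
    linarith
  · obtain ⟨R, hR⟩ := hΓ.thick_thin harea
    refine ⟨R, fun k ↦ ⟨0, ?_⟩⟩
    rcases hR (k • vert 0) with ⟨γ, hγ, h⟩ | ⟨δ, hδ, g, x, hx, h, -⟩
    · exact ⟨γ, hγ, h⟩
    · exact absurd ⟨δ, hδ, g, x, hx, h⟩ hpar

end HypGeom

/-! ### Finiteness of translation lengths and vanishing of parabolic classes -/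

namespace HypSurface

open HypGeom

variable {Γ : Subgroup SL(2, ℝ)}

/-- There are finitely many lengths of closed geodesics below each bound. -/
lemma finite_transLengths (hΓ : ProperFree Γ) (harea : area Γ < ⊤) (hcusp : AtMostOneCusp Γ)
    (M : ℝ) : (transLengths Γ ∩ Iic M).Finite := by
  obtain ⟨R, hR⟩ := hΓ.exists_vert_dist_le harea hcusp
  refine (finite_lengths (hΓ.finite (2 * R + M))).subset ?_
  rintro L ⟨⟨hL, γ, hγ, g, hg⟩, hLM⟩
  -- Conjugate so that the axis passes within R of i. The conjugate then moves i by at most 2R + M,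
  -- which leaves finitely many elements.
  obtain ⟨s, δ, hδ, hd⟩ := hR g
  refine ⟨hL, δ * γ * δ⁻¹, ⟨mul_mem (mul_mem hδ hγ) (inv_mem hδ), ?_⟩, δ * g, hg.conj δ⟩
  have h1 := dist_triangle4 I (δ • g • vert s) ((δ * γ * δ⁻¹) • δ • g • vert s)
    ((δ * γ * δ⁻¹) • I)
  have h2 : dist (δ • g • vert s) ((δ * γ * δ⁻¹) • δ • g • vert s) = L := by
    rw [mul_smul, mul_smul, inv_smul_smul, dist_smul' δ, hg.dist_vert hL.le]
  rw [h2, dist_smul' (δ * γ * δ⁻¹), dist_comm _ I] at h1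
  have : L ≤ M := hLM
  linarith

/-- The loop around the only cusp is null-homologous. -/
lemma cls_eq_zero_of_isPar (hΓ : ProperFree Γ) (harea : area Γ < ⊤) (hcusp : AtMostOneCusp Γ)
    {δ g : SL(2, ℝ)} {x : ℝ} (hδ : δ ∈ Γ) (hx : x ≠ 0) (h : IsPar δ g x) : cls Γ δ = 0 := by
  obtain ⟨w, y₀, hC⟩ := h.exists_cuspGroup hΓ harea hcusp hδ hx
  have hm : ∀ z : ℍ, (g⁻¹ * δ * g) • z = trn x • z := fun z ↦ by
    rw [mul_smul, mul_smul, h, inv_smul_smul]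
  obtain ⟨n, hn⟩ := hC.stab _ (mem_conjGroup'.2 hδ) (c_eq_zero_of_trn hm)
  apply h1Incl_injective
  rw [map_zero, h1Incl_cls hδ (g • I), h, ← hm, hn]
  -- Transporting q by g makes it invariant under the conjugated group, whose cusp is at ∞.
  refine hC.trn_eq_zero (fun z u ↦ q Γ (g • z) (g • u)) (fun _ _ _ ↦ q_add _ _ _)
    (fun γ hγ z u ↦ ?_) n I
  have := q_smul (mem_conjGroup.1 hγ) (g • z) (g • u)
  simpa only [mul_smul, inv_smul_smul] using this

lemma isTrans_or_cls_eq_zero (hΓ : ProperFree Γ) (harea : area Γ < ⊤) (hcusp : AtMostOneCusp Γ)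
    (γ : SL(2, ℝ)) (hγ : γ ∈ Γ) : (∃ g L, 0 < L ∧ IsTrans γ g L) ∨ cls Γ γ = 0 := by
  rcases classification γ with ⟨z, hz⟩ | h | ⟨g, x, hx, h⟩
  · exact Or.inr (cls_eq_zero hγ hz)
  · exact Or.inl h
  · exact Or.inr (cls_eq_zero_of_isPar hΓ harea hcusp hγ hx h)

end HypSurface

end

theorem mainTheorem4 (Γ : Subgroup SL(2, ℝ)) (hΓ : HypSurface.IsSurfaceGroup Γ)
    (harea : HypSurface.area Γ < ⊤) (hcusp : HypSurface.AtMostOneCusp Γ)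
    (h : SingularH1 (HypSurface Γ)) (hh : h ≠ 0) :
    (∃ m : Multicurve (HypSurface Γ), m.IsMinimalFor h ∧ m.length < ⊤ ∧
      m.IsEmbedded ∧ ∀ i, IsClosedGeodesic (m.component i)) ∧
    ∀ m : Multicurve (HypSurface Γ), m.IsMinimalFor h →
      (∀ i, ∃ s t, m.component i s ≠ m.component i t) →
      m.IsEmbedded ∧ ∀ i, IsClosedGeodesicUpToParam (m.component i) := by
  have hpf := hΓ.properFree
  exact ⟨HypSurface.exists_isMinimalFor hpf (HypSurface.isTrans_or_cls_eq_zero hpf harea hcusp)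
    (HypSurface.finite_transLengths hpf harea hcusp) h, fun m hm hc ↦ hm.isEmbedded hpf hc⟩
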